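/- Let $\mathbb T=\mathbb R/2\pi\mathbb Z$ and $\mathbb T^2=\mathbb T_x\times\mathbb T_y$. Let $V\in C^\infty(\mathbb T)$ satisfy $V(0)=V'(0)=0$, $V''(0)=2$ and $V>0$ on $\mathbb T\setminus\{0\}$, and let $\Delta_G=\partial_x^2+V(x)\partial_y^2$. Let $\nu>1$, $0<\rho<1$ and $y_0>0$ with $y_0+\rho<\pi$, and let $b=b(y)\in W^{1,\infty}(\mathbb T^2)$ be of the form $$b(y)=\begin{cases}0,&|y|\le y_0,\\ (|y|-y_0)^\nu,& y_0\le|y|<y_0+\rho,\\ c(|y|),& y_0+\rho<|y|<\pi,\end{cases}$$ for some positive function $c$. Put $P_h=-h^2\Delta_G+ihb(y)$ on $L^2(\mathbb T^2)$, with domain $\{\psi\in L^2(\mathbb T^2):\Delta_G\psi\in L^2(\mathbb T^2)\}$, where $\Delta_G\psi$ is taken in the sense of distributions. Then there are constants $C_1>0$, depending only on $\nu$, $C_0>0$, depending only on $\nu$ and $y_0$, and $C>0$, depending only on $\nu,y_0,\rho,V,b$, such that for every function $h\mapsto\beta_h$ with $$0\le\beta_h\le C_1h\log\tfrac1h,\qquad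 h\in(0,1],$$ and for each choice of sign $\pm$, there is a family $(\psi_h^\pm)_{h\in(0,1]}$ in the domain of $P_h$ with $$\|\psi_h^\pm\|_{L^2}=1,\qquad \big\|(P_h-1-ih\beta_h)\psi_h^\pm\big\|_{L^2}\le C\,h^2\exp\Big(-\frac{C_0\beta_h}{h}\Big),\qquad h\in(0,1],$$ and with the following two properties. (i) For every real-valued $\chi_0\in C_c^\infty((-1,1))$ with $\chi_0(\eta)=1$ for $|\eta|\le\frac12$, put $\Upsilon_R(\eta)=\chi_0(\eta/R)-\chi_0(R\eta)$ and $D_y=\frac1i\partial_y$. Then $$\lim_{R\to\infty}\,\lim_{h\to0^+}\big\|\Upsilon_R(h^2D_y)\psi_h^\pm\big\|_{L^2(\mathbb T^2)}=1,$$ where the inner limit exists for all sufficiently large $R$. (ii) If $\beta_h/h\to\infty$ as $h\to0^+$, then $|\psi_h^\pm|^2\rightharpoonup^\star\delta_{(0,\pm y_0)}$ as $h\to0^+$, that is, $\int_{\mathbb T^2}a\,|\psi_h^\pm|^2\,dx\,dy\to a(0,\pm y_0)$ for every continuous $a:\mathbb T^2\to\mathbb R$. -/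

import Mathlib

open MeasureTheory Filter Topology
open scoped ContDiff ENNReal

instance twoPiPosFact : Fact (0 < 2 * Real.pi) := ⟨Real.two_pi_pos⟩

/-- The circle `ℝ / 2πℤ`, with Lebesgue measure of total mass `2π`. -/
abbrev Circ : Type := AddCircle (2 * Real.pi)

/-- The flat torus `ℝ² / (2πℤ)²`, with Lebesgue measure `dx dy`. -/
abbrev Torus : Type := Circ × Circ

/-- The partial derivative in `x` of a function on the torus. -/
noncomputable def dX (f : Torus → ℂ) (p : Torus) : ℂ :=
  deriv (fun s : ℝ => f (p.1 + (s : Circ), p.2)) 0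

/-- The partial derivative in `y` of a function on the torus. -/
noncomputable def dY (f : Torus → ℂ) (p : Torus) : ℂ :=
  deriv (fun s : ℝ => f (p.1, p.2 + (s : Circ))) 0

/-- Smooth functions on the torus: those whose doubly periodic lift to `ℝ²` is smooth. -/
def SmoothOnTorus (f : Torus → ℂ) : Prop :=
  ContDiff ℝ ∞ (fun q : ℝ × ℝ => f ((q.1 : Circ), (q.2 : Circ)))

/-- The Baouendi-Grushin operator `∂ₓ² + V(x) ∂_y²` acting on smooth functions. -/
noncomputable def grushin (V : Circ → ℝ) (f : Torus → ℂ) (p : Torus) : ℂ :=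
  dX (dX f) p + (V p.1 : ℂ) * dY (dY f) p

/-- `g = (∂ₓ² + V(x) ∂_y²) u` in the sense of distributions on the torus
(the operator is formally symmetric with real coefficients, hence its own transpose). -/
def IsWeakGrushin (V : Circ → ℝ) (u g : Torus → ℂ) : Prop :=
  ∀ φ : Torus → ℂ, SmoothOnTorus φ → ∫ p, u p * grushin V φ p = ∫ p, g p * φ p

/-- Membership in `W^{1,∞}` of the torus, through weak derivatives. -/
def MemW1Infty (f : Torus → ℝ) : Prop :=
  MemLp f ∞ volume ∧
  ∃ gx gy : Torus → ℝ, MemLp gx ∞ volume ∧ MemLp gy ∞ volume ∧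
    ∀ φ : Torus → ℂ, SmoothOnTorus φ →
      (∫ p, (f p : ℂ) * dX φ p = - ∫ p, (gx p : ℂ) * φ p) ∧
      (∫ p, (f p : ℂ) * dY φ p = - ∫ p, (gy p : ℂ) * φ p)

/-- The coefficient of the Baouendi-Grushin operator: smooth, `2π`-periodic, with
`V(0) = V'(0) = 0`, `V''(0) = 2`, and positive away from `0`. -/
structure IsGrushinPotential (V : Circ → ℝ) : Prop where
  smooth : ContDiff ℝ ∞ (fun x : ℝ => V (x : Circ))
  zero : V 0 = 0
  deriv_zero : deriv (fun x : ℝ => V (x : Circ)) 0 = 0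
  second_deriv_zero : iteratedDeriv 2 (fun x : ℝ => V (x : Circ)) 0 = 2
  pos : ∀ x : Circ, x ≠ 0 → 0 < V x

/-- The widely undamped profile: `b = 0` for `|y| ≤ y₀`, `b = (|y| - y₀)^ν` for
`y₀ ≤ |y| < y₀ + ρ`, and `b = c(|y|)` with `c` positive for `y₀ + ρ < |y| < π`. -/
def IsWidelyUndampedProfile (ν y₀ ρ : ℝ) (b : Circ → ℝ) : Prop :=
  (∀ y : ℝ, |y| ≤ y₀ → b (y : Circ) = 0) ∧
  (∀ y : ℝ, y₀ ≤ |y| → |y| < y₀ + ρ → b (y : Circ) = (|y| - y₀) ^ ν) ∧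
  ∃ c : ℝ → ℝ, (∀ s : ℝ, y₀ + ρ < s → s < Real.pi → 0 < c s) ∧
    ∀ y : ℝ, y₀ + ρ < |y| → |y| < Real.pi → b (y : Circ) = c |y|

/-- The value of `(P_h - 1 - i h β) ψ`, where `P_h = -h² Δ_G + i h b(y)` and `g` stands
for the distribution `Δ_G ψ`, which is to be a function. -/
noncomputable def quasimodeResidual (h β : ℝ) (b : Circ → ℝ) (ψ g : Torus → ℂ)
    (p : Torus) : ℂ :=
  (-(h : ℂ) ^ 2 * g p + Complex.I * (h : ℂ) * (b p.2 : ℂ) * ψ p)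
    - ψ p - Complex.I * (h : ℂ) * (β : ℂ) * ψ p

/-- `ψ ∈ L²` is a normalized quasimode of `P_h = -h² Δ_G + i h b(y)` at `1 + i h β` with
width `r`: it lies in the (maximal) domain of `P_h`, and
`‖(P_h - 1 - i h β) ψ‖ ≤ r`. -/
def IsQuasimode (V b : Circ → ℝ) (h β r : ℝ) (ψ : Torus → ℂ) : Prop :=
  MemLp ψ 2 volume ∧ eLpNorm ψ 2 volume = 1 ∧
  ∃ g : Torus → ℂ, MemLp g 2 volume ∧ IsWeakGrushin V ψ g ∧
    eLpNorm (quasimodeResidual h β b ψ g) 2 volume ≤ ENNReal.ofReal r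

/-- The Fourier multiplier `m(t D_y)`, `D_y = -i ∂_y`, for a compactly supported `m` and
`t > 0` (the sum over the frequencies `n` is then finite): the partial Fourier coefficient
of frequency `n` in `y` is multiplied by `m(t n)`. -/
noncomputable def multY (m : ℝ → ℝ) (t : ℝ) (u : Torus → ℂ) (p : Torus) : ℂ :=
  ∑' n : ℤ, (m (t * n) : ℂ) * fourierCoeff (fun y : Circ => u (p.1, y)) n * fourier n p.2

/-- The cutoffs `χ₀ ∈ C_c^∞((-1,1))` with `χ₀ = 1` on `[-1/2, 1/2]`. -/
structure IsCutoff (χ : ℝ → ℝ) : Prop where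
  smooth : ContDiff ℝ ∞ χ
  compact_support : HasCompactSupport χ
  support_subset : tsupport χ ⊆ Set.Ioo (-1) 1
  eq_one : ∀ η : ℝ, |η| ≤ 1 / 2 → χ η = 1

/-- The annular cutoff `Υ_R(η) = χ₀(η / R) - χ₀(R η)`. -/
noncomputable def annularCutoff (χ : ℝ → ℝ) (R η : ℝ) : ℝ := χ (η / R) - χ (R * η)

/-- The mass of the family `ψ_h` concentrates in the subelliptic regime `|D_y| ~ h⁻²`:
for every cutoff `χ₀`, `lim_{R → ∞} lim_{h → 0⁺} ‖Υ_R(h² D_y) ψ_h‖ = 1`, where the inner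
limit exists for all large `R`. -/
def SubellipticConcentration (ψ : ℝ → Torus → ℂ) : Prop :=
  ∀ χ : ℝ → ℝ, IsCutoff χ →
    ∃ l : ℝ → ℝ≥0∞,
      (∀ᶠ R : ℝ in atTop,
        Tendsto (fun h : ℝ => eLpNorm (multY (annularCutoff χ R) (h ^ 2) (ψ h)) 2 volume)
          (𝓝[>] 0) (𝓝 (l R))) ∧
      Tendsto l atTop (𝓝 1)

/-- `|ψ_h|² dx dy` converges weak-* to the Dirac mass at `q` as `h → 0⁺`. -/
def DensityTendstoDirac (ψ : ℝ → Torus → ℂ) (q : Torus) : Prop :=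
  ∀ a : C(Torus, ℝ), Tendsto (fun h : ℝ => ∫ p, a p * ‖ψ h p‖ ^ 2) (𝓝[>] 0) (𝓝 (a q))

/-! Write `s = σ y - y₀`, `h = k ^ 2` and `β = h τ`. On functions `e^{-iNs} W(s)` with `N ≈ h⁻²`,
the operator `-h²Δ_G` acts in `x`, to leading order, as `h²(-∂ₓ² + N²V)`. Since `V ~ x²` at `0`,
this has an approximate ground state `A = B e^{-NS}` living at `|x| ~ h`, of energy `N - c`. The
choice `N = h⁻² + c` tunes `h²` times this energy to `1` (`exists_groundStateProfile`,
`GroundStateProfile.exists_pair`).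

A derivative falling on `W` produces `2ih²NVA W'`, which is not a multiple of `A`. Differentiating
the ground state equation in `N` shows that `D = SA = -∂_N A` solves it with right side `A - 2NVA`,
up to small errors. Adding the corrector `-i D e^{-iNs} W'` therefore turns that term into `ih²A
W'`. What remains at leading order is `ihA (hW' + (s₊^ν - β) W)`, as displayed in
`residual_identity`. So `W` should be `exp(τ s - s₊^{ν+1} / ((ν+1) h))`: it grows like `e^{τs}`
across the undamped strip up to `s = 0` and collapses in the damped region. The corrected ansatz
needs three derivatives of `W` while `s₊^ν` is only `C¹`, so the damping is averaged over a window
of length `h²` (`nonempty_smoothedPower`, `exists_envelope`).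

Cutting `W` off where `s ≤ -y₀/2` or `s ≥ ρ/2` costs a factor `e^{-τy₀/2}`. All other errors carry a
spare `k` but only the crude factor `e^τ`; the bound on `β` says `k e^{5τ} ≤ 1`, which turns that
spare `k` into the same exponential gain (`exists_ansatz`). The mass over `|x| ≤ h`, `-y₀/4 ≤ s ≤ 0`
is at least a constant times `h e^{-τy₀/2}` (`Ansatz.le_mass`), so normalizing leaves `h²
e^{-τy₀/4}` (`Ansatz.isQuasimode`).

For the frequencies, `h²D_y` is close to `-σ` on the main factor in `y`, and Parseval's identity
bounds what the annular cutoff removes (`Ansatz.eLpNorm_multY_sub_le`). For concentration, the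
density at distance `δ` from the point is `O(e^{-2δτ})`, while the mass near it is at least of order
`e^{-δτ}`, up to common factors (`Ansatz.integral_mul_normalized_sq_le`). Values of `h` bounded away
from `0` are served by a constant function. -/

/-! ### The transversal ground state in `x` and its corrector. -/

theorem exists_taylor_bound_of_grushin {v : ℝ → ℝ} (hv : ContDiff ℝ ∞ v) (h0 : v 0 = 0)
    (h1 : deriv v 0 = 0) (h2 : iteratedDeriv 2 v 0 = 2) :
    ∃ α γ C δ : ℝ, 0 < δ ∧ ∀ x : ℝ, |x| ≤ δ →
      |v x - (x ^ 2 + 2 * α * x ^ 3 + (α ^ 2 + 2 * γ) * x ^ 4)| ≤ C * |x| ^ 5 := by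
  have hT := taylor_isLittleO_univ (f := v) (x₀ := 0) (n := 5) (contDiff_infty.1 hv 5)
  have hT2 := hT.bound (c := 1) one_pos
  set a3 := iteratedDeriv 3 v 0 with ha3
  set a4 := iteratedDeriv 4 v 0 with ha4
  set a5 := iteratedDeriv 5 v 0 with ha5
  obtain ⟨δ, hδ, hb⟩ := Metric.eventually_nhds_iff.1 hT2
  -- The Taylor coefficients are parametrized so that the quartic is the square of `x + α x² + γ x³`
  -- modulo `x⁵`; this cubic will be the derivative of the phase.
  refine ⟨a3 / 12, (a4 / 24 - (a3 / 12) ^ 2) / 2, 1 + |a5| / 120, δ / 2, by positivity, ?_⟩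
  intro x hx
  have hb' := hb (y := x) (by rw [Real.dist_eq, sub_zero]; linarith)
  have hE : taylorWithinEval v 5 Set.univ 0 x =
      x ^ 2 + a3 / 6 * x ^ 3 + a4 / 24 * x ^ 4 + a5 / 120 * x ^ 5 := by
    rw [taylor_within_apply]
    simp only [Finset.sum_range_succ, Finset.sum_range_zero, iteratedDerivWithin_univ,
      iteratedDeriv_zero, iteratedDeriv_one, h0, h1, h2, smul_eq_mul, Nat.factorial, ← ha3, ← ha4,
      ← ha5]
    push_cast
    ring
  rw [hE] at hb'
  simp only [sub_zero, Real.norm_eq_abs, one_mul, abs_pow] at hb'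
  have h5 : |a5 / 120 * x ^ 5| = |a5| / 120 * |x| ^ 5 := by
    rw [abs_mul, abs_div, abs_pow]; norm_num
  calc _ = |(v x - (x ^ 2 + a3 / 6 * x ^ 3 + a4 / 24 * x ^ 4 + a5 / 120 * x ^ 5))
          + a5 / 120 * x ^ 5| := by congr 1; ring
    _ ≤ _ := abs_add_le _ _
    _ ≤ |x| ^ 5 + |a5| / 120 * |x| ^ 5 := by rw [h5]; gcongr
    _ = _ := by ring

/-- A local bound by a power of `|x|` extends to bounded intervals. -/
theorem exists_bound_pow_of_local {f : ℝ → ℝ} (hf : Continuous f) (n : ℕ) {C δ : ℝ} (hδ : 0 < δ)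
    (h : ∀ x : ℝ, |x| ≤ δ → |f x| ≤ C * |x| ^ n) :
    ∃ C' : ℝ, 0 ≤ C' ∧ ∀ x : ℝ, |x| ≤ 1 → |f x| ≤ C' * |x| ^ n := by
  obtain ⟨M, hM⟩ := (isCompact_Icc (a := (-1 : ℝ)) (b := 1)).exists_bound_of_continuousOn
    hf.continuousOn
  refine ⟨|C| + |M| / δ ^ n, by positivity, fun x hx => ?_⟩
  rcases le_or_gt |x| δ with h' | h'
  · calc |f x| ≤ C * |x| ^ n := h x h'
      _ ≤ (|C| + |M| / δ ^ n) * |x| ^ n := by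
        gcongr
        have : 0 ≤ |M| / δ ^ n := by positivity
        linarith [le_abs_self C]
  · have h3 : |f x| ≤ M := hM x (abs_le.1 hx)
    have h4 : δ ^ n ≤ |x| ^ n := by gcongr
    calc |f x| ≤ |M| := h3.trans (le_abs_self _)
      _ = |M| / δ ^ n * δ ^ n := by field_simp
      _ ≤ |M| / δ ^ n * |x| ^ n := by gcongr
      _ ≤ _ := by gcongr; linarith [abs_nonneg C]

theorem exists_bound_of_continuous_on_unit {f : ℝ → ℝ} (hf : Continuous f) :
    ∃ C' : ℝ, 0 ≤ C' ∧ ∀ x : ℝ, |x| ≤ 1 → |f x| ≤ C' := by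
  obtain ⟨M, hM⟩ := (isCompact_Icc (a := (-1 : ℝ)) (b := 1)).exists_bound_of_continuousOn
    hf.continuousOn
  exact ⟨|M|, abs_nonneg _, fun x hx => (hM x (abs_le.1 hx)).trans (le_abs_self _)⟩

/-- A phase `S` and a cut-off amplitude `B` such that `B e^{-NS}` is an approximate ground
state of `-∂ₓ² + N² v`, at energy `N - c`. -/
structure GroundStateProfile (v : ℝ → ℝ) where
  (c r C : ℝ)
  (S S1 S2 B B1 B2 : ℝ → ℝ)
  r_pos : 0 < r
  r_le : r ≤ 1
  one_le_C : 1 ≤ C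
  hasDerivAt_S : ∀ x, HasDerivAt S (S1 x) x
  hasDerivAt_S1 : ∀ x, HasDerivAt S1 (S2 x) x
  hasDerivAt_B : ∀ x, HasDerivAt B (B1 x) x
  hasDerivAt_B1 : ∀ x, HasDerivAt B1 (B2 x) x
  continuous_S2 : Continuous S2
  continuous_B2 : Continuous B2
  supp : ∀ x, r ≤ |x| → B x = 0 ∧ B1 x = 0 ∧ B2 x = 0
  le_S : ∀ x, |x| ≤ r → x ^ 2 / 4 ≤ S x
  S_le : ∀ x, |x| ≤ r → S x ≤ x ^ 2
  B_le : ∀ x, |B x| ≤ C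
  v_le : ∀ x, |x| ≤ r → |v x| ≤ C * |x| ^ 2
  eikonal : ∀ x, |x| ≤ r → |v x - S1 x ^ 2| ≤ C * |x| ^ 5
  transport : ∀ x, |x| ≤ r → |2 * S1 x * B1 x + S2 x * B x - B x| ≤ C * |x| ^ 3
  correction : ∀ x, |x| ≤ r → |B2 x - c * B x| ≤ C * |x|
  le_B : ∀ x, |x| ≤ 1 / C → 1 / 2 ≤ B x

/-- This is the WKB construction carried just far enough: at `|x| ~ N^{-1/2} ~ h`, the eikonal error
`N² x⁵`, the transport error `N x³` and the remainder `x` all have size `h`. -/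
theorem exists_groundStateProfile {v : ℝ → ℝ} (hv : ContDiff ℝ ∞ v) (h0 : v 0 = 0)
    (h1 : deriv v 0 = 0) (h2 : iteratedDeriv 2 v 0 = 2) : Nonempty (GroundStateProfile v) := by
  obtain ⟨α, γ, K, δ, hδ, hK⟩ := exists_taylor_bound_of_grushin hv h0 h1 h2
  set S : ℝ → ℝ := fun x => x ^ 2 / 2 + α * x ^ 3 / 3 + γ * x ^ 4 / 4 with hS
  set S1 : ℝ → ℝ := fun x => x + α * x ^ 2 + γ * x ^ 3 with hS1
  set S2 : ℝ → ℝ := fun x => 1 + 2 * α * x + 3 * γ * x ^ 2 with hS2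
  -- In the transport expression the coefficient `-α` of `P` kills the term of order `x`, and this
  -- `a` kills the term of order `x²`.
  set a := α ^ 2 - 3 * γ / 4 with ha
  set P : ℝ → ℝ := fun x => 1 - α * x + a * x ^ 2 with hP
  -- On `|x| ≤ r` the cubic and quartic parts of `S` are at most half of `x² / 2`, whence the
  -- two-sided quadratic bounds on `S`.
  set r : ℝ := 1 / (2 * (1 + |α| + |γ|)) with hr
  have hrpos : 0 < r := by positivity
  have hr1 : r ≤ 1 := by
    rw [hr, div_le_one (by positivity)]; linarith [abs_nonneg α, abs_nonneg γ]
  have hrag : (|α| + |γ|) * r ≤ 1 / 2 := by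
    rw [hr, mul_one_div, div_le_div_iff₀ (by positivity) (by positivity)]; linarith
  let χ : ContDiffBump (0 : ℝ) := ⟨r / 4, r / 2, by positivity, by linarith⟩
  have hχ : ContDiff ℝ ∞ (χ : ℝ → ℝ) := χ.contDiff
  set B : ℝ → ℝ := fun x => χ x * P x with hB
  have hPs : ContDiff ℝ ∞ P := by rw [hP]; fun_prop
  have hBs : ContDiff ℝ ∞ B := hχ.mul hPs
  have hB1s : ContDiff ℝ ∞ (deriv B) := hBs.iterate_deriv 1
  have hB2s : ContDiff ℝ ∞ (deriv (deriv B)) := hBs.iterate_deriv 2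
  have hBP : B =ᶠ[𝓝 0] P := by
    filter_upwards [χ.eventuallyEq_one] with x hx
    simp [hB, hx]
  have hPd : deriv P = fun x => -α + 2 * a * x := by
    funext x
    have h := (((hasDerivAt_const x (1 : ℝ)).sub ((hasDerivAt_id x).const_mul α)).add
        (((hasDerivAt_id x).pow 2).const_mul a))
    have h' : HasDerivAt P _ x := h
    rw [h'.deriv]; simp only [id]; ring
  have hPdd : deriv (deriv P) = fun _ => 2 * a := by
    rw [hPd]; funext x
    have : HasDerivAt (fun x => -α + 2 * a * x) (2 * a * 1) x :=
      ((hasDerivAt_id x).const_mul (2 * a)).const_add (-α)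
    rw [this.deriv]; ring
  have hzero : ∀ x, r ≤ |x| → B =ᶠ[𝓝 x] fun _ => 0 := by
    intro x hx
    have : {y : ℝ | r / 2 < |y|} ∈ 𝓝 x :=
      (isOpen_lt continuous_const continuous_abs).mem_nhds (by simp only [Set.mem_ofPred_eq]; linarith)
    filter_upwards [this] with y hy
    have hz : χ y = 0 := χ.zero_of_le_dist (by
      simp only [dist_zero_right, Real.norm_eq_abs]; exact le_of_lt hy)
    simp [hB, hz]
  have hloc : ∃ δ', 0 < δ' ∧ ∀ x : ℝ, |x| ≤ δ' →
      (B x = P x ∧ deriv B x = deriv P x ∧ deriv (deriv B) x = deriv (deriv P) x) ∧ 1 / 2 ≤ B x := by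
    have e1 : ∀ᶠ x in 𝓝 (0 : ℝ), (B x = P x ∧ deriv B x = deriv P x ∧
        deriv (deriv B) x = deriv (deriv P) x) ∧ 1 / 2 < B x := by
      have h3 : ∀ᶠ x in 𝓝 (0 : ℝ), 1 / 2 < B x := by
        refine hBs.continuous.continuousAt.eventually_const_lt ?_
        rw [hBP.eq_of_nhds]; simp [hP]; norm_num
      filter_upwards [hBP, hBP.deriv, hBP.deriv.deriv, h3] with x a1 a2 a3 a4
      exact ⟨⟨a1, a2, a3⟩, a4⟩
    obtain ⟨d, hd, hd'⟩ := Metric.eventually_nhds_iff.1 e1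
    refine ⟨d / 2, by positivity, fun x hx => ?_⟩
    have := hd' (y := x) (by rw [Real.dist_eq, sub_zero]; linarith)
    exact ⟨this.1, this.2.le⟩
  obtain ⟨δ', hδ', hloc⟩ := hloc
  have hvc := hv.continuous
  have hd1 := hB1s.continuous
  have hd2 := hB2s.continuous
  have hBc := hBs.continuous
  set d := min (min δ δ') 1 with hd
  have hdpos : 0 < d := by positivity
  obtain ⟨C1, hC1, hb1⟩ := exists_bound_pow_of_local (f := fun x => v x - S1 x ^ 2) (by
      rw [hS1]; fun_prop) 5 (C := K + (2 * |α * γ| + γ ^ 2)) hdpos (by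
    intro x hx
    have hx1 : |x| ≤ 1 := hx.trans (min_le_right _ _)
    have hx2 : |x| ≤ δ := hx.trans ((min_le_left _ _).trans (min_le_left _ _))
    calc |v x - S1 x ^ 2| = |(v x - (x ^ 2 + 2 * α * x ^ 3 + (α ^ 2 + 2 * γ) * x ^ 4))
          + (-(2 * (α * γ)) * x ^ 5 - γ ^ 2 * x ^ 6)| := by congr 1; simp only [hS1]; ring
      _ ≤ K * |x| ^ 5 + (2 * |α * γ| * |x| ^ 5 + γ ^ 2 * |x| ^ 6) := by
        refine (abs_add_le _ _).trans (add_le_add (hK x hx2) ((abs_sub _ _).trans (le_of_eq ?_)))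
        simp [abs_mul, abs_pow]
      _ ≤ K * |x| ^ 5 + (2 * |α * γ| * |x| ^ 5 + γ ^ 2 * |x| ^ 5) := by
        have p6 : |x| ^ 6 ≤ |x| ^ 5 := pow_le_pow_of_le_one (abs_nonneg _) hx1 (by norm_num)
        have := mul_le_mul_of_nonneg_left p6 (sq_nonneg γ)
        linarith
      _ = _ := by ring)
  obtain ⟨C2, hC2, hb2⟩ := exists_bound_pow_of_local
    (f := fun x => 2 * S1 x * deriv B x + S2 x * B x - B x) (by
      rw [hS1, hS2]; fun_prop) 3 (C := |2 * α * a + 4 * a * α - 2 * α * γ - 3 * γ * α| + |4 * a * γ + 3 * γ * a|) hdpos (by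
    intro x hx
    have hx1 : |x| ≤ 1 := hx.trans (min_le_right _ _)
    have hx2 : |x| ≤ δ' := hx.trans ((min_le_left _ _).trans (min_le_right _ _))
    obtain ⟨⟨e1, e2, -⟩, -⟩ := hloc x hx2
    rw [e1, e2, hPd]
    calc |2 * S1 x * (-α + 2 * a * x) + S2 x * P x - P x| =
        |(2 * α * a + 4 * a * α - 2 * α * γ - 3 * γ * α) * x ^ 3
          + (4 * a * γ + 3 * γ * a) * x ^ 4| := by
          congr 1; simp only [hS1, hS2, hP, ha]; ring
      _ ≤ |2 * α * a + 4 * a * α - 2 * α * γ - 3 * γ * α| * |x| ^ 3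
          + |4 * a * γ + 3 * γ * a| * |x| ^ 4 := by
        refine (abs_add_le _ _).trans (le_of_eq ?_)
        rw [abs_mul, abs_mul, abs_pow, abs_pow]
      _ ≤ |2 * α * a + 4 * a * α - 2 * α * γ - 3 * γ * α| * |x| ^ 3
          + |4 * a * γ + 3 * γ * a| * |x| ^ 3 := by
        gcongr _ + _ * ?_
        exact pow_le_pow_of_le_one (abs_nonneg _) hx1 (by norm_num)
      _ = _ := by ring)
  obtain ⟨C3, hC3, hb3⟩ := exists_bound_pow_of_local
    (f := fun x => deriv (deriv B) x - (2 * a) * B x) (by fun_prop) 1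
    (C := |2 * a| * (|α| + |a|)) hdpos (by
    intro x hx
    have hx1 : |x| ≤ 1 := hx.trans (min_le_right _ _)
    have hx2 : |x| ≤ δ' := hx.trans ((min_le_left _ _).trans (min_le_right _ _))
    obtain ⟨⟨e1, -, e3⟩, -⟩ := hloc x hx2
    rw [e1, e3, hPdd]
    calc |2 * a - 2 * a * P x| = |2 * a * (α * x - a * x ^ 2)| := by
          congr 1; simp only [hP]; ring
      _ ≤ |2 * a| * (|α| * |x| + |a| * |x| ^ 2) := by
        rw [abs_mul]
        refine mul_le_mul_of_nonneg_left ((abs_sub _ _).trans (le_of_eq ?_)) (abs_nonneg _)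
        rw [abs_mul, abs_mul, abs_pow]
      _ ≤ |2 * a| * (|α| * |x| + |a| * |x| ^ 1) := by
        gcongr _ * (_ + _ * ?_)
        exact pow_le_pow_of_le_one (abs_nonneg _) hx1 (by norm_num)
      _ = _ := by ring)
  obtain ⟨C4, hC4, hb4⟩ := exists_bound_of_continuous_on_unit hBc
  obtain ⟨C5, hC5, hb5⟩ := exists_bound_pow_of_local hvc 2 (C := |K| + 1 + |2 * α| + |α ^ 2 + 2 * γ|) hdpos (by
    intro x hx
    have hx1 : |x| ≤ 1 := hx.trans (min_le_right _ _)
    have hx2 : |x| ≤ δ := hx.trans ((min_le_left _ _).trans (min_le_left _ _))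
    calc |v x| = |(v x - (x ^ 2 + 2 * α * x ^ 3 + (α ^ 2 + 2 * γ) * x ^ 4))
          + (x ^ 2 + 2 * α * x ^ 3 + (α ^ 2 + 2 * γ) * x ^ 4)| := by congr 1; ring
      _ ≤ |K| * |x| ^ 5 + (1 * |x| ^ 2 + |2 * α| * |x| ^ 3 + |α ^ 2 + 2 * γ| * |x| ^ 4) := by
        refine (abs_add_le _ _).trans (add_le_add ((hK x hx2).trans (by
          gcongr; exact le_abs_self K)) ((abs_add_three _ _ _).trans (le_of_eq ?_)))
        simp only [abs_mul, abs_pow, one_mul]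
      _ ≤ |K| * |x| ^ 2 + (1 * |x| ^ 2 + |2 * α| * |x| ^ 2 + |α ^ 2 + 2 * γ| * |x| ^ 2) := by
        have p5 : |x| ^ 5 ≤ |x| ^ 2 := pow_le_pow_of_le_one (abs_nonneg _) hx1 (by norm_num)
        have p3 : |x| ^ 3 ≤ |x| ^ 2 := pow_le_pow_of_le_one (abs_nonneg _) hx1 (by norm_num)
        have p4 : |x| ^ 4 ≤ |x| ^ 2 := pow_le_pow_of_le_one (abs_nonneg _) hx1 (by norm_num)
        gcongr
      _ = _ := by ring)
  have hSx : ∀ x, |x| ≤ r → |α * x / 3 + γ * x ^ 2 / 4| ≤ 1 / 4 := by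
    intro x hx
    have hx1 : |x| ≤ 1 := hx.trans hr1
    calc _ ≤ |α| * |x| / 3 + |γ| * |x| ^ 2 / 4 := by
          refine (abs_add_le _ _).trans (le_of_eq ?_)
          simp [abs_mul, abs_div]
      _ ≤ |α| * |x| / 3 + |γ| * |x| / 3 := by
          have : |x| ^ 2 ≤ |x| := by nlinarith [abs_nonneg x]
          have h4 : |γ| * |x| ^ 2 ≤ |γ| * |x| := by gcongr
          have : 0 ≤ |γ| * |x| := by positivity
          linarith
      _ = (|α| + |γ|) * |x| / 3 := by ring
      _ ≤ (|α| + |γ|) * r / 3 := by gcongr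
      _ ≤ 1 / 4 := by linarith
  have key : ∀ {f : ℝ} {Ci : ℝ} {y : ℝ}, 0 ≤ y → |f| ≤ Ci * y →
      Ci ≤ 1 + 1 / δ' + C1 + C2 + C3 + C4 + C5 → |f| ≤ (1 + 1 / δ' + C1 + C2 + C3 + C4 + C5) * y :=
    fun hy hf hC => hf.trans (mul_le_mul_of_nonneg_right hC hy)
  have hd'' : 0 < 1 / δ' := by positivity
  -- The energy shift `c` is `P'' / P` at `0`. The summand `1 / δ'` of `C` makes `|x| ≤ 1 / C` imply
  -- `|x| ≤ δ'`, where `B` is at least `1 / 2`.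
  refine ⟨{ c := 2 * a, r := r, C := 1 + 1 / δ' + C1 + C2 + C3 + C4 + C5,
            S := S, S1 := S1, S2 := S2, B := B, B1 := deriv B, B2 := deriv (deriv B),
            r_pos := hrpos, r_le := hr1, one_le_C := by linarith,
            hasDerivAt_S := ?_, hasDerivAt_S1 := ?_, hasDerivAt_B := ?_, hasDerivAt_B1 := ?_,
            continuous_S2 := by rw [hS2]; fun_prop, continuous_B2 := hd2,
            supp := ?_, le_S := ?_, S_le := ?_, B_le := ?_, v_le := ?_, eikonal := ?_,
            transport := ?_, correction := ?_, le_B := ?_ }⟩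
  · intro x
    have := ((((hasDerivAt_id x).pow 2).div_const 2).add
      ((((hasDerivAt_id x).pow 3).const_mul α).div_const 3)).add
      ((((hasDerivAt_id x).pow 4).const_mul γ).div_const 4)
    refine HasDerivAt.congr_deriv (f := S) this ?_
    simp only [hS1, id]; ring
  · intro x
    have := ((hasDerivAt_id x).add (((hasDerivAt_id x).pow 2).const_mul α)).add
      (((hasDerivAt_id x).pow 3).const_mul γ)
    refine HasDerivAt.congr_deriv (f := S1) this ?_
    simp only [hS2, id]; ring
  · exact fun x => (hBs.differentiable (by simp) x).hasDerivAt
  · exact fun x => (hB1s.differentiable (by simp) x).hasDerivAt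
  · intro x hx
    have h := hzero x hx
    have hd1 : deriv B =ᶠ[𝓝 x] fun _ => 0 := by simpa using h.deriv
    have hd2 : deriv (deriv B) =ᶠ[𝓝 x] fun _ => 0 := by simpa using hd1.deriv
    exact ⟨h.eq_of_nhds, hd1.eq_of_nhds, hd2.eq_of_nhds⟩
  · intro x hx
    have := (abs_le.1 (hSx x hx)).1
    have e : S x = x ^ 2 * (1 / 2 + (α * x / 3 + γ * x ^ 2 / 4)) := by simp only [hS]; ring
    rw [e]; nlinarith [sq_nonneg x]
  · intro x hx
    have := (abs_le.1 (hSx x hx)).2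
    have e : S x = x ^ 2 * (1 / 2 + (α * x / 3 + γ * x ^ 2 / 4)) := by simp only [hS]; ring
    rw [e]; nlinarith [sq_nonneg x]
  · intro x
    rcases le_or_gt |x| 1 with hx | hx
    · linarith [hb4 x hx]
    · rw [(hzero x (hr1.trans hx.le)).eq_of_nhds, abs_zero]; positivity
  · exact fun x hx => key (by positivity) (hb5 x (hx.trans hr1)) (by linarith)
  · exact fun x hx => key (by positivity) (hb1 x (hx.trans hr1)) (by linarith)
  · exact fun x hx => key (by positivity) (hb2 x (hx.trans hr1)) (by linarith)
  · intro x hx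
    have := hb3 x (hx.trans hr1)
    rw [pow_one] at this
    exact key (by positivity) this (by linarith)
  · intro x hx
    refine (hloc x (hx.trans ?_)).2
    rw [div_le_iff₀ (by positivity)]
    have : δ' * (1 / δ') = 1 := by field_simp
    nlinarith [mul_nonneg hδ'.le (by linarith : 0 ≤ 1 + C1 + C2 + C3 + C4 + C5)]

theorem exists_pow_mul_gaussian_le (n : ℕ) : ∃ T : ℝ, 1 ≤ T ∧ ∀ j ≤ n, ∀ h x : ℝ, 0 < h →
    |x| ^ j * Real.exp (-(x ^ 2 / (16 * h ^ 2))) ≤ T * h ^ j := by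
  refine ⟨1 + 16 ^ n * n.factorial, by
    have : (0 : ℝ) ≤ 16 ^ n * n.factorial := by positivity
    linarith, fun j hj h x hh => ?_⟩
  set t := |x| / h with ht
  have ht0 : 0 ≤ t := by positivity
  have hx : |x| = t * h := by rw [ht]; field_simp
  have hx2 : x ^ 2 / (16 * h ^ 2) = t ^ 2 / 16 := by
    rw [← sq_abs, hx]; field_simp
  have h1 := Real.pow_div_factorial_le_exp (t ^ 2 / 16) (by positivity) j
  have hE : 1 ≤ Real.exp (t ^ 2 / 16) := Real.one_le_exp (by positivity)
  have h2 : t ^ (2 * j) ≤ 16 ^ j * j.factorial * Real.exp (t ^ 2 / 16) := by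
    rw [div_le_iff₀ (by positivity), div_pow, div_le_iff₀ (by positivity), ← pow_mul] at h1
    linarith
  -- The series of `exp (t² / 16)` only controls even powers of `t`.
  have h3 : t ^ j ≤ 1 + t ^ (2 * j) := by
    rw [mul_comm 2 j, pow_mul]
    nlinarith [sq_nonneg (t ^ j - 1), pow_nonneg ht0 j]
  have h4 : (16 : ℝ) ^ j * j.factorial ≤ 16 ^ n * n.factorial := by
    gcongr
    norm_num
  have h5 : t ^ j ≤ (1 + 16 ^ n * n.factorial) * Real.exp (t ^ 2 / 16) := by
    nlinarith
  rw [hx2, hx, mul_pow, Real.exp_neg]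
  calc t ^ j * h ^ j * (Real.exp (t ^ 2 / 16))⁻¹
      ≤ ((1 + 16 ^ n * n.factorial) * Real.exp (t ^ 2 / 16)) * h ^ j *
        (Real.exp (t ^ 2 / 16))⁻¹ := by gcongr
    _ = _ := by field_simp

/-- The factors in `x` of the quasimode: `A` is the approximate ground state and `D = S A`
its first corrector. -/
structure GroundStatePair (v : ℝ → ℝ) (c K h : ℝ) where
  (A A1 A2 D D1 D2 : ℝ → ℝ)
  hasDerivAt_A : ∀ x, HasDerivAt A (A1 x) x
  hasDerivAt_A1 : ∀ x, HasDerivAt A1 (A2 x) x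
  hasDerivAt_D : ∀ x, HasDerivAt D (D1 x) x
  hasDerivAt_D1 : ∀ x, HasDerivAt D1 (D2 x) x
  continuous_A2 : Continuous A2
  continuous_D2 : Continuous D2
  supp : ∀ x, 1 ≤ |x| → A x = 0 ∧ A1 x = 0 ∧ A2 x = 0 ∧ D x = 0 ∧ D1 x = 0 ∧ D2 x = 0
  A_le : ∀ x, |A x| ≤ K * Real.exp (-(x ^ 2 / (16 * h ^ 2)))
  D_le : ∀ x, |D x| ≤ K * h ^ 2 * Real.exp (-(x ^ 2 / (16 * h ^ 2)))
  eq_A : ∀ x, |A2 x - (1 / h ^ 2 + c) ^ 2 * v x * A x + A x / h ^ 2| ≤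
    K * h * Real.exp (-(x ^ 2 / (16 * h ^ 2)))
  eq_D : ∀ x, |D2 x + 2 * (1 / h ^ 2 + c) * v x * A x - (1 / h ^ 2 + c) ^ 2 * v x * D x
      + D x / h ^ 2 - A x| ≤ K * h * Real.exp (-(x ^ 2 / (16 * h ^ 2)))
  vA_le : ∀ x, |v x * A x| ≤ K * h ^ 2 * Real.exp (-(x ^ 2 / (16 * h ^ 2)))
  NvD_le : ∀ x, |(1 / h ^ 2 + c) * v x * D x| ≤ K * h ^ 2 * Real.exp (-(x ^ 2 / (16 * h ^ 2)))
  vD_le : ∀ x, |v x * D x| ≤ K * h ^ 4 * Real.exp (-(x ^ 2 / (16 * h ^ 2)))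
  le_A : ∀ x, |x| ≤ h → 1 / K ≤ A x

set_option maxHeartbeats 1000000 in
-- Every estimate comes from one count: under the Gaussian each factor `|x|` is worth `h`, and each
-- factor `N` costs `h⁻²`. The equation for `D` is the `N`-derivative of the one for `A`, because
-- `B` does not depend on `N` and `D = -∂_N (B e^{-NS})`.
theorem GroundStateProfile.exists_pair {v : ℝ → ℝ} (p : GroundStateProfile v) :
    ∃ K h₀ : ℝ, 1 ≤ K ∧ 0 < h₀ ∧ h₀ ≤ 1 ∧ ∀ h : ℝ, 0 < h → h ≤ h₀ →
      Nonempty (GroundStatePair v p.c K h) := by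
  obtain ⟨T, hT1, hT⟩ := exists_pow_mul_gaussian_le 5
  set C := p.C with hC
  have hC1 : 1 ≤ C := p.one_le_C
  have hC0 : 0 < C := by linarith
  have hr1 := p.r_le
  have hr0 := p.r_pos
  -- The three terms serve, in order, to keep `N h²` between `1/2` and `2`, to have `B ≥ 1/2` on
  -- `|x| ≤ h`, and to have `S ≤ x²` there.
  set h₀ : ℝ := min (min (1 / (2 * (1 + |p.c|))) (1 / C)) p.r with hh₀
  have hcp := abs_nonneg p.c
  have e2 : (1 : ℝ) ≤ Real.exp 2 := Real.one_le_exp (by norm_num)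
  refine ⟨2 * Real.exp 2 + 14 * T * C ^ 2, h₀, by nlinarith, by positivity,
    (min_le_right _ _).trans p.r_le, fun h hh hle => ?_⟩
  set K := 2 * Real.exp 2 + 14 * T * C ^ 2 with hK
  have hTC : T * C ≤ T * C ^ 2 := by
    rw [sq]; nlinarith [mul_pos (by linarith : 0 < T) hC0]
  have hTC0 : 0 < T * C := by positivity
  have hK14 : 14 * T * C ^ 2 ≤ K := by rw [hK]; linarith
  have hK7 : 7 * T * C ^ 2 ≤ K := by nlinarith [sq_nonneg C]
  have hTCC : 0 ≤ T * C ^ 2 := by positivity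
  have hTCK : C * T ≤ K := by linarith
  have hTCCK : C * C * T ≤ K := by nlinarith
  have hTCCK2 : 2 * (C * C) * T ≤ K := by nlinarith
  have hh1 : h ≤ 1 := hle.trans ((min_le_right _ _).trans p.r_le)
  have hhr : h ≤ p.r := hle.trans (min_le_right _ _)
  have hhC : h ≤ 1 / C := hle.trans ((min_le_left _ _).trans (min_le_right _ _))
  have hhc : h ≤ 1 / (2 * (1 + |p.c|)) := hle.trans ((min_le_left _ _).trans (min_le_left _ _))
  have hch : |p.c| * h ^ 2 ≤ 1 / 2 := by
    have h1 : (2 * (1 + |p.c|)) * h ≤ 1 := by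
      have := mul_le_mul_of_nonneg_left hhc (by positivity : 0 ≤ 2 * (1 + |p.c|))
      rwa [mul_one_div_cancel (by positivity)] at this
    nlinarith [mul_nonneg hcp hh.le]
  set N : ℝ := 1 / h ^ 2 + p.c with hN
  have hNh : N * h ^ 2 = 1 + p.c * h ^ 2 := by rw [hN]; field_simp
  have hch' : |p.c * h ^ 2| ≤ 1 / 2 := by rwa [abs_mul, abs_of_nonneg (sq_nonneg h)]
  obtain ⟨hcl, hcu⟩ := abs_le.1 hch'
  have hN2 : N * h ^ 2 ≤ 2 := by linarith
  have hN1 : 1 / 2 ≤ N * h ^ 2 := by linarith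
  have hh2 : 0 < h ^ 2 := by positivity
  have hN0 : 0 < N := by
    by_contra hcon
    nlinarith [mul_nonneg (by linarith : 0 ≤ -N) hh2.le]
  set e : ℝ → ℝ := fun x => Real.exp (-(N * p.S x)) with he
  set G : ℝ → ℝ := fun x => Real.exp (-(x ^ 2 / (16 * h ^ 2))) with hG
  have hGpos : ∀ x, 0 < G x := fun x => Real.exp_pos _
  have hepos : ∀ x, 0 < e x := fun x => Real.exp_pos _
  -- The exponential is split in two: one Gaussian absorbs powers of `|x|`, the other survives in
  -- the final bounds.
  have heG : ∀ x, |x| ≤ p.r → e x ≤ G x * G x := by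
    intro x hx
    rw [hG, he]; simp only
    rw [← Real.exp_add]
    apply Real.exp_le_exp.2
    have h1 := p.le_S x hx
    have h2 : x ^ 2 / (16 * h ^ 2) + x ^ 2 / (16 * h ^ 2) ≤ N * p.S x := by
      have h3 : x ^ 2 / (16 * h ^ 2) + x ^ 2 / (16 * h ^ 2) = x ^ 2 / (8 * h ^ 2) := by
        field_simp; ring
      rw [h3, div_le_iff₀ (by positivity)]
      have h4 : N * h ^ 2 * (x ^ 2 / 4) ≤ N * h ^ 2 * p.S x := by gcongr
      nlinarith [sq_nonneg x]
    linarith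
  have key : ∀ {f a x : ℝ} (j : ℕ), j ≤ 5 → 0 ≤ a → |x| ≤ p.r → |f| ≤ a * |x| ^ j →
      |f * e x| ≤ a * T * h ^ j * G x := by
    intro f a x j hj ha hx hf
    rw [abs_mul, abs_of_pos (hepos x)]
    calc |f| * e x ≤ (a * |x| ^ j) * (G x * G x) := by
          gcongr
          exact heG x hx
      _ = a * (|x| ^ j * G x) * G x := by ring
      _ ≤ a * (T * h ^ j) * G x := by
          have := hT j hj h x hh
          gcongr
      _ = _ := by ring
  have keyN : ∀ {f a x : ℝ} (j : ℕ), j + 2 ≤ 5 → 0 ≤ a → |x| ≤ p.r → |f| ≤ a * |x| ^ (j + 2) →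
      |N * f * e x| ≤ 2 * a * T * h ^ j * G x := by
    intro f a x j hj ha hx hf
    have h1 := key (j + 2) hj ha hx hf
    rw [mul_assoc, abs_mul, abs_of_pos hN0]
    calc N * |f * e x| ≤ N * (a * T * h ^ (j + 2) * G x) := by gcongr
      _ = (N * h ^ 2) * (a * T * h ^ j * G x) := by ring
      _ ≤ 2 * (a * T * h ^ j * G x) := by
        have := hGpos x
        gcongr
      _ = _ := by ring
  have keyNN : ∀ {f a x : ℝ}, 0 ≤ a → |x| ≤ p.r → |f| ≤ a * |x| ^ 5 →
      |N ^ 2 * f * e x| ≤ 4 * a * T * h * G x := by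
    intro f a x ha hx hf
    have h1 := key 5 le_rfl ha hx hf
    rw [mul_assoc, abs_mul, abs_of_pos (by positivity : 0 < N ^ 2)]
    calc N ^ 2 * |f * e x| ≤ N ^ 2 * (a * T * h ^ 5 * G x) := by gcongr
      _ = (N * h ^ 2) ^ 2 * (a * T * h * G x) := by ring
      _ ≤ 2 ^ 2 * (a * T * h * G x) := by
        have := hGpos x
        gcongr
      _ = _ := by ring
  have hde : ∀ x, HasDerivAt e (-(N * p.S1 x) * e x) x := by
    intro x
    have := (((p.hasDerivAt_S x).const_mul N).neg).exp
    refine HasDerivAt.congr_deriv this ?_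
    simp only [he, Pi.neg_apply]; ring
  set A : ℝ → ℝ := fun x => p.B x * e x with hA
  set A1 : ℝ → ℝ := fun x => (p.B1 x - N * p.S1 x * p.B x) * e x with hA1
  set A2 : ℝ → ℝ := fun x => (p.B2 x - 2 * N * p.S1 x * p.B1 x - N * p.S2 x * p.B x
    + N ^ 2 * p.S1 x ^ 2 * p.B x) * e x with hA2
  set D : ℝ → ℝ := fun x => p.S x * A x with hD
  set D1 : ℝ → ℝ := fun x => p.S1 x * A x + p.S x * A1 x with hD1
  set D2 : ℝ → ℝ := fun x => p.S2 x * A x + 2 * p.S1 x * A1 x + p.S x * A2 x with hD2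
  have hdA : ∀ x, HasDerivAt A (A1 x) x := fun x =>
    HasDerivAt.congr_deriv (f := A) ((p.hasDerivAt_B x).mul (hde x)) (by simp only [hA1]; ring)
  have hdA1 : ∀ x, HasDerivAt A1 (A2 x) x := fun x =>
    HasDerivAt.congr_deriv (f := A1) (((p.hasDerivAt_B1 x).sub
      (((p.hasDerivAt_S1 x).const_mul N).mul (p.hasDerivAt_B x))).mul (hde x))
      (by simp only [hA2, Pi.sub_apply, Pi.mul_apply]; ring)
  have hdD : ∀ x, HasDerivAt D (D1 x) x := fun x =>
    HasDerivAt.congr_deriv (f := D) ((p.hasDerivAt_S x).mul (hdA x)) (by simp only [hD1])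
  have hdD1 : ∀ x, HasDerivAt D1 (D2 x) x := fun x =>
    HasDerivAt.congr_deriv (f := D1) (((p.hasDerivAt_S1 x).mul (hdA x)).add
      ((p.hasDerivAt_S x).mul (hdA1 x))) (by simp only [hD2]; ring)
  have hec : Continuous e := continuous_iff_continuousAt.2 fun x => (hde x).continuousAt
  have hAc : Continuous A := continuous_iff_continuousAt.2 fun x => (hdA x).continuousAt
  have hA1c : Continuous A1 := continuous_iff_continuousAt.2 fun x => (hdA1 x).continuousAt
  have hSc : Continuous p.S := continuous_iff_continuousAt.2 fun x => (p.hasDerivAt_S x).continuousAt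
  have hS1c : Continuous p.S1 :=
    continuous_iff_continuousAt.2 fun x => (p.hasDerivAt_S1 x).continuousAt
  have hBc : Continuous p.B := continuous_iff_continuousAt.2 fun x => (p.hasDerivAt_B x).continuousAt
  have hB1c : Continuous p.B1 :=
    continuous_iff_continuousAt.2 fun x => (p.hasDerivAt_B1 x).continuousAt
  have hS2c := p.continuous_S2
  have hB2c := p.continuous_B2
  have hA2c : Continuous A2 := by rw [hA2]; fun_prop
  have hD2c : Continuous D2 := by rw [hD2]; fun_prop
  have hsupp : ∀ x, p.r ≤ |x| →
      A x = 0 ∧ A1 x = 0 ∧ A2 x = 0 ∧ D x = 0 ∧ D1 x = 0 ∧ D2 x = 0 := by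
    intro x hx
    obtain ⟨b0, b1, b2⟩ := p.supp x hx
    simp [hD2, hD1, hD, hA2, hA1, hA, b0, b1, b2]
  have hnn : ∀ {a : ℝ} (x : ℝ), 0 ≤ a → 0 ≤ a * G x := fun x ha => mul_nonneg ha (hGpos x).le
  have hK0 : 0 ≤ K := by linarith [mul_nonneg (by linarith : (0 : ℝ) ≤ 14 * T) (sq_nonneg C)]
  have hSabs : ∀ x, |x| ≤ p.r → |p.S x| ≤ |x| ^ 2 := by
    intro x hx
    rw [sq_abs, abs_of_nonneg ((by positivity : (0 : ℝ) ≤ x ^ 2 / 4).trans (p.le_S x hx))]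
    exact p.S_le x hx
  have hx1 : ∀ {x}, |x| ≤ p.r → |x| ≤ 1 := fun hx => hx.trans hr1
  have hEA : ∀ x, |x| ≤ p.r →
      |A2 x - N ^ 2 * v x * A x + A x / h ^ 2| ≤ 7 * T * C ^ 2 * h * G x := by
    intro x hx
    -- Sorting by powers of `N` gives exactly the three errors of the profile; `1 / h² = N - c`
    -- contributes the terms `-p.B x` and `-c * p.B x`.
    have e1 : A2 x - N ^ 2 * v x * A x + A x / h ^ 2 = (p.B2 x - p.c * p.B x) * e x
        - N * (2 * p.S1 x * p.B1 x + p.S2 x * p.B x - p.B x) * e x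
        - N ^ 2 * ((v x - p.S1 x ^ 2) * p.B x) * e x := by
      have : A x / h ^ 2 = (N - p.c) * A x := by rw [hN]; ring
      rw [this]; simp only [hA2, hA]; ring
    rw [e1]
    have b1 := key 1 (by norm_num) hC0.le hx (by simpa using p.correction x hx)
    have b2 := keyN 1 (by norm_num) hC0.le hx (p.transport x hx)
    have b3 := keyNN (f := (v x - p.S1 x ^ 2) * p.B x) (a := C * C) (by positivity) hx (by
      rw [abs_mul, mul_right_comm]
      gcongr
      · exact p.eikonal x hx
      · exact p.B_le x)
    refine (abs_sub _ _).trans (le_trans (add_le_add ((abs_sub _ _).trans (add_le_add b1 b2)) b3) ?_)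
    have := mul_le_mul_of_nonneg_right hTC (mul_nonneg hh.le (hGpos x).le)
    nlinarith
  have hcases : ∀ {f : ℝ → ℝ} {a : ℝ}, 0 ≤ a → (∀ x, p.r ≤ |x| → f x = 0) →
      (∀ x, |x| ≤ p.r → |f x| ≤ a * G x) → ∀ x, |f x| ≤ a * G x := by
    intro f a ha h1 h2 x
    rcases le_total |x| p.r with hx | hx
    · exact h2 x hx
    · rw [h1 x hx, abs_zero]; exact hnn x ha
  have hGle : ∀ {a b : ℝ} (x : ℝ), a ≤ b → a * G x ≤ b * G x := fun x hab =>
    mul_le_mul_of_nonneg_right hab (hGpos x).le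
  exact ⟨{
    A := A, A1 := A1, A2 := A2, D := D, D1 := D1, D2 := D2
    hasDerivAt_A := hdA, hasDerivAt_A1 := hdA1, hasDerivAt_D := hdD, hasDerivAt_D1 := hdD1
    continuous_A2 := hA2c, continuous_D2 := hD2c
    supp := fun x hx => hsupp x (hr1.trans hx)
    A_le := hcases hK0 (fun x hx => (hsupp x hx).1) fun x hx => by
      refine (key 0 (by norm_num) hC0.le hx (by simpa using p.B_le x)).trans (hGle x ?_)
      rw [pow_zero, mul_one]; exact hTCK
    D_le := hcases (by positivity) (fun x hx => (hsupp x hx).2.2.2.1) fun x hx => by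
      have : D x = (p.S x * p.B x) * e x := by simp only [hD, hA]; ring
      rw [this]
      refine (key 2 (by norm_num) hC0.le hx ?_).trans (hGle x ?_)
      · rw [abs_mul, mul_comm]
        exact mul_le_mul (p.B_le x) (hSabs x hx) (abs_nonneg _) hC0.le
      · gcongr
    eq_A := hcases (by positivity) (fun x hx => by
      obtain ⟨a, -, a2, -⟩ := hsupp x hx; rw [a, a2]; simp) fun x hx =>
        (hEA x hx).trans (hGle x (by gcongr))
    eq_D := hcases (by positivity) (fun x hx => by
      obtain ⟨a, -, a2, d, -, d2⟩ := hsupp x hx; rw [a, d, d2]; simp) fun x hx => by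
        -- Since `D = SA`, this is `S` times the residual of `A` plus commutator terms, and those
        -- are again a transport and an eikonal error.
        have e1 : D2 x + 2 * N * v x * A x - N ^ 2 * v x * D x + D x / h ^ 2 - A x =
            p.S x * (A2 x - N ^ 2 * v x * A x + A x / h ^ 2)
            + ((2 * p.S1 x * p.B1 x + p.S2 x * p.B x - p.B x) * e x
            + N * (2 * ((v x - p.S1 x ^ 2) * p.B x)) * e x) := by
          simp only [hD2, hD, hA1, hA]; ring
        rw [e1]
        have hS1 : |p.S x| ≤ 1 := (hSabs x hx).trans (pow_le_one₀ (abs_nonneg _) (hx1 hx))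
        have b1 : |p.S x * (A2 x - N ^ 2 * v x * A x + A x / h ^ 2)| ≤
            1 * (7 * T * C ^ 2 * h * G x) := by
          rw [abs_mul]
          exact mul_le_mul hS1 (hEA x hx) (abs_nonneg _) zero_le_one
        have b2 := key 1 (by norm_num) hC0.le hx ((p.transport x hx).trans (by
          gcongr _ * ?_
          exact pow_le_pow_of_le_one (abs_nonneg _) (hx1 hx) (by norm_num)))
        have b3 := keyN (f := 2 * ((v x - p.S1 x ^ 2) * p.B x)) (a := 2 * (C * C)) 1 (by norm_num)
          (by positivity) hx (by
            have h5 : |x| ^ 5 ≤ |x| ^ (1 + 2) :=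
              pow_le_pow_of_le_one (abs_nonneg _) (hx1 hx) (by norm_num)
            rw [abs_mul, abs_mul, abs_two, mul_assoc, mul_right_comm C]
            gcongr
            · exact (p.eikonal x hx).trans (by gcongr)
            · exact p.B_le x)
        refine (abs_add_le _ _).trans (le_trans (add_le_add b1
          ((abs_add_le _ _).trans (add_le_add b2 b3))) ?_)
        have h1 := mul_le_mul_of_nonneg_right hTC (mul_nonneg hh.le (hGpos x).le)
        have h2 := mul_le_mul_of_nonneg_right hK14 (mul_nonneg hh.le (hGpos x).le)
        have h3 : 0 ≤ T * C ^ 2 * (h * G x) := by have := hGpos x; positivity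
        nlinarith
    vA_le := hcases (by positivity) (fun x hx => by rw [(hsupp x hx).1, mul_zero]) fun x hx => by
      have : v x * A x = (v x * p.B x) * e x := by simp only [hA]; ring
      rw [this]
      refine (key (a := C * C) 2 (by norm_num) (by positivity) hx ?_).trans (hGle x ?_)
      · rw [abs_mul, mul_right_comm]
        gcongr
        · exact p.v_le x hx
        · exact p.B_le x
      · gcongr
    NvD_le := hcases (by positivity) (fun x hx => by rw [(hsupp x hx).2.2.2.1, mul_zero])
      fun x hx => by
        have : N * v x * D x = N * (v x * p.B x * p.S x) * e x := by simp only [hD, hA]; ring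
        rw [this]
        refine (keyN (a := C * C) 2 (by norm_num) (by positivity) hx ?_).trans (hGle x ?_)
        · rw [abs_mul, abs_mul]
          calc _ ≤ C * |x| ^ 2 * C * |x| ^ 2 := by
                gcongr
                · exact p.v_le x hx
                · exact p.B_le x
                · exact hSabs x hx
            _ = _ := by ring
        · gcongr
    vD_le := hcases (by positivity) (fun x hx => by rw [(hsupp x hx).2.2.2.1, mul_zero])
      fun x hx => by
        have : v x * D x = (v x * p.B x * p.S x) * e x := by simp only [hD, hA]; ring
        rw [this]
        refine (key (a := C * C) 4 (by norm_num) (by positivity) hx ?_).trans (hGle x ?_)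
        · rw [abs_mul, abs_mul]
          calc _ ≤ C * |x| ^ 2 * C * |x| ^ 2 := by
                gcongr
                · exact p.v_le x hx
                · exact p.B_le x
                · exact hSabs x hx
            _ = _ := by ring
        · gcongr
    le_A := fun x hx => by
      have h1 := p.le_B x (hx.trans hhC)
      have h2 : Real.exp (-2) ≤ e x := by
        apply Real.exp_le_exp.2
        have h3 := p.S_le x (hx.trans hhr)
        have h4 : x ^ 2 ≤ h ^ 2 := by rw [← sq_abs]; gcongr
        have h5 : N * p.S x ≤ N * h ^ 2 := by gcongr; linarith
        linarith
      calc 1 / K ≤ 1 / (2 * Real.exp 2) := by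
            apply one_div_le_one_div_of_le (by positivity)
            rw [hK]; have : 0 ≤ 14 * T * C ^ 2 := by positivity
            linarith
        _ = 1 / 2 * Real.exp (-2) := by rw [Real.exp_neg]; field_simp
        _ ≤ p.B x * e x := by gcongr }⟩

/-! ### The smoothed damping and the amplitude along `y`. -/

theorem hasDerivAt_posPart_rpow {p : ℝ} (hp : 1 < p) (s : ℝ) :
    HasDerivAt (fun s : ℝ => max s 0 ^ p) (p * max s 0 ^ (p - 1)) s := by
  have hp0 : p ≠ 0 := by linarith
  have hp1 : p - 1 ≠ 0 := by linarith
  rcases lt_trichotomy s 0 with hs | rfl | hs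
  · rw [max_eq_right hs.le, Real.zero_rpow hp1, mul_zero]
    refine (hasDerivAt_const s (0 : ℝ)).congr_of_eventuallyEq ?_
    filter_upwards [Iio_mem_nhds hs] with t ht
    rw [max_eq_right (le_of_lt ht), Real.zero_rpow hp0]
  -- At the corner the two one-sided derivatives agree: both vanish because `p > 1`.
  · rw [max_self, Real.zero_rpow hp1, mul_zero, ← hasDerivWithinAt_univ, ← Set.Iic_union_Ici (a := 0)]
    refine HasDerivWithinAt.union ?_ ?_
    · refine (hasDerivWithinAt_const (0 : ℝ) (Set.Iic 0) (0 : ℝ)).congr (fun t ht => ?_) ?_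
      · rw [max_eq_right ht, Real.zero_rpow hp0]
      · rw [max_self, Real.zero_rpow hp0]
    · have h := (Real.hasDerivAt_rpow_const (x := 0) (p := p) (Or.inr hp.le)).hasDerivWithinAt
        (s := Set.Ici 0)
      rw [Real.zero_rpow hp1, mul_zero] at h
      refine h.congr (fun t ht => ?_) ?_
      · rw [max_eq_left ht]
      · rw [max_self]
  · rw [max_eq_left hs.le]
    refine (Real.hasDerivAt_rpow_const (Or.inl hs.ne')).congr_of_eventuallyEq ?_
    filter_upwards [Ioi_mem_nhds hs] with t ht
    rw [max_eq_left (le_of_lt ht)]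

theorem monotone_posPart_rpow {p : ℝ} (hp : 0 ≤ p) : Monotone fun s : ℝ => max s 0 ^ p :=
  fun _ _ hst => Real.rpow_le_rpow (le_max_right _ _) (max_le_max_right 0 hst) hp

/-- A `C²` approximation `q` at scale `ε` of `s ↦ s₊ ^ ν`, with its primitive `Q`. -/
structure SmoothedPower (ν ε : ℝ) where
  (Q q q1 q2 : ℝ → ℝ)
  hasDerivAt_Q : ∀ s, HasDerivAt Q (q s) s
  hasDerivAt_q : ∀ s, HasDerivAt q (q1 s) s
  hasDerivAt_q1 : ∀ s, HasDerivAt q1 (q2 s) s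
  continuous_q2 : Continuous q2
  q_nonneg : ∀ s, 0 ≤ q s
  q_le : ∀ s ≤ 1, q s ≤ 1
  abs_sub_le : ∀ s ≤ 1, |max s 0 ^ ν - q s| ≤ ν * ε
  abs_q1_le : ∀ s ≤ 1, |q1 s| ≤ ν
  abs_q2_le : ∀ s ≤ 1, |q2 s| ≤ ν / ε
  Q_nonneg : ∀ s, 0 ≤ Q s
  Q_eq_zero : ∀ s ≤ 0, Q s = 0
  le_Q : ∀ s, max (s - ε) 0 ^ (ν + 1) / (ν + 1) ≤ Q s
  sq_le : ∀ s ≤ 1, q s ^ 2 ≤ 2 * ν * Q s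

/-- Averaging over the backward window `[s - ε, s]` is a difference quotient of an antiderivative,
so each level is explicit and gains one derivative. The window is backward so that `Q` still
vanishes for `s ≤ 0`. -/
theorem nonempty_smoothedPower {ν ε : ℝ} (hν : 1 < ν) (hε : 0 < ε) :
    Nonempty (SmoothedPower ν ε) := by
  set f1 : ℝ → ℝ := fun s => ν * max s 0 ^ (ν - 1) with hf1
  set f : ℝ → ℝ := fun s => max s 0 ^ ν with hf
  set F : ℝ → ℝ := fun s => max s 0 ^ (ν + 1) / (ν + 1) with hF
  set Φ : ℝ → ℝ := fun s => max s 0 ^ (ν + 2) / ((ν + 1) * (ν + 2)) with hΦ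
  have hdf : ∀ s, HasDerivAt f (f1 s) s := fun s => hasDerivAt_posPart_rpow hν s
  have hdF : ∀ s, HasDerivAt F (f s) s := fun s => by
    refine ((hasDerivAt_posPart_rpow (by linarith : 1 < ν + 1) s).div_const (ν + 1)).congr_deriv ?_
    rw [add_sub_cancel_right, mul_div_assoc, mul_div_cancel₀ _ (by linarith)]
  have hdΦ : ∀ s, HasDerivAt Φ (F s) s := fun s => by
    refine ((hasDerivAt_posPart_rpow (by linarith : 1 < ν + 2) s).div_const
      ((ν + 1) * (ν + 2))).congr_deriv ?_
    rw [show ν + 2 - 1 = ν + 1 by ring]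
    simp only [hF]
    field_simp
  have hf1c : Continuous f1 := by
    rw [hf1]
    exact continuous_const.mul ((continuous_id.max continuous_const).rpow_const
      fun s => Or.inr (by linarith))
  have hfm : Monotone f := monotone_posPart_rpow (by linarith)
  have hFm : Monotone F := fun s t hst =>
    div_le_div_of_nonneg_right (monotone_posPart_rpow (p := ν + 1) (by linarith) hst) (by linarith)
  have hf0 : ∀ s, 0 ≤ f s := fun s => Real.rpow_nonneg (le_max_right _ _) _
  have hF0 : ∀ s, 0 ≤ F s := fun s =>
    div_nonneg (Real.rpow_nonneg (le_max_right _ _) _) (by linarith)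
  have hf10 : ∀ s, 0 ≤ f1 s := fun s =>
    mul_nonneg (by linarith) (Real.rpow_nonneg (le_max_right _ _) _)
  have hm1 : ∀ s : ℝ, s ≤ 1 → max s 0 ≤ 1 := fun s hs => max_le hs zero_le_one
  have hfle : ∀ s ≤ 1, f s ≤ 1 := fun s hs =>
    Real.rpow_le_one (le_max_right _ _) (hm1 s hs) (by linarith)
  have hf1le : ∀ s ≤ 1, f1 s ≤ ν := fun s hs => by
    have := Real.rpow_le_one (le_max_right s 0) (hm1 s hs) (by linarith : 0 ≤ ν - 1)
    simp only [hf1]; nlinarith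
  have hLip : ∀ s ≤ 1, ∀ t ≤ 1, |f s - f t| ≤ ν * |s - t| := fun s hs t ht =>
    (convex_Iic (1 : ℝ)).norm_image_sub_le_of_norm_hasDerivWithin_le (f := f) (f' := f1)
      (fun x _ => (hdf x).hasDerivWithinAt)
      (fun x hx => by rw [Real.norm_eq_abs, abs_of_nonneg (hf10 x)]; exact hf1le x hx) ht hs
  have hsh : ∀ {u u' : ℝ → ℝ}, (∀ s, HasDerivAt u (u' s) s) → ∀ s,
      HasDerivAt (fun s => (u s - u (s - ε)) / ε) ((u' s - u' (s - ε)) / ε) s := by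
    intro u u' hu s
    have h2 : HasDerivAt (fun s => u (s - ε)) (u' (s - ε)) s := (hu (s - ε)).comp_sub_const s ε
    exact ((hu s).sub h2).div_const ε
  -- By the mean value theorem the average is a value of the averaged function inside the window, so
  -- pointwise bounds and monotonicity pass to it.
  have hmv : ∀ {u u' : ℝ → ℝ}, (∀ s, HasDerivAt u (u' s) s) → ∀ s,
      ∃ ξ, s - ε < ξ ∧ ξ < s ∧ (u s - u (s - ε)) / ε = u' ξ := by
    intro u u' hu s
    obtain ⟨ξ, hξ, h⟩ := exists_hasDerivAt_eq_slope u u' (by linarith : s - ε < s)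
      (continuousOn_of_forall_continuousAt fun x _ => (hu x).continuousAt) (fun x _ => hu x)
    exact ⟨ξ, hξ.1, hξ.2, by rw [h]; congr 1; ring⟩
  set Q : ℝ → ℝ := fun s => (Φ s - Φ (s - ε)) / ε with hQ
  set q : ℝ → ℝ := fun s => (F s - F (s - ε)) / ε with hq
  set q1 : ℝ → ℝ := fun s => (f s - f (s - ε)) / ε with hq1
  have hdQ : ∀ s, HasDerivAt Q (q s) s := hsh hdΦ
  have hdq : ∀ s, HasDerivAt q (q1 s) s := hsh hdF
  have hq0 : ∀ s, 0 ≤ q s := fun s => by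
    obtain ⟨ξ, -, -, h⟩ := hmv hdF s
    simp only [hq, h, hf0]
  have hq10 : ∀ s, 0 ≤ q1 s := fun s =>
    div_nonneg (sub_nonneg.2 (hfm (by linarith))) hε.le
  have hq1le : ∀ s ≤ 1, q1 s ≤ ν := fun s hs => by
    obtain ⟨ξ, -, h2, h⟩ := hmv hdf s
    simp only [hq1, h]; exact hf1le ξ (by linarith)
  have hneg : ∀ s : ℝ, s ≤ 0 → max s 0 = 0 := fun s hs => max_eq_right hs
  have hQz : ∀ s ≤ 0, Q s = 0 := fun s hs => by
    simp only [hQ, hΦ, hneg s hs, hneg (s - ε) (by linarith), sub_self, zero_div]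
  have hqz : ∀ s ≤ 0, q s = 0 := fun s hs => by
    simp only [hq, hF, hneg s hs, hneg (s - ε) (by linarith), sub_self, zero_div]
  refine ⟨{ Q := Q, q := q, q1 := q1, q2 := fun s => (f1 s - f1 (s - ε)) / ε,
            hasDerivAt_Q := hdQ, hasDerivAt_q := hdq, hasDerivAt_q1 := hsh hdf
            continuous_q2 := by fun_prop
            q_nonneg := hq0, q_le := ?_, abs_sub_le := ?_, abs_q1_le := ?_, abs_q2_le := ?_
            Q_nonneg := ?_, Q_eq_zero := hQz, le_Q := ?_, sq_le := ?_ }⟩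
  · intro s hs
    obtain ⟨ξ, -, h2, h⟩ := hmv hdF s
    simp only [hq, h]; exact hfle ξ (by linarith)
  · intro s hs
    obtain ⟨ξ, h1, h2, h⟩ := hmv hdF s
    simp only [hq, h]
    refine (hLip s hs ξ (by linarith)).trans ?_
    gcongr
    rw [abs_le]; constructor <;> linarith
  · intro s hs
    rw [abs_of_nonneg (hq10 s)]; exact hq1le s hs
  · intro s hs
    rw [abs_div, abs_of_pos hε]
    gcongr
    rw [abs_le]
    constructor <;> linarith [hf10 s, hf10 (s - ε), hf1le s hs, hf1le (s - ε) (by linarith)]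
  · intro s
    obtain ⟨ξ, -, -, h⟩ := hmv hdΦ s
    simp only [hQ, h, hF0]
  · intro s
    obtain ⟨ξ, h1, -, h⟩ := hmv hdΦ s
    simp only [hQ, h]
    exact hFm h1.le
  · intro s hs
    -- The difference `2νQ - q²` has derivative `2q(ν - q')`, nonnegative on `s ≤ 1`, and it
    -- vanishes for `s ≤ 0`.
    have hg : ∀ s, HasDerivAt (fun s => 2 * ν * Q s - q s ^ 2) (2 * q s * (ν - q1 s)) s := fun s =>
      HasDerivAt.congr_deriv (((hdQ s).const_mul (2 * ν)).sub ((hdq s).pow 2)) (by ring)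
    have hmono : MonotoneOn (fun s => 2 * ν * Q s - q s ^ 2) (Set.Iic 1) := by
      refine monotoneOn_of_deriv_nonneg (convex_Iic 1)
        (continuousOn_of_forall_continuousAt fun x _ => (hg x).continuousAt)
        (fun x _ => (hg x).differentiableAt.differentiableWithinAt) fun x hx => ?_
      rw [interior_Iic] at hx
      rw [(hg x).deriv]
      exact mul_nonneg (mul_nonneg zero_le_two (hq0 x)) (sub_nonneg.2 (hq1le x hx.le))
    have h1 := hmono (a := min s 0) (b := s) ((min_le_left _ _).trans hs) hs (min_le_left _ _)
    simp only [hQz _ (min_le_right s 0), hqz _ (min_le_right s 0)] at h1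
    linarith

/-- A smooth cutoff between two intervals, with bounded derivatives. -/
theorem exists_cutoff_derivatives {a b c d : ℝ} (hab : a < b) (hcd : c < d) :
    ∃ (M : ℝ) (η η1 η2 η3 : ℝ → ℝ), 1 ≤ M ∧ (∀ s, HasDerivAt η (η1 s) s) ∧
      (∀ s, HasDerivAt η1 (η2 s) s) ∧ (∀ s, HasDerivAt η2 (η3 s) s) ∧ Continuous η3 ∧
      (∀ s, 0 ≤ η s ∧ η s ≤ 1) ∧ (∀ s, |η1 s| ≤ M) ∧ (∀ s, |η2 s| ≤ M) ∧ (∀ s, |η3 s| ≤ M) ∧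
      (∀ s, s ≤ a ∨ d ≤ s → η s = 0 ∧ η1 s = 0 ∧ η2 s = 0 ∧ η3 s = 0) ∧
      (∀ s, b ≤ s → s ≤ c → η s = 1 ∧ η1 s = 0) := by
  -- The ramps start at midpoints, so that `η` vanishes near `a` and `d` and all its derivatives are
  -- zero there too.
  set a' := (a + b) / 2 with ha'
  set d' := (c + d) / 2 with hd'
  set η : ℝ → ℝ := fun s => Real.smoothTransition ((s - a') / (b - a')) *
    Real.smoothTransition ((d' - s) / (d' - c)) with hη
  have hba : 0 < b - a' := by linarith
  have hdc : 0 < d' - c := by linarith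
  have hs : ContDiff ℝ ∞ η :=
    (Real.smoothTransition.contDiff.comp (by fun_prop)).mul
      (Real.smoothTransition.contDiff.comp (by fun_prop))
  have h1 : ContDiff ℝ ∞ (deriv η) := hs.iterate_deriv 1
  have h2 : ContDiff ℝ ∞ (deriv (deriv η)) := hs.iterate_deriv 2
  have h3 : ContDiff ℝ ∞ (deriv (deriv (deriv η))) := hs.iterate_deriv 3
  have hz : ∀ s, s ≤ a' ∨ d' ≤ s → η s = 0 := by
    rintro s (h | h)
    · simp only [hη]
      rw [Real.smoothTransition.zero_of_nonpos (div_nonpos_of_nonpos_of_nonneg (by linarith) hba.le),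
        zero_mul]
    · simp only [hη]
      rw [Real.smoothTransition.zero_of_nonpos (x := (d' - s) / (d' - c))
        (div_nonpos_of_nonpos_of_nonneg (by linarith) hdc.le), mul_zero]
  have ho : ∀ s, b ≤ s → s ≤ c → η s = 1 := by
    intro s h h'
    simp only [hη]
    rw [Real.smoothTransition.one_of_one_le ((one_le_div hba).2 (by linarith)),
      Real.smoothTransition.one_of_one_le ((one_le_div hdc).2 (by linarith)), mul_one]
  have h01 : ∀ s, 0 ≤ η s ∧ η s ≤ 1 := fun s =>
    ⟨mul_nonneg (Real.smoothTransition.nonneg _) (Real.smoothTransition.nonneg _),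
      mul_le_one₀ (Real.smoothTransition.le_one _) (Real.smoothTransition.nonneg _)
        (Real.smoothTransition.le_one _)⟩
  have hev : ∀ s, s ≤ a ∨ d ≤ s → η =ᶠ[𝓝 s] fun _ => 0 := by
    rintro s (h | h)
    · filter_upwards [Iio_mem_nhds (by linarith : s < a')] with t ht
      exact hz t (Or.inl (le_of_lt ht))
    · filter_upwards [Ioi_mem_nhds (by linarith : d' < s)] with t ht
      exact hz t (Or.inr (le_of_lt ht))
  have hc : HasCompactSupport η := HasCompactSupport.intro (isCompact_Icc (a := a') (b := d'))
    fun x hx => hz x (by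
      by_contra! hcon
      exact hx ⟨hcon.1.le, hcon.2.le⟩)
  obtain ⟨M1, hM1⟩ := hc.deriv.exists_bound_of_continuous h1.continuous
  obtain ⟨M2, hM2⟩ := hc.deriv.deriv.exists_bound_of_continuous h2.continuous
  obtain ⟨M3, hM3⟩ := hc.deriv.deriv.deriv.exists_bound_of_continuous h3.continuous
  have p1 := (norm_nonneg _).trans (hM1 0)
  have p2 := (norm_nonneg _).trans (hM2 0)
  have p3 := (norm_nonneg _).trans (hM3 0)
  refine ⟨1 + M1 + M2 + M3, η, deriv η, deriv (deriv η), deriv (deriv (deriv η)), by linarith,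
    fun s => (hs.differentiable (by simp) s).hasDerivAt,
    fun s => (h1.differentiable (by simp) s).hasDerivAt,
    fun s => (h2.differentiable (by simp) s).hasDerivAt, h3.continuous, h01,
    fun s => (hM1 s).trans (by linarith), fun s => (hM2 s).trans (by linarith),
    fun s => (hM3 s).trans (by linarith), fun s hs => ?_, fun s hb hc => ⟨ho s hb hc, ?_⟩⟩
  · have e0 := hev s hs
    have e1 : deriv η =ᶠ[𝓝 s] fun _ => 0 := by simpa using e0.deriv
    have e2 : deriv (deriv η) =ᶠ[𝓝 s] fun _ => 0 := by simpa using e1.deriv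
    have e3 : deriv (deriv (deriv η)) =ᶠ[𝓝 s] fun _ => 0 := by simpa using e2.deriv
    exact ⟨e0.eq_of_nhds, e1.eq_of_nhds, e2.eq_of_nhds, e3.eq_of_nhds⟩
  -- The value `1` is a maximum of `η`; this covers the endpoints `b` and `c`, where `η` is not
  -- locally constant.
  · have : IsLocalMax η s := by
      filter_upwards with t
      rw [ho s hb hc]; exact (h01 t).2
    exact this.deriv_eq_zero

/-- The amplitude in the outward coordinate `s = |y| - y₀`: an approximate solution of
`h W' + (s₊ ^ ν - h τ) W = 0`, `h = k ^ 2`. -/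
structure Envelope (ν y₀ ρ K k τ : ℝ) where
  (W W1 W2 W3 env : ℝ → ℝ)
  hasDerivAt_W : ∀ s, HasDerivAt W (W1 s) s
  hasDerivAt_W1 : ∀ s, HasDerivAt W1 (W2 s) s
  hasDerivAt_W2 : ∀ s, HasDerivAt W2 (W3 s) s
  continuous_W3 : Continuous W3
  supp : ∀ s, s ≤ -(3 * y₀ / 4) ∨ 3 * ρ / 4 ≤ s → W s = 0 ∧ W1 s = 0 ∧ W2 s = 0 ∧ W3 s = 0
  W_le : ∀ s, |W s| ≤ Real.exp τ
  W1_le : ∀ s, k * |W1 s| ≤ K * Real.exp τ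
  W2_le : ∀ s, k ^ 3 * |W2 s| ≤ K * Real.exp τ
  W3_le : ∀ s, k ^ 6 * |W3 s| ≤ K * Real.exp τ
  transport : ∀ s, |k ^ 2 * W1 s + (max s 0 ^ ν - k ^ 2 * τ) * W s| ≤
    K * k ^ 2 * Real.exp (-(y₀ / 2 * τ))
  eq_exp : ∀ s, -(y₀ / 2) ≤ s → s ≤ 0 → W s = Real.exp (τ * s)
  W_le_env : ∀ s, |W s| ≤ env s
  W1_le_env : ∀ s, k ^ 2 * |W1 s| ≤ K * env s
  env_nonneg : ∀ s, 0 ≤ env s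
  env_le_of_nonpos : ∀ s ≤ 0, env s ≤ Real.exp (τ * s)
  env_le_of_pos : ∀ δ, 0 < δ → k ^ 4 ≤ δ / 2 → ∀ s, δ ≤ s →
    env s ≤ (ν + 1) / (δ / 2) ^ (ν + 1) * Real.exp (-(2 * τ))

set_option maxHeartbeats 1000000 in
-- The amplitude is `η exp(τ s - Q / k²)`. Its equation fails only through the derivative of the
-- cutoff and through replacing `s₊ ^ ν` by `q`. The scale `ε = k ^ 4` makes the second failure
-- `O(k⁴ e^τ)` and still leaves a third derivative of size `k⁻⁶ e^τ`.
theorem exists_envelope {ν y₀ ρ : ℝ} (hν : 1 < ν) (hy : 0 < y₀) (hy4 : y₀ ≤ 4) (hρ : 0 < ρ)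
    (hρ1 : ρ < 1) : ∃ K : ℝ, 1 ≤ K ∧ ∀ k τ : ℝ, 0 < k → k ≤ 1 → k ^ 4 ≤ ρ / 4 → 0 ≤ τ →
      k * Real.exp (5 * τ) ≤ 1 → Nonempty (Envelope ν y₀ ρ K k τ) := by
  obtain ⟨M, η, η1, η2, η3, hM, dη, dη1, dη2, cη3, h01, hM1, hM2, hM3, hsupp, hone⟩ :=
    exists_cutoff_derivatives (a := -(3 * y₀ / 4)) (b := -(y₀ / 2)) (c := ρ / 2) (d := 3 * ρ / 4)
      (by linarith) (by linarith)
  set L := 2 + 2 * ν with hL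
  set a := (ν + 1) / (ρ / 2 / 2) ^ (ν + 1) with ha
  have ha0 : 0 < a := by positivity
  set K := 10 * M * (L + ν + 1) + 4 * L + 3 * ν * L + ν + M * (1 + a) with hK
  have hν0 : 0 < ν := by linarith
  have hL0 : 0 < L := by linarith
  have hML : L ≤ M * L := by nlinarith
  have hMν : ν ≤ M * ν := by nlinarith
  have hMa : a ≤ M * a := by nlinarith
  have hνL : 0 < ν * L := by positivity
  have hMp : 0 < M := by linarith
  have hK1 : 1 ≤ K := by rw [hK]; nlinarith [mul_pos hMp ha0]
  refine ⟨K, hK1, fun k τ hk hk1 hkρ hτ hkτ => ?_⟩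
  obtain ⟨p⟩ := nonempty_smoothedPower (ε := k ^ 4) hν (by positivity)
  have heτ1 : 1 ≤ Real.exp τ := Real.one_le_exp hτ
  have hexpmul : ∀ c : ℝ, c ≤ 5 → k * Real.exp (c * τ) ≤ 1 := fun c hc =>
    (mul_le_mul_of_nonneg_left (Real.exp_le_exp.2 (by nlinarith)) hk.le).trans hkτ
  have hkeτ : k * Real.exp τ ≤ 1 := by simpa using hexpmul 1 (by norm_num)
  have hτe : τ ≤ Real.exp τ := by linarith [Real.add_one_le_exp τ]
  have hkτ1 : k * τ ≤ 1 := (mul_le_mul_of_nonneg_left hτe hk.le).trans hkeτ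
  have hk2 : k ^ 2 ≤ k := by nlinarith
  have hk3 : k ^ 3 ≤ 1 := pow_le_one₀ hk.le hk1
  have hk6 : k ^ 6 ≤ 1 := pow_le_one₀ hk.le hk1
  set E : ℝ → ℝ := fun s => τ * s - p.Q s / k ^ 2 with hE
  set E1 : ℝ → ℝ := fun s => τ - p.q s / k ^ 2 with hE1
  set E2 : ℝ → ℝ := fun s => -p.q1 s / k ^ 2 with hE2
  set E3 : ℝ → ℝ := fun s => -p.q2 s / k ^ 2 with hE3
  set w : ℝ → ℝ := fun s => Real.exp (E s) with hw
  have dE : ∀ s, HasDerivAt E (E1 s) s := fun s =>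
    HasDerivAt.congr_deriv (f := E) (((hasDerivAt_id s).const_mul τ).sub
      ((p.hasDerivAt_Q s).div_const _)) (by simp [hE1])
  have dE1 : ∀ s, HasDerivAt E1 (E2 s) s := fun s =>
    HasDerivAt.congr_deriv (f := E1) (((p.hasDerivAt_q s).div_const (k ^ 2)).const_sub τ)
      (by simp only [hE2]; ring)
  have dE2 : ∀ s, HasDerivAt E2 (E3 s) s := fun s => ((p.hasDerivAt_q1 s).neg).div_const _
  have dw : ∀ s, HasDerivAt w (E1 s * w s) s := fun s =>
    HasDerivAt.congr_deriv (f := w) (dE s).exp (by ring)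
  have hw0 : ∀ s, 0 < w s := fun s => Real.exp_pos _
  set W : ℝ → ℝ := fun s => η s * w s with hW
  set W1 : ℝ → ℝ := fun s => (η1 s + η s * E1 s) * w s with hW1
  set W2 : ℝ → ℝ := fun s => (η2 s + 2 * η1 s * E1 s + η s * (E1 s ^ 2 + E2 s)) * w s with hW2
  set W3 : ℝ → ℝ := fun s => (η3 s + 3 * η2 s * E1 s + 3 * η1 s * (E1 s ^ 2 + E2 s)
    + η s * (E1 s ^ 3 + 3 * E1 s * E2 s + E3 s)) * w s with hW3
  have dW : ∀ s, HasDerivAt W (W1 s) s := fun s =>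
    HasDerivAt.congr_deriv (f := W) ((dη s).mul (dw s)) (by simp only [hW1]; ring)
  have dW1 : ∀ s, HasDerivAt W1 (W2 s) s := fun s =>
    HasDerivAt.congr_deriv (f := W1) (((dη1 s).add ((dη s).mul (dE1 s))).mul (dw s))
      (by simp only [hW2, Pi.add_apply, Pi.mul_apply]; ring)
  have dW2 : ∀ s, HasDerivAt W2 (W3 s) s := fun s =>
    HasDerivAt.congr_deriv (f := W2) ((((dη2 s).add (((dη1 s).const_mul 2).mul (dE1 s))).add
      ((dη s).mul (((dE1 s).pow 2).add (dE2 s)))).mul (dw s))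
      (by simp only [hW3, Pi.add_apply, Pi.mul_apply, Pi.pow_apply]; ring)
  have hcW3 : Continuous W3 := by
    have c1 : Continuous η := continuous_iff_continuousAt.2 fun x => (dη x).continuousAt
    have c2 : Continuous η1 := continuous_iff_continuousAt.2 fun x => (dη1 x).continuousAt
    have c3 : Continuous η2 := continuous_iff_continuousAt.2 fun x => (dη2 x).continuousAt
    have c4 : Continuous w := continuous_iff_continuousAt.2 fun x => (dw x).continuousAt
    have c5 : Continuous E1 := continuous_iff_continuousAt.2 fun x => (dE1 x).continuousAt
    have c6 : Continuous E2 := continuous_iff_continuousAt.2 fun x => (dE2 x).continuousAt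
    have c7 : Continuous E3 := p.continuous_q2.neg.div_const _
    rw [hW3]; fun_prop
  have hsuppW : ∀ s, s ≤ -(3 * y₀ / 4) ∨ 3 * ρ / 4 ≤ s →
      W s = 0 ∧ W1 s = 0 ∧ W2 s = 0 ∧ W3 s = 0 := by
    intro s hs
    obtain ⟨z0, z1, z2, z3⟩ := hsupp s hs
    simp [hW, hW1, hW2, hW3, z0, z1, z2, z3]
  -- pointwise bounds on the support
  have hQd : ∀ s, 0 ≤ p.Q s / k ^ 2 := fun s => div_nonneg (p.Q_nonneg s) (by positivity)
  have hwle : ∀ s ≤ 1, w s ≤ Real.exp τ := fun s hs => Real.exp_le_exp.2 (by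
    have := hQd s
    simp only [hE]; nlinarith)
  -- A derivative of the exponent looks as large as `q / k²`, but `q² ≤ 2νQ` bounds `q / k` by a
  -- multiple of `exp(Q / k²)`, which the decay of `w` cancels. The first derivative thus costs
  -- `k⁻¹` instead of `k⁻²`.
  have hkE1w : ∀ s ≤ 1, |k * E1 s * w s| ≤ L * Real.exp τ := by
    intro s hs
    have h1 : p.q s / k ≤ (1 + 2 * ν) * Real.exp (p.Q s / k ^ 2) := by
      have e1 := Real.add_one_le_exp (p.Q s / k ^ 2)
      have e2 := p.sq_le s hs
      have e3 : (p.q s / k) ^ 2 ≤ 2 * ν * (p.Q s / k ^ 2) := by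
        rw [div_pow, ← mul_div_assoc]; gcongr
      have e4 := hQd s
      nlinarith [sq_nonneg (p.q s / k - 1)]
    have h2 : p.q s / k * w s ≤ (1 + 2 * ν) * Real.exp τ := by
      have : w s ≤ Real.exp τ * Real.exp (-(p.Q s / k ^ 2)) := by
        rw [← Real.exp_add]; apply Real.exp_le_exp.2; simp only [hE]; nlinarith
      calc p.q s / k * w s ≤ ((1 + 2 * ν) * Real.exp (p.Q s / k ^ 2)) *
            (Real.exp τ * Real.exp (-(p.Q s / k ^ 2))) := by
            have := (hw0 s).le
            gcongr
        _ = (1 + 2 * ν) * Real.exp τ * (Real.exp (p.Q s / k ^ 2) *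
            Real.exp (-(p.Q s / k ^ 2))) := by ring
        _ = _ := by rw [← Real.exp_add]; simp
    have h3 : k * E1 s * w s = k * τ * w s - p.q s / k * w s := by
      simp only [hE1]; field_simp
    have h4 : k * τ * w s ≤ 1 * Real.exp τ := by
      have := hwle s hs; have := (hw0 s).le; gcongr
    have h5 : 0 ≤ k * τ * w s := by have := (hw0 s).le; positivity
    have h6 : 0 ≤ p.q s / k * w s := by have := (hw0 s).le; have := p.q_nonneg s; positivity
    rw [h3, abs_le, hL]
    constructor <;> nlinarith
  have hE1b : ∀ s ≤ 1, |k ^ 2 * E1 s| ≤ 2 := by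
    intro s hs
    have h3 : k ^ 2 * E1 s = k * (k * τ) - p.q s := by simp only [hE1]; field_simp
    have h4 : k * (k * τ) ≤ 1 := mul_le_one₀ hk1 (by positivity) hkτ1
    have h5 : 0 ≤ k * (k * τ) := by positivity
    rw [h3, abs_le]
    constructor <;> linarith [p.q_nonneg s, p.q_le s hs]
  have hE2b : ∀ s ≤ 1, |k ^ 2 * E2 s| ≤ ν := by
    intro s hs
    have h3 : k ^ 2 * E2 s = -p.q1 s := by simp only [hE2]; field_simp
    rw [h3, abs_neg]; exact p.abs_q1_le s hs
  have hE3b : ∀ s ≤ 1, |k ^ 6 * E3 s| ≤ ν := by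
    intro s hs
    have h3 : k ^ 6 * E3 s = -(k ^ 4 * p.q2 s) := by simp only [hE3]; field_simp
    rw [h3, abs_neg, abs_mul, abs_of_pos (by positivity : 0 < k ^ 4)]
    calc k ^ 4 * |p.q2 s| ≤ k ^ 4 * (ν / k ^ 4) := by gcongr; exact p.abs_q2_le s hs
      _ = ν := by field_simp
  have hout : ∀ {f : ℝ → ℝ} {b : ℝ → ℝ}, (∀ s, 0 ≤ b s) →
      (∀ s, s ≤ -(3 * y₀ / 4) ∨ 3 * ρ / 4 ≤ s → f s = 0) → (∀ s ≤ 1, |f s| ≤ b s) →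
      ∀ s, |f s| ≤ b s := by
    intro f b hb hz h s
    rcases le_or_gt s 1 with hs | hs
    · exact h s hs
    · rw [hz s (Or.inr (by linarith)), abs_zero]; exact hb s
  have hηa : ∀ s, |η s| ≤ 1 := fun s => by rw [abs_of_nonneg (h01 s).1]; exact (h01 s).2
  have heτ0 := Real.exp_pos τ
  have hmul : ∀ {a b A B : ℝ}, |a| ≤ A → |b| ≤ B → |a * b| ≤ A * B := fun ha hb => by
    rw [abs_mul]; exact mul_le_mul ha hb (abs_nonneg _) ((abs_nonneg _).trans ha)
  have hkp : ∀ n : ℕ, |k ^ n| ≤ 1 := fun n => by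
    rw [abs_of_nonneg (by positivity)]; exact pow_le_one₀ hk.le hk1
  have hwa : ∀ s ≤ 1, |w s| ≤ Real.exp τ := fun s hs => by
    rw [abs_of_pos (hw0 s)]; exact hwle s hs
  have hab1 : ∀ s ≤ 1, |k * W1 s| ≤ K * Real.exp τ := fun s hs => by
    have e1 : k * W1 s = k ^ 1 * (η1 s * w s) + η s * (k * E1 s * w s) := by simp only [hW1]; ring
    rw [e1]
    refine (abs_add_le _ _).trans ((add_le_add (hmul (hkp 1) (hmul (hM1 s) (hwa s hs)))
      (hmul (hηa s) (hkE1w s hs))).trans ?_)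
    have : 1 * (M * Real.exp τ) + 1 * (L * Real.exp τ) = (M + L) * Real.exp τ := by ring
    rw [this]
    apply mul_le_mul_of_nonneg_right _ heτ0.le
    rw [hK]; linarith [mul_pos hMp ha0, mul_pos hMp hL0, mul_pos hMp hν0]
  have hmid : ∀ s ≤ 1, |k ^ 2 * E1 s * (k * E1 s * w s) + k ^ 1 * (k ^ 2 * E2 s * w s)| ≤
      (2 * L + ν) * Real.exp τ := fun s hs => by
    refine (abs_add_le _ _).trans ((add_le_add (hmul (hE1b s hs) (hkE1w s hs))
      (hmul (hkp 1) (hmul (hE2b s hs) (hwa s hs)))).trans (le_of_eq (by ring)))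
  have hab2 : ∀ s ≤ 1, |k ^ 3 * W2 s| ≤ K * Real.exp τ := fun s hs => by
    have e1 : k ^ 3 * W2 s = k ^ 3 * (η2 s * w s) + 2 * (k ^ 2 * (η1 s * (k * E1 s * w s)))
        + η s * (k ^ 2 * E1 s * (k * E1 s * w s) + k ^ 1 * (k ^ 2 * E2 s * w s)) := by
      simp only [hW2]; ring
    rw [e1]
    refine (abs_add_three _ _ _).trans ((add_le_add (add_le_add
      (hmul (hkp 3) (hmul (hM2 s) (hwa s hs)))
      (hmul (abs_two.le) (hmul (hkp 2) (hmul (hM1 s) (hkE1w s hs)))))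
      (hmul (hηa s) (hmid s hs))).trans ?_)
    have : 1 * (M * Real.exp τ) + 2 * (1 * (M * (L * Real.exp τ))) +
        1 * ((2 * L + ν) * Real.exp τ) = (M + 2 * M * L + 2 * L + ν) * Real.exp τ := by ring
    rw [this]
    apply mul_le_mul_of_nonneg_right _ heτ0.le
    rw [hK]; linarith [mul_pos hMp ha0, mul_pos hMp hL0, mul_pos hMp hν0]
  -- The worst term is `E3`, of size `k⁻⁶`; the others are at most of order `k⁻⁵`. Each product is
  -- grouped so that one factor `E1` is paired with `w` whenever it occurs.
  have hab3 : ∀ s ≤ 1, |k ^ 6 * W3 s| ≤ K * Real.exp τ := fun s hs => by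
    have e1 : k ^ 6 * W3 s = k ^ 6 * (η3 s * w s) + 3 * (k ^ 5 * (η2 s * (k * E1 s * w s)))
        + 3 * (k ^ 3 * (η1 s * (k ^ 2 * E1 s * (k * E1 s * w s) + k ^ 1 * (k ^ 2 * E2 s * w s))))
        + η s * (k ^ 1 * (k ^ 2 * E1 s * (k ^ 2 * E1 s * (k * E1 s * w s)))
          + 3 * (k ^ 3 * (k ^ 2 * E2 s * (k * E1 s * w s))) + k ^ 6 * E3 s * w s) := by
      simp only [hW3]; ring
    rw [e1]
    have h3 : |(3 : ℝ)| ≤ 3 := by norm_num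
    refine (abs_add_le _ _).trans ((add_le_add ((abs_add_three _ _ _).trans (add_le_add (add_le_add
      (hmul (hkp 6) (hmul (hM3 s) (hwa s hs)))
      (hmul h3 (hmul (hkp 5) (hmul (hM2 s) (hkE1w s hs)))))
      (hmul h3 (hmul (hkp 3) (hmul (hM1 s) (hmid s hs))))))
      (hmul (hηa s) ((abs_add_three _ _ _).trans (add_le_add (add_le_add
        (hmul (hkp 1) (hmul (hE1b s hs) (hmul (hE1b s hs) (hkE1w s hs))))
        (hmul h3 (hmul (hkp 3) (hmul (hE2b s hs) (hkE1w s hs)))))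
        (hmul (hE3b s hs) (hwa s hs)))))).trans ?_)
    have : 1 * (M * Real.exp τ) + 3 * (1 * (M * (L * Real.exp τ))) +
        3 * (1 * (M * ((2 * L + ν) * Real.exp τ))) + 1 * (1 * (2 * (2 * (L * Real.exp τ))) +
        3 * (1 * (ν * (L * Real.exp τ))) + ν * Real.exp τ) =
        (M + 3 * M * L + 3 * M * (2 * L + ν) + (4 * L + 3 * ν * L + ν)) * Real.exp τ := by ring
    rw [this]
    apply mul_le_mul_of_nonneg_right _ heτ0.le
    rw [hK]; linarith [mul_pos hMp ha0, mul_pos hMp hL0, mul_pos hMp hν0]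
  have henv0 : ∀ s ≤ 0, w s ≤ Real.exp (τ * s) := fun s hs => by
    apply Real.exp_le_exp.2
    simp only [hE]; linarith [hQd s]
  -- The derivative of `W` contains `η' w`, so it is compared with the uncut `w` rather than with
  -- `W`. The truncation at `1` is harmless since `η` vanishes for `s ≥ 3ρ/4`.
  set env : ℝ → ℝ := fun s => if s ≤ 1 then w s else 0 with henv
  have henv1 : ∀ s ≤ 1, env s = w s := fun s hs => if_pos hs
  have henvn : ∀ s, 0 ≤ env s := fun s => by
    simp only [henv]; split_ifs
    · exact (hw0 s).le
    · exact le_rfl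
  have hpos : ∀ δ, 0 < δ → k ^ 4 ≤ δ / 2 → ∀ s ≤ 1, δ ≤ s →
      w s ≤ (ν + 1) / (δ / 2) ^ (ν + 1) * Real.exp (-(2 * τ)) := by
    intro δ hδ hkδ s hs hδs
    have h1 : (δ / 2) ^ (ν + 1) / (ν + 1) ≤ p.Q s := by
      refine le_trans ?_ (p.le_Q s)
      gcongr
      exact le_max_of_le_left (by linarith)
    set A := (δ / 2) ^ (ν + 1) / (ν + 1) with hA
    have hA0 : 0 < A := by positivity
    have hAi : (ν + 1) / (δ / 2) ^ (ν + 1) = 1 / A := by rw [hA]; field_simp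
    -- Polynomial decay in `k` is enough here: one factor `k` already pays for `e^{3τ}`.
    have h2 : Real.exp (-(A / k ^ 2)) ≤ k ^ 2 / A := by
      rw [Real.exp_neg, inv_le_comm₀ (Real.exp_pos _) (by positivity), inv_div]
      linarith [Real.add_one_le_exp (A / k ^ 2)]
    have h3 : k * Real.exp (3 * τ) ≤ 1 := hexpmul 3 (by norm_num)
    have h4 : k ^ 2 * Real.exp (3 * τ) ≤ 1 :=
      (mul_le_mul_of_nonneg_right hk2 (Real.exp_pos _).le).trans h3
    calc w s ≤ Real.exp τ * Real.exp (-(A / k ^ 2)) := by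
          rw [← Real.exp_add]
          apply Real.exp_le_exp.2
          have : A / k ^ 2 ≤ p.Q s / k ^ 2 := by gcongr
          simp only [hE]; nlinarith
      _ ≤ Real.exp τ * (k ^ 2 / A) := by gcongr
      _ = (k ^ 2 * Real.exp (3 * τ)) * Real.exp (-(2 * τ)) / A := by
          rw [mul_assoc, ← Real.exp_add, show 3 * τ + -(2 * τ) = τ by ring]; ring
      _ ≤ 1 * Real.exp (-(2 * τ)) / A := by gcongr
      _ = _ := by rw [hAi]; ring
  have hy2 : Real.exp (-(2 * τ)) ≤ Real.exp (-(y₀ / 2 * τ)) := Real.exp_le_exp.2 (by nlinarith)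
  -- The derivative of `η` lives on two ramps. On the left one `e^{τs}` is at most `e^{-y₀τ/2}`; on
  -- the right one the damping gives `e^{-2τ}`, which suffices because `y₀ ≤ 4`.
  have hη1w : ∀ s ≤ 1, |η1 s * w s| ≤ M * ((1 + a) * Real.exp (-(y₀ / 2 * τ))) := by
    intro s hs
    have hpe := Real.exp_pos (-(y₀ / 2 * τ))
    rcases le_or_gt s (-(y₀ / 2)) with h1 | h1
    · refine hmul (hM1 s) ?_
      rw [abs_of_pos (hw0 s)]
      calc w s ≤ Real.exp (τ * s) := henv0 s (by linarith)
        _ ≤ Real.exp (-(y₀ / 2 * τ)) := Real.exp_le_exp.2 (by nlinarith)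
        _ ≤ _ := by nlinarith
    · rcases le_or_gt s (ρ / 2) with h2 | h2
      · rw [(hone s h1.le h2).2, zero_mul, abs_zero]; positivity
      · refine hmul (hM1 s) ?_
        rw [abs_of_pos (hw0 s)]
        calc w s ≤ a * Real.exp (-(2 * τ)) := hpos (ρ / 2) (by positivity) (by linarith) s hs h2.le
          _ ≤ a * Real.exp (-(y₀ / 2 * τ)) := by gcongr
          _ ≤ _ := by nlinarith
  have htr : ∀ s ≤ 1, |k ^ 2 * W1 s + (max s 0 ^ ν - k ^ 2 * τ) * W s| ≤
      K * k ^ 2 * Real.exp (-(y₀ / 2 * τ)) := by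
    intro s hs
    have e1 : k ^ 2 * W1 s + (max s 0 ^ ν - k ^ 2 * τ) * W s =
        k ^ 2 * (η1 s * w s) + η s * ((max s 0 ^ ν - p.q s) * w s) := by
      simp only [hW1, hW, hE1]; field_simp; ring
    -- This absorbs the error of replacing `s₊ ^ ν` by `q`.
    have h1 : k ^ 4 * Real.exp τ ≤ k ^ 2 * Real.exp (-(y₀ / 2 * τ)) := by
      have h2 : k * Real.exp ((1 + y₀ / 2) * τ) ≤ 1 := hexpmul _ (by linarith)
      calc k ^ 4 * Real.exp τ = k ^ 2 * k * (k * Real.exp ((1 + y₀ / 2) * τ)) *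
            Real.exp (-(y₀ / 2 * τ)) := by
            rw [mul_assoc (k ^ 2 * k), mul_assoc k, ← Real.exp_add]
            rw [show (1 + y₀ / 2) * τ + -(y₀ / 2 * τ) = τ by ring]; ring
        _ ≤ k ^ 2 * 1 * 1 * Real.exp (-(y₀ / 2 * τ)) := by gcongr
        _ = _ := by ring
    rw [e1]
    refine (abs_add_le _ _).trans ((add_le_add (hmul (abs_of_pos (by positivity)).le (hη1w s hs))
      (hmul (hηa s) (hmul (p.abs_sub_le s hs) (hwa s hs)))).trans ?_)
    calc k ^ 2 * (M * ((1 + a) * Real.exp (-(y₀ / 2 * τ)))) + 1 * (ν * k ^ 4 * Real.exp τ)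
        = M * (1 + a) * (k ^ 2 * Real.exp (-(y₀ / 2 * τ))) + ν * (k ^ 4 * Real.exp τ) := by ring
      _ ≤ M * (1 + a) * (k ^ 2 * Real.exp (-(y₀ / 2 * τ)))
          + ν * (k ^ 2 * Real.exp (-(y₀ / 2 * τ))) := by gcongr
      _ = (M * (1 + a) + ν) * (k ^ 2 * Real.exp (-(y₀ / 2 * τ))) := by ring
      _ ≤ K * (k ^ 2 * Real.exp (-(y₀ / 2 * τ))) := by
        gcongr
        rw [hK]; linarith [mul_pos hMp ha0, mul_pos hMp hL0, mul_pos hMp hν0]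
      _ = _ := by ring
  exact ⟨{
    W := W, W1 := W1, W2 := W2, W3 := W3, env := env
    hasDerivAt_W := dW, hasDerivAt_W1 := dW1, hasDerivAt_W2 := dW2, continuous_W3 := hcW3
    supp := hsuppW
    W_le := hout (fun _ => heτ0.le) (fun s hs => (hsuppW s hs).1) fun s hs => by
      exact (hmul (hηa s) (hwa s hs)).trans (one_mul _).le
    W1_le := fun s => by
      have := hout (f := fun s => k * W1 s) (b := fun _ => K * Real.exp τ)
        (fun _ => by positivity) (fun s hs => by simp [(hsuppW s hs).2.1]) hab1 s
      rwa [abs_mul, abs_of_pos hk] at this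
    W2_le := fun s => by
      have := hout (f := fun s => k ^ 3 * W2 s) (b := fun _ => K * Real.exp τ)
        (fun _ => by positivity) (fun s hs => by simp [(hsuppW s hs).2.2.1]) hab2 s
      rwa [abs_mul, abs_of_pos (by positivity)] at this
    W3_le := fun s => by
      have := hout (f := fun s => k ^ 6 * W3 s) (b := fun _ => K * Real.exp τ)
        (fun _ => by positivity) (fun s hs => by simp [(hsuppW s hs).2.2.2]) hab3 s
      rwa [abs_mul, abs_of_pos (by positivity)] at this
    transport := hout (fun _ => by positivity)
      (fun s hs => by simp [(hsuppW s hs).1, (hsuppW s hs).2.1]) htr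
    eq_exp := fun s h1 h2 => by
      simp only [hW, hw, hE]
      rw [(hone s h1 (by linarith)).1, p.Q_eq_zero s h2, zero_div, sub_zero, one_mul]
    W_le_env := hout henvn (fun s hs => (hsuppW s hs).1) fun s hs => by
      rw [henv1 s hs]
      exact (hmul (hηa s) (abs_of_pos (hw0 s)).le).trans (one_mul _).le
    W1_le_env := fun s => by
      have := hout (f := fun s => k ^ 2 * W1 s) (b := fun s => K * env s)
        (fun s => mul_nonneg (by linarith) (henvn s)) (fun s hs => by simp [(hsuppW s hs).2.1])
        (fun s hs => by
          rw [henv1 s hs]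
          have e1 : k ^ 2 * W1 s = (k ^ 2 * η1 s + η s * (k ^ 2 * E1 s)) * w s := by
            simp only [hW1]; ring
          rw [e1]
          refine hmul ((abs_add_le _ _).trans ((add_le_add (hmul (hkp 2) (hM1 s))
            (hmul (hηa s) (hE1b s hs))).trans ?_)) (abs_of_pos (hw0 s)).le
          rw [hK]; linarith [mul_pos hMp ha0, mul_pos hMp hL0, mul_pos hMp hν0]) s
      rwa [abs_mul, abs_of_pos (by positivity)] at this
    env_nonneg := henvn
    env_le_of_nonpos := fun s hs => by rw [henv1 s (by linarith)]; exact henv0 s hs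
    env_le_of_pos := fun δ hδ hkδ s hs => by
      rcases le_or_gt s 1 with h | h
      · rw [henv1 s h]; exact hpos δ hδ hkδ s h hs
      · simp only [henv]; rw [if_neg (not_le.2 h)]; positivity }⟩

/-! ### Functions on the circle and torus, and the weak Grushin operator. -/

/-- The representative in `[-π, π)` of a point of the circle. -/
noncomputable def Circ.rep (p : Circ) : ℝ :=
  (AddCircle.equivIco (2 * Real.pi) (-Real.pi) p : ℝ)

theorem Circ.rep_mem (p : Circ) : -Real.pi ≤ p.rep ∧ p.rep < Real.pi := by
  have h := (AddCircle.equivIco (2 * Real.pi) (-Real.pi) p).2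
  exact ⟨h.1, by have := h.2; unfold Circ.rep; linarith⟩

theorem Circ.coe_rep (p : Circ) : ((p.rep : ℝ) : Circ) = p :=
  AddCircle.coe_equivIco

theorem Circ.rep_coe {x : ℝ} (h : -Real.pi ≤ x) (h' : x < Real.pi) : Circ.rep (x : Circ) = x := by
  have := AddCircle.liftIco_coe_apply (p := 2 * Real.pi) (a := -Real.pi) (f := fun x : ℝ => x)
    (x := x) ⟨h, by linarith⟩
  exact this

theorem Circ.continuous_comp_rep {B : Type*} [TopologicalSpace B] {f : ℝ → B} (hf : Continuous f)
    (h : f (-Real.pi) = f Real.pi) : Continuous fun p : Circ => f p.rep :=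
  AddCircle.liftIco_continuous (p := 2 * Real.pi) (a := -Real.pi)
    (by rw [h]; congr 1; ring) hf.continuousOn

theorem Circ.integral_eq {E : Type*} [NormedAddCommGroup E] [NormedSpace ℝ E] (f : Circ → E) :
    ∫ p, f p = ∫ x in -Real.pi..Real.pi, f (x : Circ) := by
  rw [← AddCircle.intervalIntegral_preimage (2 * Real.pi) (-Real.pi) f]
  congr 1; ring

theorem Circ.integral_comp_rep {E : Type*} [NormedAddCommGroup E] [NormedSpace ℝ E]
    {f : Circ → E} {g : ℝ → E}
    (h : ∀ x : ℝ, -Real.pi ≤ x → x < Real.pi → f (x : Circ) = g x) :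
    ∫ p, f p = ∫ x in -Real.pi..Real.pi, g x := by
  rw [Circ.integral_eq]
  have hpi := Real.pi_pos
  rw [intervalIntegral.integral_of_le (by linarith), intervalIntegral.integral_of_le (by linarith),
    integral_Ioc_eq_integral_Ioo, integral_Ioc_eq_integral_Ioo]
  exact setIntegral_congr_fun measurableSet_Ioo fun x hx => h x hx.1.le hx.2

/-- A function on the line, with its first two derivatives, all vanishing at `± π`. -/
structure IsC2Bump (f f1 f2 : ℝ → ℂ) : Prop where
  hasDerivAt : ∀ x, HasDerivAt f (f1 x) x
  hasDerivAt' : ∀ x, HasDerivAt f1 (f2 x) x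
  continuous : Continuous f2
  left : f (-Real.pi) = 0 ∧ f1 (-Real.pi) = 0 ∧ f2 (-Real.pi) = 0
  right : f Real.pi = 0 ∧ f1 Real.pi = 0 ∧ f2 Real.pi = 0

namespace IsC2Bump

variable {f f1 f2 : ℝ → ℂ}

theorem continuous_fun (h : IsC2Bump f f1 f2) : Continuous f :=
  continuous_iff_continuousAt.2 fun x => (h.hasDerivAt x).continuousAt

theorem continuous_deriv (h : IsC2Bump f f1 f2) : Continuous f1 :=
  continuous_iff_continuousAt.2 fun x => (h.hasDerivAt' x).continuousAt

theorem continuous_rep (h : IsC2Bump f f1 f2) : Continuous fun p : Circ => f p.rep :=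
  Circ.continuous_comp_rep h.continuous_fun (by rw [h.left.1, h.right.1])

theorem continuous_deriv_rep (h : IsC2Bump f f1 f2) : Continuous fun p : Circ => f1 p.rep :=
  Circ.continuous_comp_rep h.continuous_deriv (by rw [h.left.2.1, h.right.2.1])

theorem continuous_deriv2_rep (h : IsC2Bump f f1 f2) : Continuous fun p : Circ => f2 p.rep :=
  Circ.continuous_comp_rep h.continuous (by rw [h.left.2.2, h.right.2.2])

theorem integral_mul_deriv2 (h : IsC2Bump f f1 f2) {θ θ1 θ2 : ℝ → ℂ}
    (h0 : ∀ x, HasDerivAt θ (θ1 x) x) (h1 : ∀ x, HasDerivAt θ1 (θ2 x) x) (h2 : Continuous θ2) :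
    ∫ x in -Real.pi..Real.pi, f x * θ2 x = ∫ x in -Real.pi..Real.pi, f2 x * θ x := by
  have c1 : Continuous θ1 := continuous_iff_continuousAt.2 fun x => (h1 x).continuousAt
  rw [intervalIntegral.integral_mul_deriv_eq_deriv_mul (fun x _ => h.hasDerivAt x)
    (fun x _ => h1 x) (h.continuous_deriv.intervalIntegrable _ _) (h2.intervalIntegrable _ _),
    intervalIntegral.integral_mul_deriv_eq_deriv_mul (fun x _ => h.hasDerivAt' x)
    (fun x _ => h0 x) (h.continuous.intervalIntegrable _ _) (c1.intervalIntegrable _ _),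
    h.left.1, h.right.1, h.left.2.1, h.right.2.1]
  ring

end IsC2Bump

namespace SmoothOnTorus

variable {φ : Torus → ℂ}

theorem continuous (h : SmoothOnTorus φ) : Continuous φ := by
  have hq : IsOpenQuotientMap (fun x : ℝ => (x : Circ)) := QuotientAddGroup.isOpenQuotientMap_mk
  have hqq := hq.prodMap hq
  rw [hqq.isQuotientMap.continuous_iff]
  exact ContDiff.continuous h

theorem dX_lift (h : SmoothOnTorus φ) (q : ℝ × ℝ) :
    dX φ ((q.1 : Circ), (q.2 : Circ)) =
      fderiv ℝ (fun q : ℝ × ℝ => φ ((q.1 : Circ), (q.2 : Circ))) q (1, 0) := by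
  have h1 : HasFDerivAt (fun q : ℝ × ℝ => φ ((q.1 : Circ), (q.2 : Circ))) _ (q.1 + 0, q.2) :=
    ((ContDiff.differentiable h (by simp)) (q.1 + 0, q.2)).hasFDerivAt
  have h2 : HasDerivAt (fun s : ℝ => (q.1 + s, q.2)) ((1 : ℝ), (0 : ℝ)) 0 :=
    ((hasDerivAt_id (0 : ℝ)).const_add q.1).prodMk (hasDerivAt_const _ _)
  have h3 := h1.comp_hasDerivAt (0 : ℝ) h2
  have h4 : dX φ ((q.1 : Circ), (q.2 : Circ)) = deriv ((fun q : ℝ × ℝ =>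
      φ ((q.1 : Circ), (q.2 : Circ))) ∘ fun s : ℝ => (q.1 + s, q.2)) 0 := by
    unfold dX; congr 1
  rw [h4, h3.deriv, add_zero]

theorem dY_lift (h : SmoothOnTorus φ) (q : ℝ × ℝ) :
    dY φ ((q.1 : Circ), (q.2 : Circ)) =
      fderiv ℝ (fun q : ℝ × ℝ => φ ((q.1 : Circ), (q.2 : Circ))) q (0, 1) := by
  have h1 : HasFDerivAt (fun q : ℝ × ℝ => φ ((q.1 : Circ), (q.2 : Circ))) _ (q.1, q.2 + 0) :=
    ((ContDiff.differentiable h (by simp)) (q.1, q.2 + 0)).hasFDerivAt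
  have h2 : HasDerivAt (fun s : ℝ => (q.1, q.2 + s)) ((0 : ℝ), (1 : ℝ)) 0 :=
    (hasDerivAt_const _ _).prodMk ((hasDerivAt_id (0 : ℝ)).const_add q.2)
  have h3 := h1.comp_hasDerivAt (0 : ℝ) h2
  have h4 : dY φ ((q.1 : Circ), (q.2 : Circ)) = deriv ((fun q : ℝ × ℝ =>
      φ ((q.1 : Circ), (q.2 : Circ))) ∘ fun s : ℝ => (q.1, q.2 + s)) 0 := by
    unfold dY; congr 1
  rw [h4, h3.deriv, add_zero]

theorem smooth_dX (h : SmoothOnTorus φ) : SmoothOnTorus (dX φ) := by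
  unfold SmoothOnTorus
  simp_rw [h.dX_lift]
  exact (ContDiff.fderiv_right h (m := ∞) (by simp)).clm_apply contDiff_const

theorem smooth_dY (h : SmoothOnTorus φ) : SmoothOnTorus (dY φ) := by
  unfold SmoothOnTorus
  simp_rw [h.dY_lift]
  exact (ContDiff.fderiv_right h (m := ∞) (by simp)).clm_apply contDiff_const

theorem hasDerivAt_dX (h : SmoothOnTorus φ) (x : ℝ) (y : Circ) :
    HasDerivAt (fun x : ℝ => φ ((x : Circ), y)) (dX φ ((x : Circ), y)) x := by
  obtain ⟨y, rfl⟩ := QuotientAddGroup.mk_surjective y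
  have h1 : HasFDerivAt (fun q : ℝ × ℝ => φ ((q.1 : Circ), (q.2 : Circ))) _ (x, y) :=
    ((ContDiff.differentiable h (by simp)) (x, y)).hasFDerivAt
  have h2 : HasDerivAt (fun s : ℝ => (s, y)) ((1 : ℝ), (0 : ℝ)) x :=
    (hasDerivAt_id x).prodMk (hasDerivAt_const _ _)
  exact (h1.comp_hasDerivAt x h2).congr_deriv (h.dX_lift (x, y)).symm

theorem hasDerivAt_dY (h : SmoothOnTorus φ) (x : Circ) (y : ℝ) :
    HasDerivAt (fun y : ℝ => φ (x, (y : Circ))) (dY φ (x, (y : Circ))) y := by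
  obtain ⟨x, rfl⟩ := QuotientAddGroup.mk_surjective x
  have h1 : HasFDerivAt (fun q : ℝ × ℝ => φ ((q.1 : Circ), (q.2 : Circ))) _ (x, y) :=
    ((ContDiff.differentiable h (by simp)) (x, y)).hasFDerivAt
  have h2 : HasDerivAt (fun s : ℝ => (x, s)) ((0 : ℝ), (1 : ℝ)) y :=
    (hasDerivAt_const _ _).prodMk (hasDerivAt_id y)
  exact (h1.comp_hasDerivAt y h2).congr_deriv (h.dY_lift (x, y)).symm

theorem continuous_grushin (h : SmoothOnTorus φ) {V : Circ → ℝ} (hV : Continuous V) :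
    Continuous (grushin V φ) := by
  have h1 := h.smooth_dX.smooth_dX.continuous
  have h2 := h.smooth_dY.smooth_dY.continuous
  unfold grushin
  fun_prop

end SmoothOnTorus

theorem integrable_torus_of_continuous {E : Type*} [NormedAddCommGroup E] {f : Torus → E}
    (hf : Continuous f) : Integrable f :=
  hf.integrable_of_hasCompactSupport (HasCompactSupport.of_compactSpace f)

theorem IsGrushinPotential.continuous {V : Circ → ℝ} (hV : IsGrushinPotential V) : Continuous V := by
  have hq : IsOpenQuotientMap (fun x : ℝ => (x : Circ)) := QuotientAddGroup.isOpenQuotientMap_mk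
  rw [hq.isQuotientMap.continuous_iff]
  exact hV.smooth.continuous

/-- Fubini reduces the identity to two integrations by parts in each variable. The coefficient `V`
depends on `x` alone, so it is a constant for the integration in `y`; vanishing at `±π` removes the
boundary terms. -/
theorem IsC2Bump.isWeakGrushin {V : Circ → ℝ} (hV : Continuous V) {f f1 f2 u u1 u2 : ℝ → ℂ}
    (hf : IsC2Bump f f1 f2) (hu : IsC2Bump u u1 u2) :
    IsWeakGrushin V (fun p => f p.1.rep * u p.2.rep)
      (fun p => f2 p.1.rep * u p.2.rep + V p.1 * f p.1.rep * u2 p.2.rep) := by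
  intro φ hφ
  have c1 := hφ.smooth_dX.smooth_dX.continuous
  have c2 := hφ.smooth_dY.smooth_dY.continuous
  have c0 := hφ.continuous
  have cf : Continuous fun p : Torus => f p.1.rep := hf.continuous_rep.comp continuous_fst
  have cf2 : Continuous fun p : Torus => f2 p.1.rep := hf.continuous_deriv2_rep.comp continuous_fst
  have cu : Continuous fun p : Torus => u p.2.rep := hu.continuous_rep.comp continuous_snd
  have cu2 : Continuous fun p : Torus => u2 p.2.rep := hu.continuous_deriv2_rep.comp continuous_snd
  have cV : Continuous fun p : Torus => (V p.1 : ℂ) :=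
    Complex.continuous_ofReal.comp (hV.comp continuous_fst)
  have i1 : Integrable (fun p : Torus => (f p.1.rep * dX (dX φ) p) * u p.2.rep) :=
    integrable_torus_of_continuous ((cf.mul c1).mul cu)
  have i2 : Integrable (fun p : Torus => (V p.1 * f p.1.rep) * (u p.2.rep * dY (dY φ) p)) :=
    integrable_torus_of_continuous ((cV.mul cf).mul (cu.mul c2))
  have i3 : Integrable (fun p : Torus => (f2 p.1.rep * φ p) * u p.2.rep) :=
    integrable_torus_of_continuous ((cf2.mul c0).mul cu)
  have i4 : Integrable (fun p : Torus => (V p.1 * f p.1.rep) * (u2 p.2.rep * φ p)) :=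
    integrable_torus_of_continuous ((cV.mul cf).mul (cu2.mul c0))
  calc ∫ p : Torus, f p.1.rep * u p.2.rep * grushin V φ p
      = ∫ p : Torus, ((f p.1.rep * dX (dX φ) p) * u p.2.rep
        + (V p.1 * f p.1.rep) * (u p.2.rep * dY (dY φ) p)) := by
        congr 1; ext p; unfold grushin; ring
    _ = (∫ p : Torus, (f p.1.rep * dX (dX φ) p) * u p.2.rep)
        + ∫ p : Torus, (V p.1 * f p.1.rep) * (u p.2.rep * dY (dY φ) p) := integral_add i1 i2
    _ = (∫ p : Torus, (f2 p.1.rep * φ p) * u p.2.rep)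
        + ∫ p : Torus, (V p.1 * f p.1.rep) * (u2 p.2.rep * φ p) := by
        congr 1
        · rw [Measure.volume_eq_prod] at i1 i3 ⊢
          rw [integral_prod_symm _ i1, integral_prod_symm _ i3]
          congr 1; ext y
          simp only
          rw [integral_mul_const, integral_mul_const]
          congr 1
          rw [Circ.integral_comp_rep (g := fun x => f x * dX (dX φ) ((x : Circ), y))
            (fun x h h' => by rw [Circ.rep_coe h h']),
            Circ.integral_comp_rep (g := fun x => f2 x * φ ((x : Circ), y))
            (fun x h h' => by rw [Circ.rep_coe h h'])]
          exact hf.integral_mul_deriv2 (fun x => hφ.hasDerivAt_dX x y)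
            (fun x => hφ.smooth_dX.hasDerivAt_dX x y)
            (c1.comp ((AddCircle.continuous_mk' _).prodMk continuous_const))
        · rw [Measure.volume_eq_prod] at i2 i4 ⊢
          rw [integral_prod _ i2, integral_prod _ i4]
          congr 1; ext x
          simp only
          rw [integral_const_mul, integral_const_mul]
          congr 1
          rw [Circ.integral_comp_rep (g := fun y => u y * dY (dY φ) (x, (y : Circ)))
            (fun x h h' => by rw [Circ.rep_coe h h']),
            Circ.integral_comp_rep (g := fun y => u2 y * φ (x, (y : Circ)))
            (fun x h h' => by rw [Circ.rep_coe h h'])]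
          exact hu.integral_mul_deriv2 (fun y => hφ.hasDerivAt_dY x y)
            (fun y => hφ.smooth_dY.hasDerivAt_dY x y)
            (c2.comp (continuous_const.prodMk (AddCircle.continuous_mk' _)))
    _ = ∫ p : Torus, ((f2 p.1.rep * φ p) * u p.2.rep
        + (V p.1 * f p.1.rep) * (u2 p.2.rep * φ p)) := (integral_add i3 i4).symm
    _ = _ := by congr 1; ext p; ring

theorem IsWeakGrushin.add {V : Circ → ℝ} (hV : Continuous V) {u v g k : Torus → ℂ}
    (hu : Continuous u) (hv : Continuous v) (hg : Continuous g) (hk : Continuous k)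
    (h1 : IsWeakGrushin V u g) (h2 : IsWeakGrushin V v k) :
    IsWeakGrushin V (fun p => u p + v p) (fun p => g p + k p) := by
  intro φ hφ
  have c := hφ.continuous_grushin hV
  have c0 := hφ.continuous
  simp_rw [add_mul]
  rw [integral_add (integrable_torus_of_continuous (by fun_prop))
    (integrable_torus_of_continuous (by fun_prop)), integral_add
    (integrable_torus_of_continuous (by fun_prop)) (integrable_torus_of_continuous (by fun_prop)),
    h1 φ hφ, h2 φ hφ]

theorem IsWeakGrushin.const_mul {V : Circ → ℝ} {u g : Torus → ℂ} (c : ℂ)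
    (h : IsWeakGrushin V u g) : IsWeakGrushin V (fun p => c * u p) (fun p => c * g p) := by
  intro φ hφ
  simp_rw [mul_assoc]
  rw [integral_const_mul, integral_const_mul, h φ hφ]

/-- Periodicity makes the integrals of second derivatives vanish. This serves the values of `h` that
are not small. -/
theorem isWeakGrushin_const {V : Circ → ℝ} (hV : Continuous V) (c : ℂ) :
    IsWeakGrushin V (fun _ => c) (fun _ => 0) := by
  intro φ hφ
  have c1 := hφ.smooth_dX.smooth_dX.continuous
  have c2 := hφ.smooth_dY.smooth_dY.continuous
  have cV : Continuous fun p : Torus => (V p.1 : ℂ) :=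
    Complex.continuous_ofReal.comp (hV.comp continuous_fst)
  have hper : ((Real.pi : ℝ) : Circ) = ((-Real.pi : ℝ) : Circ) := by
    rw [← AddCircle.coe_add_period (2 * Real.pi) (-Real.pi)]
    congr 1; ring
  have i1 : Integrable (fun p : Torus => dX (dX φ) p) := integrable_torus_of_continuous c1
  have i2 : Integrable (fun p : Torus => V p.1 * dY (dY φ) p) :=
    integrable_torus_of_continuous (cV.mul c2)
  have e1 : ∫ p : Torus, dX (dX φ) p = 0 := by
    rw [Measure.volume_eq_prod] at i1 ⊢
    rw [integral_prod_symm _ i1]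
    refine integral_eq_zero_of_ae (Eventually.of_forall fun y => ?_)
    simp only
    rw [Circ.integral_eq, intervalIntegral.integral_eq_sub_of_hasDerivAt
      (fun x _ => hφ.smooth_dX.hasDerivAt_dX x y)
      ((c1.comp ((AddCircle.continuous_mk' _).prodMk continuous_const)).intervalIntegrable _ _),
      hper, sub_self]
    rfl
  have e2 : ∫ p : Torus, V p.1 * dY (dY φ) p = 0 := by
    rw [Measure.volume_eq_prod] at i2 ⊢
    rw [integral_prod _ i2]
    refine integral_eq_zero_of_ae (Eventually.of_forall fun x => ?_)
    simp only
    rw [integral_const_mul, Circ.integral_eq, intervalIntegral.integral_eq_sub_of_hasDerivAt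
      (fun y _ => hφ.smooth_dY.hasDerivAt_dY x y)
      ((c2.comp (continuous_const.prodMk (AddCircle.continuous_mk' _))).intervalIntegrable _ _),
      hper, sub_self, mul_zero]
    rfl
  unfold grushin
  rw [integral_const_mul, integral_add i1 i2, e1, e2]
  simp

/-! ### The two-term ansatz and its residual. -/

/-- The phase `e^{-iNs}`. -/
noncomputable def wavePhase (N s : ℝ) : ℂ := Complex.exp (-(Complex.I * N * s))

theorem norm_wavePhase (N s : ℝ) : ‖wavePhase N s‖ = 1 := by
  unfold wavePhase
  rw [Complex.norm_exp]
  simp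

theorem hasDerivAt_wavePhase_mul {N : ℝ} {w : ℝ → ℂ} {w' : ℂ} {s : ℝ} (hw : HasDerivAt w w' s) :
    HasDerivAt (fun s => wavePhase N s * w s) (wavePhase N s * (w' - Complex.I * N * w s)) s := by
  have h1 : HasDerivAt (fun s : ℝ => -(Complex.I * N * (s : ℂ))) (-(Complex.I * N * 1)) s :=
    ((Complex.ofRealCLM.hasDerivAt (x := s)).const_mul (Complex.I * N)).neg
  have h2 : HasDerivAt (fun s : ℝ => wavePhase N s) (wavePhase N s * (-(Complex.I * N * 1))) s :=
    h1.cexp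
  exact (h2.mul hw).congr_deriv (by ring)

theorem isC2Bump_ofReal {A A1 A2 : ℝ → ℝ} (h : ∀ x, HasDerivAt A (A1 x) x)
    (h' : ∀ x, HasDerivAt A1 (A2 x) x) (hc : Continuous A2)
    (hz : ∀ x, 1 ≤ |x| → A x = 0 ∧ A1 x = 0 ∧ A2 x = 0) (c : ℂ) :
    IsC2Bump (fun x => c * A x) (fun x => c * A1 x) (fun x => c * A2 x) := by
  have hpi := Real.pi_gt_three
  obtain ⟨r0, r1, r2⟩ := hz Real.pi (by rw [abs_of_pos Real.pi_pos]; linarith)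
  obtain ⟨l0, l1, l2⟩ := hz (-Real.pi) (by rw [abs_neg, abs_of_pos Real.pi_pos]; linarith)
  exact ⟨fun x => (h x).ofReal_comp.const_mul c, fun x => (h' x).ofReal_comp.const_mul c,
    continuous_const.mul (Complex.continuous_ofReal.comp hc),
    by simp [l0, l1, l2], by simp [r0, r1, r2]⟩

/-- The frequency `N` need not be an integer, so the phase alone is not periodic. The amplitude
vanishes at both ends of the period because it is supported in `0 ≤ σ y ≤ y₀ + a`. The reflection
`σ` leaves second derivatives unchanged since `σ² = 1`. -/
theorem isC2Bump_wavePhase_mul {w w1 w2 : ℝ → ℝ} (N : ℝ) {σ y₀ a : ℝ} (hσ : σ = 1 ∨ σ = -1)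
    (ha : y₀ + a ≤ Real.pi) (h : ∀ s, HasDerivAt w (w1 s) s)
    (h' : ∀ s, HasDerivAt w1 (w2 s) s) (hc : Continuous w2)
    (hz : ∀ s, s ≤ -y₀ ∨ a ≤ s → w s = 0 ∧ w1 s = 0 ∧ w2 s = 0) :
    IsC2Bump (fun y => wavePhase N (σ * y - y₀) * w (σ * y - y₀))
      (fun y => σ * (wavePhase N (σ * y - y₀) * (w1 (σ * y - y₀) - Complex.I * N * w (σ * y - y₀))))
      (fun y => wavePhase N (σ * y - y₀) * (w2 (σ * y - y₀) - 2 * Complex.I * N * w1 (σ * y - y₀)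
        - N ^ 2 * w (σ * y - y₀))) := by
  have hd : ∀ {u : ℝ → ℂ} {u' : ℂ} {y : ℝ}, HasDerivAt u u' (σ * y - y₀) →
      HasDerivAt (fun y => u (σ * y - y₀)) (σ * u') y := by
    intro u u' y hu
    have h2 : HasDerivAt (fun y : ℝ => σ * y - y₀) σ y := by
      simpa using ((hasDerivAt_id y).const_mul σ).sub_const y₀
    have := hu.scomp y h2
    rwa [Complex.real_smul] at this
  have hc0 : Continuous w := continuous_iff_continuousAt.2 fun x => (h x).continuousAt
  have hc1 : Continuous w1 := continuous_iff_continuousAt.2 fun x => (h' x).continuousAt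
  have hcp : Continuous (wavePhase N) := by unfold wavePhase; fun_prop
  have hσ2 : (σ : ℂ) * σ = 1 := by rcases hσ with rfl | rfl <;> simp
  have hpi := Real.pi_pos
  have hend : ∀ y : ℝ, y = Real.pi ∨ y = -Real.pi → w (σ * y - y₀) = 0 ∧ w1 (σ * y - y₀) = 0 ∧
      w2 (σ * y - y₀) = 0 := by
    intro y hy'
    apply hz
    rcases hσ with rfl | rfl <;> rcases hy' with rfl | rfl
    · right; linarith
    · left; linarith
    · left; linarith
    · right; linarith
  refine ⟨fun y => hd (hasDerivAt_wavePhase_mul (h _).ofReal_comp), fun y => ?_, by fun_prop,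
    ?_, ?_⟩
  · have h3 := (hd (y := y) (hasDerivAt_wavePhase_mul (N := N)
      ((h' _).ofReal_comp.sub ((h _).ofReal_comp.const_mul (Complex.I * N))))).const_mul (σ : ℂ)
    refine h3.congr_deriv ?_
    rw [← mul_assoc, hσ2]
    simp only [Pi.sub_apply]
    linear_combination (-(N : ℂ) ^ 2 * w (σ * y - y₀) * wavePhase N (σ * y - y₀)) *
      (-Complex.I_sq)
  · obtain ⟨z0, z1, z2⟩ := hend (-Real.pi) (Or.inr rfl)
    simp only [z0, z1, z2]; simp
  · obtain ⟨z0, z1, z2⟩ := hend Real.pi (Or.inl rfl)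
    simp only [z0, z1, z2]; simp

theorem IsC2Bump.fourierCoeff_deriv {f f1 f2 : ℝ → ℂ} (h : IsC2Bump f f1 f2) (n : ℤ) :
    fourierCoeff (fun p : Circ => f1 p.rep) n =
      Complex.I * n * fourierCoeff (fun p : Circ => f p.rep) n := by
  have e : ∀ g : ℝ → ℂ, fourierCoeff (fun p : Circ => g p.rep) n =
      (2 * Real.pi)⁻¹ * ∫ x in -Real.pi..Real.pi, fourier (-n) (x : Circ) * g x := by
    intro g
    unfold fourierCoeff
    rw [AddCircle.integral_haarAddCircle, Complex.real_smul, Circ.integral_comp_rep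
      (g := fun x => fourier (-n) (x : Circ) * g x)
      (fun x h h' => by simp only [Circ.rep_coe h h', smul_eq_mul])]
  have hd : ∀ x : ℝ, HasDerivAt (fun x : ℝ => (fourier (-n) (x : Circ) : ℂ))
      (-(Complex.I * n) * fourier (-n) (x : Circ)) x := fun x => by
    refine (hasDerivAt_fourier_neg (2 * Real.pi) n x).congr_deriv ?_
    have : (Real.pi : ℂ) ≠ 0 := by exact_mod_cast Real.pi_ne_zero
    push_cast
    field_simp
  have hc : Continuous fun x : ℝ => (fourier (-n) (x : Circ) : ℂ) :=
    continuous_iff_continuousAt.2 fun x => (hd x).continuousAt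
  rw [e, e, intervalIntegral.integral_mul_deriv_eq_deriv_mul (fun x _ => hd x)
    (fun x _ => h.hasDerivAt x) ((continuous_const.mul hc).intervalIntegrable _ _)
    (h.continuous_deriv.intervalIntegrable _ _), h.left.1, h.right.1]
  simp only [mul_assoc]
  rw [intervalIntegral.integral_const_mul]
  ring

/-- The residual at a point, for the ansatz `ψ = A u₀ - i D u₁`. -/
theorem residual_identity (h τ N A A2 D D2 v f W W1 W2 W3 : ℝ) (P : ℂ) (hh : h ≠ 0) :
    (-(h : ℂ) ^ 2 * (((1 : ℂ) * A2 * (P * W) + v * ((1 : ℂ) * A) *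
          (P * (W2 - 2 * Complex.I * N * W1 - N ^ 2 * W)))
        + (-Complex.I * D2 * (P * W1) + v * (-Complex.I * D) *
          (P * (W3 - 2 * Complex.I * N * W2 - N ^ 2 * W1))))
      + Complex.I * h * f * ((1 : ℂ) * A * (P * W) + -Complex.I * D * (P * W1)))
      - ((1 : ℂ) * A * (P * W) + -Complex.I * D * (P * W1))
      - Complex.I * h * ((h * τ : ℝ) : ℂ) * ((1 : ℂ) * A * (P * W) + -Complex.I * D * (P * W1)) =
    P * (((-(h ^ 2 * ((A2 - N ^ 2 * v * A + A / h ^ 2) * W)) - h ^ 2 * ((v * A - 2 * (N * v * D)) * W2)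
        + h * ((f - h * τ) * (D * W1)) : ℝ) : ℂ)
      + Complex.I * ((h ^ 2 * ((D2 + 2 * N * v * A - N ^ 2 * v * D + D / h ^ 2 - A) * W1)
        + h * (A * (h * W1 + (f - h * τ) * W)) + h ^ 2 * (v * D * W3) : ℝ) : ℂ)) := by
  have hC : (h : ℂ) ≠ 0 := by exact_mod_cast hh
  have hI : Complex.I ^ 2 = -1 := Complex.I_sq
  push_cast
  field_simp
  ring_nf
  simp only [hI]
  ring

theorem IsWidelyUndampedProfile.eq_posPart {ν y₀ ρ : ℝ} {b : Circ → ℝ}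
    (hb : IsWidelyUndampedProfile ν y₀ ρ b) (hν : 0 < ν) {σ y : ℝ} (hσ : σ = 1 ∨ σ = -1)
    (h1 : -y₀ < σ * y - y₀) (h2 : σ * y - y₀ < ρ) :
    b (y : Circ) = max (σ * y - y₀) 0 ^ ν := by
  have habs : |y| = σ * y := by
    rcases hσ with rfl | rfl
    · rw [one_mul, abs_of_pos (by linarith)]
    · rw [abs_of_neg (by linarith)]; ring
  rcases le_total (σ * y) y₀ with h | h
  · rw [hb.1 y (by rw [habs]; exact h), max_eq_right (by linarith), Real.zero_rpow hν.ne']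
  · rw [hb.2.1 y (by rw [habs]; exact h) (by rw [habs]; linarith), habs,
      max_eq_left (by linarith)]

/-- The transversal Gaussian weight `exp (-x² / 16 h²)`, for `h = k ^ 2`. -/
noncomputable def Circ.gaussian (k : ℝ) (x : Circ) : ℝ :=
  Real.exp (-(x.rep ^ 2 / (16 * (k ^ 2) ^ 2)))

/-- A sum of two products that is a quasimode up to normalization, for `h = k ^ 2` and
`β = h τ`. -/
structure Ansatz (V b : Circ → ℝ) (ν y₀ K k τ σ : ℝ) where
  (f0 f1 u0 u1 du0 : Circ → ℂ)
  (ψ g : Torus → ℂ)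
  eq_ψ : ∀ p, ψ p = f0 p.1 * u0 p.2 + f1 p.1 * u1 p.2
  continuous_f0 : Continuous f0
  continuous_f1 : Continuous f1
  continuous_u0 : Continuous u0
  continuous_u1 : Continuous u1
  continuous_du0 : Continuous du0
  continuous_g : Continuous g
  weak : IsWeakGrushin V ψ g
  residual_le : ∀ p, ‖quasimodeResidual (k ^ 2) (k ^ 2 * τ) b ψ g p‖ ≤
    K * k ^ 4 * Real.exp (-(y₀ / 2 * τ)) * p.1.gaussian k
  f0_le : ∀ x, ‖f0 x‖ ≤ K * x.gaussian k
  f1_le : ∀ x, ‖f1 x‖ ≤ K * k ^ 4 * x.gaussian k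
  u0_le : ∀ y, ‖u0 y‖ ≤ Real.exp τ
  u1_le : ∀ y, k * ‖u1 y‖ ≤ K * Real.exp τ
  fourierCoeff_du0 : ∀ n, fourierCoeff du0 n = Complex.I * n * fourierCoeff u0 n
  frequency : ∀ y, ‖(k : ℂ) ^ 4 * du0 y + Complex.I * σ * u0 y‖ ≤ K * k ^ 3 * Real.exp τ
  le_norm : ∀ p : Torus, |p.1.rep| ≤ k ^ 2 → -(y₀ / 2) ≤ σ * p.2.rep - y₀ →
    σ * p.2.rep - y₀ ≤ 0 → 1 / K * Real.exp (τ * (σ * p.2.rep - y₀)) ≤ ‖ψ p‖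
  norm_le : ∀ δ, 0 < δ → δ ≤ 2 → k ^ 4 ≤ δ / 2 → ∀ p : Torus, δ ≤ |σ * p.2.rep - y₀| →
    ‖ψ p‖ ≤ K * (1 + (ν + 1) / (δ / 2) ^ (ν + 1)) * Real.exp (-(δ * τ)) * p.1.gaussian k

set_option maxHeartbeats 1000000 in
-- After `residual_identity`, six terms remain, each of which must be `O(k⁴ e^{-y₀τ/2})` times the
-- Gaussian. Five follow from sizes alone, with a spare factor `k` traded for the exponential; the
-- sixth is the transport equation.
theorem exists_ansatz {V b : Circ → ℝ} {ν y₀ ρ : ℝ} (hV : IsGrushinPotential V)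
    (hb : IsWidelyUndampedProfile ν y₀ ρ b) (hν : 1 < ν) (hy : 0 < y₀) (hρ : 0 < ρ) (hρ1 : ρ < 1)
    (hyρ : y₀ + ρ < Real.pi) :
    ∃ K k₀ : ℝ, 1 ≤ K ∧ 0 < k₀ ∧ k₀ ≤ 1 ∧ ∀ k τ σ : ℝ, 0 < k → k ≤ k₀ → 0 ≤ τ →
      k * Real.exp (5 * τ) ≤ 1 → (σ = 1 ∨ σ = -1) → Nonempty (Ansatz V b ν y₀ K k τ σ) := by
  have hpi := Real.pi_le_four
  obtain ⟨p⟩ := exists_groundStateProfile (v := fun x : ℝ => V (x : Circ)) hV.smooth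
    (by exact_mod_cast hV.zero) hV.deriv_zero hV.second_deriv_zero
  obtain ⟨K1, h₀, hK1, hh₀, hh₀1, hpair⟩ := p.exists_pair
  obtain ⟨K2, hK2, henv⟩ := exists_envelope hν hy (by linarith) hρ hρ1
  set K := (9 + |p.c|) * (K1 * K2) with hK
  have hK12 : 1 ≤ K1 * K2 := by nlinarith
  have hK0 : 0 ≤ |p.c| := abs_nonneg _
  have hK9 : 9 * (K1 * K2) ≤ K := by rw [hK]; nlinarith
  have hKc : |p.c| + K2 ≤ K := by
    have : K2 ≤ K1 * K2 := by nlinarith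
    rw [hK]; nlinarith
  have hKK1 : K1 ≤ K := by nlinarith
  have hKK2 : K2 ≤ K := by linarith
  -- As `k ≤ 1`, one bound on `k` yields both `k² ≤ h₀` and `k⁴ ≤ ρ / 4`.
  refine ⟨K, min h₀ (ρ / 4), by linarith, by positivity, (min_le_left _ _).trans hh₀1,
    fun k τ σ hk hk0 hτ hkτ hσ => ?_⟩
  have hk1 : k ≤ 1 := hk0.trans ((min_le_left _ _).trans hh₀1)
  have hkle : ∀ n : ℕ, n ≠ 0 → k ^ n ≤ k := fun n hn => pow_le_of_le_one hk.le hk1 hn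
  obtain ⟨q⟩ := hpair (k ^ 2) (by positivity) ((hkle 2 (by norm_num)).trans
    (hk0.trans (min_le_left _ _)))
  obtain ⟨e⟩ := henv k τ hk hk1 ((hkle 4 (by norm_num)).trans (hk0.trans (min_le_right _ _)))
    hτ hkτ
  set N : ℝ := 1 / (k ^ 2) ^ 2 + p.c with hN
  have hkN : k ^ 4 * N = 1 + p.c * k ^ 4 := by rw [hN]; field_simp
  have hexpmul : ∀ c : ℝ, c ≤ 5 → k * Real.exp (c * τ) ≤ 1 := fun c hc =>
    (mul_le_mul_of_nonneg_left (Real.exp_le_exp.2 (by nlinarith)) hk.le).trans hkτ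
  have hkeτ : k * Real.exp τ ≤ 1 := by simpa using hexpmul 1 (by norm_num)
  have heτ := Real.exp_pos τ
  have bA := isC2Bump_ofReal q.hasDerivAt_A q.hasDerivAt_A1 q.continuous_A2
    (fun x hx => ⟨(q.supp x hx).1, (q.supp x hx).2.1, (q.supp x hx).2.2.1⟩) 1
  have bD := isC2Bump_ofReal q.hasDerivAt_D q.hasDerivAt_D1 q.continuous_D2
    (fun x hx => (q.supp x hx).2.2.2) (-Complex.I)
  have hs' : ∀ s, s ≤ -y₀ ∨ ρ ≤ s → e.W s = 0 ∧ e.W1 s = 0 ∧ e.W2 s = 0 ∧ e.W3 s = 0 :=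
    fun s hs => e.supp s (hs.imp (fun h => by linarith) fun h => by linarith)
  have cW2 : Continuous e.W2 := continuous_iff_continuousAt.2 fun x => (e.hasDerivAt_W2 x).continuousAt
  have bU0 := isC2Bump_wavePhase_mul N hσ hyρ.le e.hasDerivAt_W e.hasDerivAt_W1
    cW2 (fun s hs => ⟨(hs' s hs).1, (hs' s hs).2.1, (hs' s hs).2.2.1⟩)
  have bU1 := isC2Bump_wavePhase_mul N hσ hyρ.le e.hasDerivAt_W1 e.hasDerivAt_W2
    e.continuous_W3 (fun s hs => (hs' s hs).2)
  have hVc := hV.continuous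
  have cV : Continuous fun p : Torus => (V p.1 : ℂ) :=
    Complex.continuous_ofReal.comp (hVc.comp continuous_fst)
  have cg0 := ((bA.continuous_deriv2_rep.comp continuous_fst).mul
    (bU0.continuous_rep.comp continuous_snd)).add ((cV.mul (bA.continuous_rep.comp
    continuous_fst)).mul (bU0.continuous_deriv2_rep.comp continuous_snd))
  have cg1 := ((bD.continuous_deriv2_rep.comp continuous_fst).mul
    (bU1.continuous_rep.comp continuous_snd)).add ((cV.mul (bD.continuous_rep.comp
    continuous_fst)).mul (bU1.continuous_deriv2_rep.comp continuous_snd))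
  have weak := (bA.isWeakGrushin hVc bU0).add hVc
    ((bA.continuous_rep.comp continuous_fst).mul (bU0.continuous_rep.comp continuous_snd))
    ((bD.continuous_rep.comp continuous_fst).mul (bU1.continuous_rep.comp continuous_snd))
    cg0 cg1 (bD.isWeakGrushin hVc bU1)
  have hG0 : ∀ x : Circ, 0 < x.gaussian k := fun x => Real.exp_pos _
  have hnI : ‖-Complex.I‖ = 1 := by simp
  have hnψ : ∀ x s : ℝ, ‖(1 : ℂ) * q.A x * (wavePhase N s * e.W s) +
      -Complex.I * q.D x * (wavePhase N s * e.W1 s)‖ =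
      ‖((q.A x * e.W s : ℝ) : ℂ) - ((q.D x * e.W1 s : ℝ) : ℂ) * Complex.I‖ := by
    intro x s
    have : (1 : ℂ) * q.A x * (wavePhase N s * e.W s) +
        -Complex.I * q.D x * (wavePhase N s * e.W1 s) = wavePhase N s *
        (((q.A x * e.W s : ℝ) : ℂ) - ((q.D x * e.W1 s : ℝ) : ℂ) * Complex.I) := by
      push_cast; ring
    rw [this, norm_mul, norm_wavePhase, one_mul]
  refine ⟨{
    f0 := _, f1 := _, u0 := _, u1 := _, du0 := _, ψ := _, g := _
    eq_ψ := fun p => rfl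
    continuous_f0 := bA.continuous_rep
    continuous_f1 := bD.continuous_rep
    continuous_u0 := bU0.continuous_rep
    continuous_u1 := bU1.continuous_rep
    continuous_du0 := bU0.continuous_deriv_rep
    continuous_g := cg0.add cg1
    weak := weak
    residual_le := ?_, f0_le := ?_, f1_le := ?_, u0_le := ?_, u1_le := ?_
    fourierCoeff_du0 := bU0.fourierCoeff_deriv
    frequency := ?_, le_norm := ?_, norm_le := ?_ }⟩
  · intro P
    set s := σ * P.2.rep - y₀ with hs
    set x := P.1.rep with hx
    have hvx : V (x : Circ) = V P.1 := by rw [hx, Circ.coe_rep]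
    refine (congrArg norm (residual_identity (k ^ 2) τ N (q.A x) (q.A2 x) (q.D x) (q.D2 x) (V P.1)
      (b P.2) (e.W s) (e.W1 s) (e.W2 s) (e.W3 s) (wavePhase N s) (by positivity))).trans_le ?_
    rw [norm_mul, norm_wavePhase, one_mul]
    -- Where the amplitude vanishes, the value of `b` does not matter; on the remaining set it is
    -- `s₊ ^ ν`.
    by_cases hsup : s ≤ -(3 * y₀ / 4) ∨ 3 * ρ / 4 ≤ s
    · obtain ⟨z0, z1, z2, z3⟩ := e.supp s hsup
      rw [z0, z1, z2, z3]
      have := hG0 P.1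
      simp only [mul_zero, add_zero, neg_zero, sub_zero, Complex.ofReal_zero, norm_zero]
      positivity
    push Not at hsup
    obtain ⟨hs1, hs2⟩ := hsup
    have hbv : b P.2 = max s 0 ^ ν := by
      rw [← Circ.coe_rep P.2]
      exact hb.eq_posPart (by linarith) hσ (by linarith) (by linarith)
    rw [hbv]
    set f := max s 0 ^ ν with hf
    set G := P.1.gaussian k with hG
    have hGp : 0 < G := hG0 P.1
    have hEA : |q.A2 x - N ^ 2 * V P.1 * q.A x + q.A x / (k ^ 2) ^ 2| ≤ K1 * k ^ 2 * G := by
      have := q.eq_A x; simp only [hvx] at this; exact this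
    have hED : |q.D2 x + 2 * N * V P.1 * q.A x - N ^ 2 * V P.1 * q.D x + q.D x / (k ^ 2) ^ 2
        - q.A x| ≤ K1 * k ^ 2 * G := by
      have := q.eq_D x; simp only [hvx] at this; exact this
    have hvA : |V P.1 * q.A x| ≤ K1 * (k ^ 2) ^ 2 * G := by
      have := q.vA_le x; simp only [hvx] at this; exact this
    have hNvD : |N * V P.1 * q.D x| ≤ K1 * (k ^ 2) ^ 2 * G := by
      have := q.NvD_le x; simp only [hvx] at this; exact this
    have hvD : |V P.1 * q.D x| ≤ K1 * (k ^ 2) ^ 4 * G := by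
      have := q.vD_le x; simp only [hvx] at this; exact this
    have hA : |q.A x| ≤ K1 * G := q.A_le x
    have hD : |q.D x| ≤ K1 * (k ^ 2) ^ 2 * G := q.D_le x
    have hf0 : 0 ≤ f := Real.rpow_nonneg (le_max_right _ _) _
    have hf1 : f ≤ 1 := Real.rpow_le_one (le_max_right _ _) (max_le (by linarith) zero_le_one)
      (by linarith)
    have hτ1 : k ^ 2 * τ ≤ 1 := by
      have h1 : τ ≤ Real.exp τ := by linarith [Real.add_one_le_exp τ]
      have h2 := hkle 2 (by norm_num)
      calc k ^ 2 * τ ≤ k * Real.exp τ := by gcongr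
        _ ≤ 1 := hkeτ
    have hτ0 : 0 ≤ k ^ 2 * τ := by positivity
    have hfβ : |f - k ^ 2 * τ| ≤ 1 := by rw [abs_le]; constructor <;> linarith
    set Z := Real.exp (-(y₀ / 2 * τ)) with hZ
    have hZp : 0 < Z := Real.exp_pos _
    -- The exchange of a spare `k` against the exponential gain; it uses `1 + y₀ / 2 ≤ 5`.
    have hkZ : k * Real.exp τ ≤ Z := by
      have h2 : k * Real.exp ((1 + y₀ / 2) * τ) ≤ 1 := hexpmul _ (by linarith)
      calc k * Real.exp τ = (k * Real.exp ((1 + y₀ / 2) * τ)) * Z := by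
            rw [mul_assoc, hZ, ← Real.exp_add]; congr 2; ring
        _ ≤ 1 * Z := by gcongr
        _ = Z := one_mul Z
    have hW := e.W_le s
    have hW1 := e.W1_le s
    have hW2 := e.W2_le s
    have hW3 := e.W3_le s
    have hT := e.transport s
    have hKK : 0 < K1 * K2 * k ^ 4 * Z * G := by positivity
    have hZ' : K2 * (k * Real.exp τ) ≤ K2 * Z := by gcongr
    have ab : ∀ {u v : ℝ}, |u * v| = |u| * |v| := fun {u v} => abs_mul u v
    have hk2 : |k ^ 2| = k ^ 2 := abs_of_pos (by positivity)
    have t1 : |(k ^ 2) ^ 2 * ((q.A2 x - N ^ 2 * V P.1 * q.A x + q.A x / (k ^ 2) ^ 2) * e.W s)| ≤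
        K1 * K2 * k ^ 4 * Z * G := by
      rw [ab, ab, abs_pow, hk2]
      calc (k ^ 2) ^ 2 * (_ * |e.W s|) ≤ (k ^ 2) ^ 2 * ((K1 * k ^ 2 * G) * Real.exp τ) := by gcongr
        _ = K1 * k ^ 4 * G * k * (k * Real.exp τ) := by ring
        _ ≤ K1 * k ^ 4 * G * 1 * Z := by gcongr
        _ = 1 * (K1 * k ^ 4 * G * Z) := by ring
        _ ≤ K2 * (K1 * k ^ 4 * G * Z) := by gcongr
        _ = _ := by ring
    have t2 : |(k ^ 2) ^ 2 * ((V P.1 * q.A x - 2 * (N * V P.1 * q.D x)) * e.W2 s)| ≤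
        3 * (K1 * K2 * k ^ 4 * Z * G) := by
      have h1 : |V P.1 * q.A x - 2 * (N * V P.1 * q.D x)| ≤ 3 * (K1 * (k ^ 2) ^ 2 * G) := by
        refine (abs_sub _ _).trans ?_
        rw [abs_mul 2, abs_two]; linarith
      rw [ab, ab, abs_pow, hk2]
      calc (k ^ 2) ^ 2 * (_ * |e.W2 s|) ≤ (k ^ 2) ^ 2 * ((3 * (K1 * (k ^ 2) ^ 2 * G)) * |e.W2 s|) := by
            gcongr
        _ = 3 * K1 * k ^ 4 * G * k * (k ^ 3 * |e.W2 s|) := by ring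
        _ ≤ 3 * K1 * k ^ 4 * G * k * (K2 * Real.exp τ) := by gcongr
        _ = 3 * K1 * K2 * k ^ 4 * G * (k * Real.exp τ) := by ring
        _ ≤ 3 * K1 * K2 * k ^ 4 * G * Z := by gcongr
        _ = _ := by ring
    have hDW1 : |q.D x * e.W1 s| ≤ K1 * K2 * k ^ 2 * Z * G := by
      rw [ab]
      calc |q.D x| * |e.W1 s| ≤ (K1 * (k ^ 2) ^ 2 * G) * |e.W1 s| := by gcongr
        _ = K1 * k ^ 2 * G * k * (k * |e.W1 s|) := by ring
        _ ≤ K1 * k ^ 2 * G * k * (K2 * Real.exp τ) := by gcongr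
        _ = K1 * K2 * k ^ 2 * G * (k * Real.exp τ) := by ring
        _ ≤ K1 * K2 * k ^ 2 * G * Z := by gcongr
        _ = _ := by ring
    have t3 : |k ^ 2 * ((f - k ^ 2 * τ) * (q.D x * e.W1 s))| ≤ K1 * K2 * k ^ 4 * Z * G := by
      rw [ab, ab, hk2]
      calc k ^ 2 * (|f - k ^ 2 * τ| * |q.D x * e.W1 s|) ≤ k ^ 2 * (1 * (K1 * K2 * k ^ 2 * Z * G)) := by
            gcongr
        _ = _ := by ring
    have t4 : |(k ^ 2) ^ 2 * ((q.D2 x + 2 * N * V P.1 * q.A x - N ^ 2 * V P.1 * q.D x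
        + q.D x / (k ^ 2) ^ 2 - q.A x) * e.W1 s)| ≤ K1 * K2 * k ^ 4 * Z * G := by
      rw [ab, ab, abs_pow, hk2]
      calc (k ^ 2) ^ 2 * (_ * |e.W1 s|) ≤ (k ^ 2) ^ 2 * ((K1 * k ^ 2 * G) * |e.W1 s|) := by gcongr
        _ = K1 * k ^ 4 * G * k * (k * |e.W1 s|) := by ring
        _ ≤ K1 * k ^ 4 * G * k * (K2 * Real.exp τ) := by gcongr
        _ = K1 * K2 * k ^ 4 * G * (k * Real.exp τ) := by ring
        _ ≤ K1 * K2 * k ^ 4 * G * Z := by gcongr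
        _ = _ := by ring
    -- No power of `k` is spare in this term, so the exponential factor has to come from the
    -- transport estimate.
    have t5 : |k ^ 2 * (q.A x * (k ^ 2 * e.W1 s + (f - k ^ 2 * τ) * e.W s))| ≤
        K1 * K2 * k ^ 4 * Z * G := by
      rw [ab, ab, hk2]
      calc k ^ 2 * (|q.A x| * _) ≤ k ^ 2 * ((K1 * G) * (K2 * k ^ 2 * Z)) := by gcongr
        _ = _ := by ring
    have t6 : |(k ^ 2) ^ 2 * (V P.1 * q.D x * e.W3 s)| ≤ K1 * K2 * k ^ 4 * Z * G := by
      rw [ab, ab, abs_pow, hk2]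
      calc (k ^ 2) ^ 2 * (|V P.1 * q.D x| * |e.W3 s|)
          ≤ (k ^ 2) ^ 2 * ((K1 * (k ^ 2) ^ 4 * G) * |e.W3 s|) := by gcongr
        _ = K1 * k ^ 4 * G * k ^ 2 * (k ^ 6 * |e.W3 s|) := by ring
        _ ≤ K1 * k ^ 4 * G * k * (K2 * Real.exp τ) := by
            have := hkle 2 (by norm_num)
            gcongr
        _ = K1 * K2 * k ^ 4 * G * (k * Real.exp τ) := by ring
        _ ≤ K1 * K2 * k ^ 4 * G * Z := by gcongr
        _ = _ := by ring
    refine (norm_add_le _ _).trans ?_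
    rw [norm_mul, Complex.norm_I, one_mul, Complex.norm_real, Complex.norm_real, Real.norm_eq_abs,
      Real.norm_eq_abs]
    refine (add_le_add ((abs_add_le _ _).trans (add_le_add ((abs_sub _ _).trans (add_le_add
      ((abs_neg _).trans_le t1) t2)) t3)) ((abs_add_three _ _ _).trans
      (add_le_add (add_le_add t4 t5) t6))).trans ?_
    have := mul_le_mul_of_nonneg_right hK9 (by positivity : 0 ≤ k ^ 4 * Z * G)
    linarith
  · intro x
    rw [one_mul, Complex.norm_real]
    exact (q.A_le _).trans (mul_le_mul_of_nonneg_right hKK1 (hG0 x).le)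
  · intro x
    rw [norm_mul, hnI, one_mul, Complex.norm_real]
    refine (q.D_le _).trans ?_
    have := hG0 x
    show K1 * (k ^ 2) ^ 2 * x.gaussian k ≤ _
    rw [← pow_mul]
    gcongr
  · intro y
    rw [norm_mul, norm_wavePhase, one_mul, Complex.norm_real]
    exact e.W_le _
  · intro y
    rw [norm_mul, norm_wavePhase, one_mul, Complex.norm_real]
    exact (e.W1_le _).trans (mul_le_mul_of_nonneg_right hKK2 heτ.le)
  · intro y
    set s := σ * y.rep - y₀
    -- Because `k⁴ N = 1 + c k⁴`, the leading part of the derivative cancels `iσ u₀`, leaving `k⁴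
    -- W'` and `c k⁴ W`.
    have e1 : (k : ℂ) ^ 4 * (σ * (wavePhase N s * (e.W1 s - Complex.I * N * e.W s))) +
        Complex.I * σ * (wavePhase N s * e.W s) = wavePhase N s * (σ *
          (((k ^ 3 * (k * e.W1 s) : ℝ) : ℂ) - Complex.I * ((p.c * k ^ 4 * e.W s : ℝ) : ℂ))) := by
      have : ((k : ℂ) ^ 4 * N) = 1 + p.c * k ^ 4 := by exact_mod_cast congrArg Complex.ofReal hkN
      push_cast
      linear_combination (-Complex.I * σ * wavePhase N s * e.W s) * this
    rw [e1, norm_mul, norm_wavePhase, one_mul, norm_mul]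
    have hσn : ‖(σ : ℂ)‖ = 1 := by rcases hσ with rfl | rfl <;> simp
    rw [hσn, one_mul]
    refine (norm_sub_le _ _).trans ?_
    rw [norm_mul, Complex.norm_I, one_mul, Complex.norm_real, Complex.norm_real, Real.norm_eq_abs,
      Real.norm_eq_abs, abs_mul, abs_mul, abs_mul, abs_mul, abs_of_pos (by positivity : 0 < k ^ 3),
      abs_of_pos (by positivity : 0 < k ^ 4), abs_of_pos hk]
    calc k ^ 3 * (k * |e.W1 s|) + |p.c| * k ^ 4 * |e.W s|
        ≤ k ^ 3 * (K2 * Real.exp τ) + |p.c| * k ^ 3 * Real.exp τ := by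
          have h1 := e.W1_le s
          have h2 := e.W_le s
          have h3 : k ^ 4 ≤ k ^ 3 := pow_le_pow_of_le_one hk.le hk1 (by norm_num)
          gcongr
      _ = (|p.c| + K2) * (k ^ 3 * Real.exp τ) := by ring
      _ ≤ K * (k ^ 3 * Real.exp τ) := by gcongr
      _ = _ := by ring
  · intro P h1 h2 h3
    show _ ≤ ‖_‖
    rw [hnψ]
    -- Up to the common phase the main term is real and the corrector purely imaginary, so they
    -- cannot cancel.
    refine le_trans ?_ (Complex.abs_re_le_norm _)
    simp only [Complex.sub_re, Complex.ofReal_re, Complex.re_ofReal_mul, Complex.I_re, mul_zero,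
      sub_zero]
    refine le_trans ?_ (le_abs_self _)
    rw [e.eq_exp _ h2 h3]
    gcongr
    refine le_trans ?_ (q.le_A _ h1)
    exact one_div_le_one_div_of_le (by linarith) hKK1
  · intro δ hδ hδ2 hkδ P hs
    show ‖_‖ ≤ _
    rw [hnψ]
    set s := σ * P.2.rep - y₀
    set x := P.1.rep with hx
    -- To the right of `δ` the decay is `e^{-2τ}`, hence the restriction `δ ≤ 2`; to the left it is
    -- that of `e^{τs}`.
    have hen : e.env s ≤ (1 + (ν + 1) / (δ / 2) ^ (ν + 1)) * Real.exp (-(δ * τ)) := by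
      have ha : 0 < (ν + 1) / (δ / 2) ^ (ν + 1) := by positivity
      have he := Real.exp_pos (-(δ * τ))
      rcases le_abs.1 hs with h | h
      · calc _ ≤ _ := e.env_le_of_pos δ hδ hkδ s h
          _ ≤ (ν + 1) / (δ / 2) ^ (ν + 1) * Real.exp (-(δ * τ)) := by
            gcongr
          _ ≤ _ := by nlinarith
      · calc _ ≤ _ := e.env_le_of_nonpos s (by linarith)
          _ ≤ Real.exp (-(δ * τ)) := Real.exp_le_exp.2 (by nlinarith)
          _ ≤ _ := by nlinarith
    have hG := hG0 P.1
    have hA : |q.A x| ≤ K1 * P.1.gaussian k := q.A_le _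
    have hD : |q.D x| ≤ K1 * (k ^ 2) ^ 2 * P.1.gaussian k := q.D_le _
    refine (norm_sub_le _ _).trans ?_
    rw [norm_mul, Complex.norm_I, mul_one, Complex.norm_real, Complex.norm_real, Real.norm_eq_abs,
      Real.norm_eq_abs, abs_mul, abs_mul]
    calc |q.A x| * |e.W s| + |q.D x| * |e.W1 s|
        ≤ (K1 * P.1.gaussian k) * e.env s + (K1 * (k ^ 2) ^ 2 * P.1.gaussian k) * |e.W1 s| := by
          have := e.W_le_env s
          gcongr
      _ = (K1 * P.1.gaussian k) * e.env s + (K1 * k ^ 2 * P.1.gaussian k) * (k ^ 2 * |e.W1 s|) := by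
          ring
      _ ≤ (K1 * P.1.gaussian k) * e.env s + (K1 * 1 * P.1.gaussian k) * (K2 * e.env s) := by
          have := e.W1_le_env s
          have h2 : k ^ 2 ≤ 1 := pow_le_one₀ hk.le hk1
          gcongr
      _ = (K1 * (1 + K2)) * (e.env s * P.1.gaussian k) := by ring
      _ ≤ K * (((1 + (ν + 1) / (δ / 2) ^ (ν + 1)) * Real.exp (-(δ * τ))) * P.1.gaussian k) := by
          have h4 : K1 * (1 + K2) ≤ K := by nlinarith
          have h5 := e.env_nonneg s
          gcongr
      _ = _ := by ring

/-! ### Norms and integrals on the circle and the torus. -/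

theorem eLpNorm_two_eq_sqrt_of_continuous {X : Type*} [TopologicalSpace X] [CompactSpace X]
    [MeasurableSpace X] [OpensMeasurableSpace X] [SecondCountableTopology X] {μ : Measure X}
    [IsFiniteMeasure μ] {f : X → ℂ} (hf : Continuous f) :
    eLpNorm f 2 μ = ENNReal.ofReal (√(∫ x, ‖f x‖ ^ 2 ∂μ)) := by
  have hm : MemLp f 2 μ := by
    obtain ⟨M, hM⟩ := isCompact_univ.exists_bound_of_continuousOn hf.continuousOn
    exact MemLp.of_bound hf.aestronglyMeasurable M (Eventually.of_forall fun x => hM x trivial)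
  rw [hm.eLpNorm_eq_integral_rpow_norm (by norm_num) (by norm_num)]
  congr 1
  rw [Real.sqrt_eq_rpow]
  simp

theorem memLp_two_of_continuous {X : Type*} [TopologicalSpace X] [CompactSpace X]
    [MeasurableSpace X] [OpensMeasurableSpace X] [SecondCountableTopology X] {μ : Measure X}
    [IsFiniteMeasure μ] {f : X → ℂ} (hf : Continuous f) : MemLp f 2 μ := by
  obtain ⟨M, hM⟩ := isCompact_univ.exists_bound_of_continuousOn hf.continuousOn
  exact MemLp.of_bound hf.aestronglyMeasurable M (Eventually.of_forall fun x => hM x trivial)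

theorem integrable_circ_of_continuous {E : Type*} [NormedAddCommGroup E] {f : Circ → E}
    (hf : Continuous f) : Integrable f :=
  hf.integrable_of_hasCompactSupport (HasCompactSupport.of_compactSpace f)

theorem Circ.continuous_gaussian (k : ℝ) : Continuous (Circ.gaussian k) := by
  unfold Circ.gaussian
  exact Circ.continuous_comp_rep (f := fun x : ℝ => Real.exp (-(x ^ 2 / (16 * (k ^ 2) ^ 2))))
    (by fun_prop) (by simp)

theorem Circ.gaussian_pos (k : ℝ) (x : Circ) : 0 < x.gaussian k := Real.exp_pos _

theorem Circ.integral_one : ∫ _ : Circ, (1 : ℝ) = 2 * Real.pi := by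
  rw [integral_const, smul_eq_mul, mul_one, Measure.real, AddCircle.measure_univ,
    ENNReal.toReal_ofReal Real.two_pi_pos.le]

theorem Circ.integral_gaussian_sq_le {k : ℝ} (hk : 0 < k) :
    ∫ x : Circ, x.gaussian k ^ 2 ≤ 6 * k ^ 2 := by
  have hb : 0 < 1 / (8 * (k ^ 2) ^ 2) := by positivity
  rw [Circ.integral_comp_rep (g := fun x : ℝ => Real.exp (-(1 / (8 * (k ^ 2) ^ 2)) * x ^ 2))
    (fun x h h' => by
      rw [Circ.gaussian, Circ.rep_coe h h', ← Real.exp_nat_mul]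
      congr 1; push_cast; field_simp; ring)]
  rw [intervalIntegral.integral_of_le (by linarith [Real.pi_pos])]
  refine (setIntegral_le_integral (integrable_exp_neg_mul_sq hb)
    (Eventually.of_forall fun x => (Real.exp_pos _).le)).trans ?_
  rw [integral_gaussian, Real.sqrt_le_left (by positivity)]
  have := Real.pi_le_four
  rw [div_div_eq_mul_div, div_one]
  nlinarith [pow_pos hk 4]

/-- The preimage of a ball is a union of translated intervals. Since `[c - ε, c + ε]` lies strictly
inside `(-π, π)`, only the untranslated one can contain the representative. -/
theorem Circ.abs_rep_sub_le {x : Circ} {c ε : ℝ} (h1 : -Real.pi < c - ε) (h2 : c + ε < Real.pi)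
    (hx : x ∈ Metric.closedBall (c : Circ) ε) : |x.rep - c| ≤ ε := by
  have hmem : x.rep ∈ (fun t : ℝ => (t : Circ)) ⁻¹' Metric.closedBall (c : Circ) ε := by
    simpa [Circ.coe_rep] using hx
  have h3 := AddCircle.coe_real_preimage_closedBall_eq_iUnion (p := 2 * Real.pi) c ε
  rw [h3, Set.mem_iUnion] at hmem
  obtain ⟨z, hz⟩ := hmem
  rw [Metric.mem_closedBall, Real.dist_eq, zsmul_eq_mul, abs_le] at hz
  obtain ⟨l, r⟩ := x.rep_mem
  have hpi := Real.pi_pos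
  have hz0 : z = 0 := by
    have a1 : (z : ℝ) < 1 := by
      by_contra! hcon
      nlinarith
    have a2 : (-1 : ℝ) < z := by
      by_contra! hcon
      nlinarith
    have b1 : z < 1 := by exact_mod_cast a1
    have b2 : -1 < z := by exact_mod_cast a2
    omega
  rw [hz0] at hz
  rw [abs_le]
  simpa using hz

/-- Mass of a continuous function that is bounded below on a rectangle. -/
theorem le_integral_torus_of_le {F : Torus → ℝ} (hF : Continuous F) (h0 : ∀ p, 0 ≤ F p)
    {c d ε η m : ℝ} (hε : 0 < ε) (hη : 0 < η) (hm : 0 ≤ m)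
    (h1 : -Real.pi < c - ε) (h2 : c + ε < Real.pi) (h3 : -Real.pi < d - η) (h4 : d + η < Real.pi)
    (h : ∀ p : Torus, |p.1.rep - c| ≤ ε → |p.2.rep - d| ≤ η → m ≤ F p) :
    m * (2 * ε * (2 * η)) ≤ ∫ p, F p := by
  have hb := mul_meas_ge_le_integral_of_nonneg (Eventually.of_forall h0)
    (integrable_torus_of_continuous hF) m
  refine le_trans (mul_le_mul_of_nonneg_left ?_ hm) hb
  have hsub : (Metric.closedBall (c : Circ) ε) ×ˢ (Metric.closedBall (d : Circ) η) ⊆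
      {p : Torus | m ≤ F p} := fun p hp =>
    h p (Circ.abs_rep_sub_le h1 h2 hp.1) (Circ.abs_rep_sub_le h3 h4 hp.2)
  have hv : volume.real ((Metric.closedBall (c : Circ) ε) ×ˢ (Metric.closedBall (d : Circ) η)) =
      2 * ε * (2 * η) := by
    rw [Measure.volume_eq_prod, measureReal_prod_prod, Measure.real, Measure.real,
      AddCircle.volume_closedBall, AddCircle.volume_closedBall, min_eq_right (by linarith),
      min_eq_right (by linarith), ENNReal.toReal_ofReal (by positivity),
      ENNReal.toReal_ofReal (by positivity)]
  rw [← hv]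
  exact measureReal_mono hsub

theorem integral_torus_mul (f g : Circ → ℝ) :
    ∫ p : Torus, f p.1 * g p.2 = (∫ x, f x) * ∫ y, g y := by
  rw [Measure.volume_eq_prod]; exact integral_prod_mul f g

theorem integral_torus_gaussian_sq_le {k : ℝ} (hk : 0 < k) :
    ∫ p : Torus, p.1.gaussian k ^ 2 ≤ 48 * k ^ 2 := by
  have h := integral_torus_mul (fun x => x.gaussian k ^ 2) (fun _ => 1)
  simp only [mul_one] at h
  rw [h, Circ.integral_one]
  have h1 := Circ.integral_gaussian_sq_le hk
  have h2 := Real.pi_le_four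
  have h3 := Real.pi_pos
  have : 0 ≤ ∫ x : Circ, x.gaussian k ^ 2 := integral_nonneg fun _ => sq_nonneg _
  nlinarith

theorem eLpNorm_le_of_norm_le_gaussian {k r : ℝ} (hk : 0 < k) (hr : 0 ≤ r) {F : Torus → ℂ}
    (h : ∀ p, ‖F p‖ ≤ r * p.1.gaussian k) : eLpNorm F 2 volume ≤ ENNReal.ofReal (7 * r * k) := by
  have hc : Continuous fun p : Torus => ((r * p.1.gaussian k : ℝ) : ℂ) :=
    Complex.continuous_ofReal.comp (continuous_const.mul
      ((Circ.continuous_gaussian k).comp continuous_fst))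
  have hmono : eLpNorm F 2 volume ≤ eLpNorm (fun p : Torus => ((r * p.1.gaussian k : ℝ) : ℂ)) 2
      volume := eLpNorm_mono fun p => by
    rw [Complex.norm_real, Real.norm_of_nonneg (mul_nonneg hr (p.1.gaussian_pos k).le)]
    exact h p
  refine hmono.trans ?_
  rw [eLpNorm_two_eq_sqrt_of_continuous hc]
  apply ENNReal.ofReal_le_ofReal
  -- The constant `7` comes from `48 ≤ 7²`.
  rw [Real.sqrt_le_left (by positivity)]
  have e : ∀ p : Torus, ‖((r * p.1.gaussian k : ℝ) : ℂ)‖ ^ 2 = r ^ 2 * p.1.gaussian k ^ 2 :=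
    fun p => by rw [Complex.norm_real, Real.norm_eq_abs, sq_abs, mul_pow]
  simp_rw [e]
  rw [integral_const_mul]
  have := integral_torus_gaussian_sq_le hk
  nlinarith [mul_le_mul_of_nonneg_left this (sq_nonneg r), mul_nonneg (sq_nonneg r) (sq_nonneg k)]

/-! ### Fourier multipliers in `y` and annular cutoffs. -/

/-- **Parseval's identity** for continuous functions on the circle. -/
theorem hasSum_sq_fourierCoeff_of_continuous {T : ℝ} [hT : Fact (0 < T)] {u : AddCircle T → ℂ}
    (hu : Continuous u) :
    HasSum (fun n => ‖fourierCoeff u n‖ ^ 2) (T⁻¹ * ∫ y, ‖u y‖ ^ 2) := by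
  have hm : MemLp u 2 (AddCircle.haarAddCircle (T := T)) := memLp_two_of_continuous hu
  have h := hasSum_sq_fourierCoeff (hm.toLp u)
  have e1 : ∀ n, fourierCoeff (hm.toLp u : AddCircle T → ℂ) n = fourierCoeff u n :=
    fun n => congrFun (fourierCoeff_congr_ae hm.coeFn_toLp) n
  have e2 : ∫ t, ‖hm.toLp u t‖ ^ 2 ∂AddCircle.haarAddCircle = T⁻¹ * ∫ y, ‖u y‖ ^ 2 := by
    rw [← smul_eq_mul, ← AddCircle.integral_haarAddCircle]
    refine integral_congr_ae ?_
    filter_upwards [hm.coeFn_toLp] with t ht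
    rw [ht]
  rw [e2] at h
  exact h.congr_fun fun n => by rw [e1]

theorem integral_sq_le_of_fourierCoeff_le {v w : Circ → ℂ} (hv : Continuous v) (hw : Continuous w)
    {B : ℝ} (h : ∀ n, ‖fourierCoeff v n‖ ≤ B * ‖fourierCoeff w n‖) :
    ∫ y, ‖v y‖ ^ 2 ≤ B ^ 2 * ∫ y, ‖w y‖ ^ 2 := by
  have h1 := hasSum_sq_fourierCoeff_of_continuous hv
  have h2 := (hasSum_sq_fourierCoeff_of_continuous hw).mul_left (B ^ 2)
  have h3 := hasSum_le (fun n => by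
    rw [← mul_pow]
    exact pow_le_pow_left₀ (norm_nonneg _) (h n) 2) h1 h2
  have hpi : 0 < (2 * Real.pi)⁻¹ := by have := Real.pi_pos; positivity
  rw [← mul_assoc, mul_comm (B ^ 2), mul_assoc] at h3
  exact le_of_mul_le_mul_left h3 hpi

/-- The frequencies seen by a compactly supported multiplier. -/
theorem finite_setOf_multiplier_ne_zero {m : ℝ → ℝ} {R t : ℝ} (ht : 0 < t)
    (hm : ∀ η, R ≤ |η| → m η = 0) : {n : ℤ | m (t * n) ≠ 0}.Finite := by
  refine (Set.finite_Icc (-⌈R / t⌉) ⌈R / t⌉).subset fun n hn => ?_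
  have h1 : |t * n| < R := by
    by_contra! hcon
    exact hn (hm _ hcon)
  rw [abs_mul, abs_of_pos ht] at h1
  have h2 : |(n : ℝ)| < R / t := by rw [lt_div_iff₀ ht]; linarith
  have h3 : |(n : ℝ)| ≤ ⌈R / t⌉ := h2.le.trans (Int.le_ceil _)
  rw [abs_le] at h3
  exact ⟨by exact_mod_cast h3.1, by exact_mod_cast h3.2⟩

/-- The Fourier multiplier `m(t D)` on the circle. -/
noncomputable def multCirc (m : ℝ → ℝ) (t : ℝ) (u : Circ → ℂ) (y : Circ) : ℂ :=
  ∑' n : ℤ, (m (t * n) : ℂ) * fourierCoeff u n * fourier n y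

section multCirc

variable {m : ℝ → ℝ} {R t : ℝ} {u : Circ → ℂ}

theorem multCirc_eq_sum (hf : {n : ℤ | m (t * n) ≠ 0}.Finite) (y : Circ) :
    multCirc m t u y = ∑ n ∈ hf.toFinset, (m (t * n) : ℂ) * fourierCoeff u n * fourier n y := by
  refine tsum_eq_sum fun n hn => ?_
  have : m (t * n) = 0 := by simpa using hn
  rw [this]; simp

theorem continuous_multCirc (hf : {n : ℤ | m (t * n) ≠ 0}.Finite) :
    Continuous (multCirc m t u) := by
  have : multCirc m t u = fun y => ∑ n ∈ hf.toFinset,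
      (m (t * n) : ℂ) * fourierCoeff u n * fourier n y := funext (multCirc_eq_sum hf)
  rw [this]
  fun_prop

theorem fourierCoeff_multCirc (hf : {n : ℤ | m (t * n) ≠ 0}.Finite) (n : ℤ) :
    fourierCoeff (multCirc m t u) n = m (t * n) * fourierCoeff u n := by
  have e1 : multCirc m t u = ∑ n ∈ hf.toFinset, fun y : Circ =>
      ((m (t * n) : ℂ) * fourierCoeff u n) * fourier n y := by
    funext y; rw [multCirc_eq_sum hf, Finset.sum_apply]
  rw [e1]
  have hi : ∀ i ∈ hf.toFinset, Integrable (fun y : Circ =>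
      ((m (t * i) : ℂ) * fourierCoeff u i) * fourier i y) AddCircle.haarAddCircle := fun i _ =>
    (Continuous.integrable_of_hasCompactSupport (by fun_prop) (HasCompactSupport.of_compactSpace _))
  rw [fourierCoeff.sum hf.toFinset _ hi, Finset.sum_apply]
  have e3 : ∀ i : ℤ, fourierCoeff (fun y : Circ => ((m (t * i) : ℂ) * fourierCoeff u i) *
      fourier i y) n = (m (t * i) * fourierCoeff u i) * (Pi.single i 1 : ℤ → ℂ) n := fun i => by
    rw [fourierCoeff.const_mul, ← fourierCoeff_fourier (T := 2 * Real.pi)]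
  simp_rw [e3]
  by_cases hn : n ∈ hf.toFinset
  · rw [Finset.sum_eq_single n (fun i _ hi => by rw [Pi.single_eq_of_ne hi.symm, mul_zero])
      (fun h => absurd hn h), Pi.single_eq_same, mul_one]
  · rw [Finset.sum_eq_zero fun i hi => by
      have hin : n ≠ i := fun h => hn (by rw [h]; exact hi)
      rw [Pi.single_eq_of_ne hin, mul_zero]]
    have : m (t * n) = 0 := by simpa using hn
    rw [this]; simp

/-- By Parseval, only a comparison of coefficients is needed. The free function `w` is meant to be
small when `u` is concentrated at frequencies where `m = 1`. -/
theorem integral_multCirc_sub_sq_le (hf : {n : ℤ | m (t * n) ≠ 0}.Finite) (hu : Continuous u)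
    {w : Circ → ℂ} (hw : Continuous w) {B : ℝ}
    (h : ∀ n : ℤ, |m (t * n) - 1| * ‖fourierCoeff u n‖ ≤ B * ‖fourierCoeff w n‖) :
    ∫ y, ‖multCirc m t u y - u y‖ ^ 2 ≤ B ^ 2 * ∫ y, ‖w y‖ ^ 2 := by
  refine integral_sq_le_of_fourierCoeff_le ((continuous_multCirc hf).sub hu) hw fun n => ?_
  have hi : ∀ {v : Circ → ℂ}, Continuous v → Integrable v AddCircle.haarAddCircle := fun hv =>
    hv.integrable_of_hasCompactSupport (HasCompactSupport.of_compactSpace _)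
  have e : (fun y => multCirc m t u y - u y) = multCirc m t u + fun y => (-1 : ℂ) * u y := by
    funext y; simp [sub_eq_add_neg]
  change ‖fourierCoeff (fun y => multCirc m t u y - u y) n‖ ≤ _
  rw [e, fourierCoeff.add (hi (continuous_multCirc hf)) (hi (by fun_prop)), Pi.add_apply,
    fourierCoeff.const_mul, fourierCoeff_multCirc hf, ← add_mul, norm_mul]
  refine le_trans (le_of_eq ?_) (h n)
  rw [← sub_eq_add_neg, ← Complex.ofReal_one, ← Complex.ofReal_sub, Complex.norm_real,
    Real.norm_eq_abs]

end multCirc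

/-- Each slice in `y` is a combination of `u0` and `u1`, so the multiplier on the torus reduces to
the one on the circle. -/
theorem multY_eq {m : ℝ → ℝ} {t : ℝ} {f0 f1 u0 u1 : Circ → ℂ}
    (hf : {n : ℤ | m (t * n) ≠ 0}.Finite) (h0 : Continuous u0) (h1 : Continuous u1) (c : ℂ)
    (p : Torus) : multY m t (fun p => c * (f0 p.1 * u0 p.2 + f1 p.1 * u1 p.2)) p =
      c * (f0 p.1 * multCirc m t u0 p.2 + f1 p.1 * multCirc m t u1 p.2) := by
  have hi : ∀ {v : Circ → ℂ}, Continuous v → Integrable v AddCircle.haarAddCircle := fun hv =>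
    hv.integrable_of_hasCompactSupport (HasCompactSupport.of_compactSpace _)
  have e : ∀ n : ℤ, fourierCoeff (fun y : Circ => c * (f0 p.1 * u0 y + f1 p.1 * u1 y)) n =
      c * (f0 p.1 * fourierCoeff u0 n + f1 p.1 * fourierCoeff u1 n) := fun n => by
    have e1 : (fun y : Circ => f0 p.1 * u0 y + f1 p.1 * u1 y) =
      (fun y => f0 p.1 * u0 y) + fun y => f1 p.1 * u1 y := rfl
    rw [fourierCoeff.const_mul, e1, fourierCoeff.add (hi (by fun_prop)) (hi (by fun_prop)),
      Pi.add_apply, fourierCoeff.const_mul, fourierCoeff.const_mul]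
  have e4 : multY m t (fun p => c * (f0 p.1 * u0 p.2 + f1 p.1 * u1 p.2)) p =
      ∑ n ∈ hf.toFinset, (m (t * n) : ℂ) *
      (c * (f0 p.1 * fourierCoeff u0 n + f1 p.1 * fourierCoeff u1 n)) * fourier n p.2 := by
    unfold multY
    simp_rw [e]
    refine tsum_eq_sum fun n hn => ?_
    have : m (t * n) = 0 := by simpa using hn
    rw [this]; simp
  rw [e4, multCirc_eq_sum hf, multCirc_eq_sum hf, Finset.mul_sum, Finset.mul_sum,
    ← Finset.sum_add_distrib, Finset.mul_sum]
  exact Finset.sum_congr rfl fun n _ => by ring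

/-- Properties of the annular cutoffs. -/
theorem IsCutoff.eq_zero {χ : ℝ → ℝ} (h : IsCutoff χ) {η : ℝ} (hη : 1 ≤ |η|) : χ η = 0 := by
  by_contra hne
  have h1 := h.support_subset (subset_tsupport χ hne)
  have : |η| < 1 := abs_lt.2 ⟨h1.1, h1.2⟩
  linarith

theorem IsCutoff.annularCutoff_eq_zero {χ : ℝ → ℝ} (h : IsCutoff χ) {R η : ℝ} (hR : 1 ≤ R)
    (hη : R ≤ |η|) : annularCutoff χ R η = 0 := by
  unfold annularCutoff
  rw [h.eq_zero, h.eq_zero, sub_zero]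
  · rw [abs_mul, abs_of_pos (by linarith)]; nlinarith
  · rw [abs_div, abs_of_pos (by linarith : 0 < R), le_div_iff₀ (by linarith)]; linarith

theorem IsCutoff.annularCutoff_eq_one {χ : ℝ → ℝ} (h : IsCutoff χ) {R η : ℝ} (hR : 4 ≤ R)
    (h1 : 1 / 2 ≤ |η|) (h2 : |η| ≤ 3 / 2) : annularCutoff χ R η = 1 := by
  unfold annularCutoff
  rw [h.eq_one, h.eq_zero, sub_zero]
  · rw [abs_mul, abs_of_pos (by linarith)]; nlinarith
  · rw [abs_div, abs_of_pos (by linarith : 0 < R), div_le_iff₀ (by linarith)]; linarith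

theorem IsCutoff.exists_bound {χ : ℝ → ℝ} (h : IsCutoff χ) :
    ∃ B : ℝ, 0 ≤ B ∧ ∀ R η : ℝ, |annularCutoff χ R η - 1| ≤ B := by
  obtain ⟨M, hM⟩ := h.compact_support.exists_bound_of_continuous h.smooth.continuous
  have h0 := (norm_nonneg _).trans (hM 0)
  refine ⟨M + M + 1, by linarith, fun R η => ?_⟩
  unfold annularCutoff
  refine (abs_sub _ _).trans ?_
  rw [abs_one]
  have := abs_sub (χ (η / R)) (χ (R * η))
  have h1 := hM (η / R)
  have h2 := hM (R * η)
  rw [Real.norm_eq_abs] at h1 h2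
  linarith

theorem mul_exp_le_one_of_le {k τ c : ℝ} (hk : 0 < k) (hτ : 0 ≤ τ) (hkτ : k * Real.exp (5 * τ) ≤ 1)
    (hc : c ≤ 5) : k * Real.exp (c * τ) ≤ 1 :=
  (mul_le_mul_of_nonneg_left (Real.exp_le_exp.2 (by nlinarith)) hk.le).trans hkτ

theorem Circ.integral_sq_le_of_norm_le {u : Circ → ℂ} (hu : Continuous u) {M : ℝ}
    (h : ∀ y, ‖u y‖ ≤ M) : ∫ y, ‖u y‖ ^ 2 ≤ 8 * M ^ 2 := by
  have h1 : ∫ y, ‖u y‖ ^ 2 ≤ ∫ _ : Circ, M ^ 2 * 1 :=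
    integral_mono (integrable_circ_of_continuous (by fun_prop)) (integrable_const _) fun y => by
      have := h y
      have h0 := norm_nonneg (u y)
      rw [mul_one]
      exact pow_le_pow_left₀ h0 this 2
  rw [integral_const_mul, Circ.integral_one] at h1
  have := Real.pi_le_four
  nlinarith [sq_nonneg M]

theorem Circ.integral_sq_le_of_norm_le_gaussian {u : Circ → ℂ} (hu : Continuous u) {k M : ℝ}
    (hk : 0 < k) (h : ∀ x, ‖u x‖ ≤ M * x.gaussian k) : ∫ x, ‖u x‖ ^ 2 ≤ 6 * M ^ 2 * k ^ 2 := by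
  have hg := Circ.continuous_gaussian k
  have h1 : ∫ y, ‖u y‖ ^ 2 ≤ ∫ x : Circ, M ^ 2 * x.gaussian k ^ 2 :=
    integral_mono (integrable_circ_of_continuous (by fun_prop))
      (integrable_circ_of_continuous (by fun_prop)) fun y => by
      simp only
      rw [← mul_pow]
      exact pow_le_pow_left₀ (norm_nonneg (u y)) (h y) 2
  rw [integral_const_mul] at h1
  nlinarith [mul_le_mul_of_nonneg_left (Circ.integral_gaussian_sq_le hk) (sq_nonneg M)]

theorem quasimodeResidual_const_mul (h β : ℝ) (b : Circ → ℝ) (c : ℂ) (ψ g : Torus → ℂ) (p : Torus) :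
    quasimodeResidual h β b (fun p => c * ψ p) (fun p => c * g p) p =
      c * quasimodeResidual h β b ψ g p := by
  unfold quasimodeResidual; ring

/-! ### Mass, width, frequency and concentration of the normalized ansatz. -/

namespace Ansatz

variable {V b : Circ → ℝ} {ν y₀ K k τ σ : ℝ} (a : Ansatz V b ν y₀ K k τ σ)

theorem continuous_ψ : Continuous a.ψ := by
  have h0 := a.continuous_f0
  have h1 := a.continuous_f1
  have h2 := a.continuous_u0
  have h3 := a.continuous_u1
  have : a.ψ = fun p => a.f0 p.1 * a.u0 p.2 + a.f1 p.1 * a.u1 p.2 := funext a.eq_ψ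
  rw [this]; fun_prop

/-- The squared `L²` norm. -/
noncomputable def mass : ℝ := ∫ p, ‖a.ψ p‖ ^ 2

/-- The normalized quasimode. -/
noncomputable def normalized (p : Torus) : ℂ := ((1 / √a.mass : ℝ) : ℂ) * a.ψ p

theorem continuous_normalized : Continuous a.normalized :=
  continuous_const.mul a.continuous_ψ

/-- The bound integrates the lower bound on `‖ψ‖²` over the rectangle `|x| ≤ k²`, `-μ ≤ s ≤ 0`,
where it is least at `s = -μ`. Leaving `μ` free matters: `y₀ / 4` gives the width, and `μ ≤ δ / 2`
gives concentration at scale `δ`. -/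
theorem le_mass (hK : 1 ≤ K) (hk : 0 < k) (hk1 : k ≤ 1) (hτ : 0 ≤ τ) (hy : y₀ < Real.pi)
    (hσ : σ = 1 ∨ σ = -1) {μ : ℝ} (hμ : 0 < μ) (hμy : μ ≤ y₀ / 2) :
    2 * μ / K ^ 2 * k ^ 2 * Real.exp (-(2 * μ * τ)) ≤ a.mass := by
  have hψ := a.continuous_ψ
  have hk2 : k ^ 2 ≤ 1 := pow_le_one₀ hk.le hk1
  have hpi := Real.pi_gt_three
  have hd : |σ * (y₀ - μ / 2)| = y₀ - μ / 2 := by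
    rcases hσ with rfl | rfl
    · rw [one_mul, abs_of_pos (by linarith)]
    · rw [neg_one_mul, abs_neg, abs_of_pos (by linarith)]
  obtain ⟨d1, d2⟩ := abs_le.1 hd.le
  have h := le_integral_torus_of_le (F := fun p => ‖a.ψ p‖ ^ 2) (by fun_prop)
    (fun p => by positivity) (c := 0) (d := σ * (y₀ - μ / 2)) (ε := k ^ 2) (η := μ / 2)
    (m := (1 / K * Real.exp (-(μ * τ))) ^ 2) (by positivity) (by positivity) (by positivity)
    (by linarith) (by linarith) (by linarith) (by linarith) (fun p h1 h2 => by
      rw [sub_zero] at h1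
      have h3 : |(σ * p.2.rep - y₀) + μ / 2| ≤ μ / 2 := by
        refine le_trans (le_of_eq ?_) h2
        rcases hσ with rfl | rfl
        · congr 1; ring
        · rw [← abs_neg]; congr 1; ring
      obtain ⟨l, r⟩ := abs_le.1 h3
      refine pow_le_pow_left₀ (by positivity) ?_ 2
      refine le_trans ?_ (a.le_norm p h1 (by linarith) (by linarith))
      gcongr
      nlinarith)
  refine le_trans (le_of_eq ?_) h
  rw [mul_pow, ← Real.exp_nat_mul]
  have : ((2 : ℕ) : ℝ) * -(μ * τ) = -(2 * μ * τ) := by push_cast; ring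
  rw [this]
  field_simp

theorem mass_pos (hK : 1 ≤ K) (hk : 0 < k) (hk1 : k ≤ 1) (hτ : 0 ≤ τ) (hy0 : 0 < y₀)
    (hy : y₀ < Real.pi) (hσ : σ = 1 ∨ σ = -1) : 0 < a.mass :=
  lt_of_lt_of_le (by positivity) (a.le_mass hK hk hk1 hτ hy hσ (half_pos hy0) le_rfl)

theorem norm_normalized_sq (h : 0 < a.mass) (p : Torus) :
    ‖a.normalized p‖ ^ 2 = ‖a.ψ p‖ ^ 2 / a.mass := by
  unfold normalized
  rw [norm_mul, Complex.norm_real, Real.norm_of_nonneg (by positivity), mul_pow, div_pow,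
    Real.sq_sqrt h.le]
  ring

theorem integral_normalized_sq (h : 0 < a.mass) : ∫ p, ‖a.normalized p‖ ^ 2 = 1 := by
  simp_rw [a.norm_normalized_sq h]
  rw [integral_div]
  exact div_self h.ne'

theorem eLpNorm_normalized (h : 0 < a.mass) : eLpNorm a.normalized 2 volume = 1 := by
  rw [eLpNorm_two_eq_sqrt_of_continuous a.continuous_normalized, a.integral_normalized_sq h]
  simp

/-- The residual has norm `O(k⁵ e^{-y₀τ/2})`, and the square root of the mass is at least of order
`k e^{-y₀τ/4}`; half of the exponential gain survives the division. -/
theorem isQuasimode (hK : 1 ≤ K) (hk : 0 < k) (hk1 : k ≤ 1) (hτ : 0 ≤ τ) (hy0 : 0 < y₀)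
    (hy : y₀ < Real.pi) (hσ : σ = 1 ∨ σ = -1) :
    IsQuasimode V b (k ^ 2) (k ^ 2 * τ)
      (7 * K ^ 2 / √(y₀ / 2) * (k ^ 2) ^ 2 * Real.exp (-(y₀ / 4 * τ))) a.normalized := by
  have hZ := a.mass_pos hK hk hk1 hτ hy0 hy hσ
  refine ⟨memLp_two_of_continuous a.continuous_normalized, a.eLpNorm_normalized hZ,
    fun p => ((1 / √a.mass : ℝ) : ℂ) * a.g p,
    memLp_two_of_continuous (continuous_const.mul a.continuous_g), a.weak.const_mul _, ?_⟩
  have hsq : 0 < √a.mass := Real.sqrt_pos.2 hZ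
  have hs0 : 0 < √(y₀ / 2) := Real.sqrt_pos.2 (by positivity)
  have hlow : √(y₀ / 2) / K * k * Real.exp (-(y₀ / 4 * τ)) ≤ √a.mass := by
    apply Real.le_sqrt_of_sq_le
    have h := a.le_mass hK hk hk1 hτ hy hσ (μ := y₀ / 4) (by positivity) (by linarith)
    refine le_trans (le_of_eq ?_) h
    rw [mul_pow, mul_pow, div_pow, Real.sq_sqrt (by positivity), ← Real.exp_nat_mul]
    have : ((2 : ℕ) : ℝ) * -(y₀ / 4 * τ) = -(2 * (y₀ / 4) * τ) := by push_cast; ring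
    rw [this]; ring
  refine (eLpNorm_le_of_norm_le_gaussian (k := k)
    (r := 1 / √a.mass * (K * k ^ 4 * Real.exp (-(y₀ / 2 * τ)))) hk (by positivity) fun p => ?_).trans
    (ENNReal.ofReal_le_ofReal ?_)
  · change ‖quasimodeResidual _ _ _ (fun p => ((1 / √a.mass : ℝ) : ℂ) * a.ψ p) _ p‖ ≤ _
    rw [quasimodeResidual_const_mul, norm_mul, Complex.norm_real, Real.norm_of_nonneg (by positivity),
      mul_assoc]
    gcongr
    exact a.residual_le p
  · have h2 : 1 / √a.mass ≤ 1 / (√(y₀ / 2) / K * k * Real.exp (-(y₀ / 4 * τ))) :=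
      one_div_le_one_div_of_le (by positivity) hlow
    calc 7 * (1 / √a.mass * (K * k ^ 4 * Real.exp (-(y₀ / 2 * τ)))) * k
        ≤ 7 * (1 / (√(y₀ / 2) / K * k * Real.exp (-(y₀ / 4 * τ))) *
          (K * k ^ 4 * Real.exp (-(y₀ / 2 * τ)))) * k := by gcongr
      _ = 7 * K ^ 2 / √(y₀ / 2) * k ^ 4 *
          (Real.exp (-(y₀ / 2 * τ)) / Real.exp (-(y₀ / 4 * τ))) := by field_simp
      _ = _ := by
        rw [← Real.exp_sub, ← pow_mul]
        congr 2
        ring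

/-- The main factor has small coefficients away from `t n = -σ`, where the cutoff equals `1`. The
corrector needs no such information, since `f1` is already `O(k⁴)`. -/
theorem eLpNorm_multY_sub_le (hK : 1 ≤ K) (hk : 0 < k) (hk1 : k ≤ 1) (hτ : 0 ≤ τ)
    (hkτ : k * Real.exp (5 * τ) ≤ 1) (hy0 : 0 < y₀) (hy : y₀ < Real.pi) (hσ : σ = 1 ∨ σ = -1)
    {χ : ℝ → ℝ} (hχ : IsCutoff χ) {B R : ℝ} (hB : ∀ η : ℝ, |annularCutoff χ R η - 1| ≤ B)
    (hR : 4 ≤ R) :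
    Continuous (multY (annularCutoff χ R) ((k ^ 2) ^ 2) a.normalized) ∧
    eLpNorm (multY (annularCutoff χ R) ((k ^ 2) ^ 2) a.normalized - a.normalized) 2 volume ≤
      ENNReal.ofReal (√(960 * K ^ 6 * B ^ 2 / y₀) * k ^ 2) := by
  have hZ := a.mass_pos hK hk hk1 hτ hy0 hy hσ
  set m := annularCutoff χ R with hm
  set t := (k ^ 2) ^ 2 with ht
  have ht4 : t = k ^ 4 := by rw [ht, ← pow_mul]
  have hf : {n : ℤ | m (t * n) ≠ 0}.Finite := finite_setOf_multiplier_ne_zero (by positivity)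
    fun η hη => hχ.annularCutoff_eq_zero (by linarith) hη
  have c0 := a.continuous_u0
  have c1 := a.continuous_u1
  have cd := a.continuous_du0
  have cf0 := a.continuous_f0
  have cf1 := a.continuous_f1
  have cm0 : Continuous (multCirc m t a.u0) := continuous_multCirc hf
  have cm1 : Continuous (multCirc m t a.u1) := continuous_multCirc hf
  set c : ℂ := ((1 / √a.mass : ℝ) : ℂ) with hc
  have eψ : a.normalized = fun p => c * (a.f0 p.1 * a.u0 p.2 + a.f1 p.1 * a.u1 p.2) :=
    funext fun p => by rw [normalized, a.eq_ψ]
  have eM : multY m t a.normalized = fun p =>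
      c * (a.f0 p.1 * multCirc m t a.u0 p.2 + a.f1 p.1 * multCirc m t a.u1 p.2) := by
    rw [eψ]; exact funext fun p => multY_eq hf c0 c1 c p
  set v0 : Circ → ℂ := fun y => multCirc m t a.u0 y - a.u0 y with hv0
  set v1 : Circ → ℂ := fun y => multCirc m t a.u1 y - a.u1 y with hv1
  have cv0 : Continuous v0 := cm0.sub c0
  have cv1 : Continuous v1 := cm1.sub c1
  have eD : multY m t a.normalized - a.normalized = fun p =>
      c * (a.f0 p.1 * v0 p.2 + a.f1 p.1 * v1 p.2) := by
    rw [eM, eψ]; funext p; simp only [Pi.sub_apply, hv0, hv1]; ring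
  refine ⟨by rw [eM]; fun_prop, ?_⟩
  have hB0 : 0 ≤ B := (abs_nonneg _).trans (hB 0)
  -- The coefficients of `w` are `i (t n + σ)` times those of `u0`. Wherever the cutoff can differ
  -- from `1`, `|t n + σ| ≥ 1/2`, so `w` controls `u0` with a loss of `2`.
  set w : Circ → ℂ := fun y => (k : ℂ) ^ 4 * a.du0 y + Complex.I * σ * a.u0 y with hw
  have cw : Continuous w := by fun_prop
  have hσa : |σ| = 1 := by rcases hσ with rfl | rfl <;> simp
  have hwc : ∀ n : ℤ, ‖fourierCoeff w n‖ = |t * n + σ| * ‖fourierCoeff a.u0 n‖ := fun n => by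
    have hi : ∀ {v : Circ → ℂ}, Continuous v → Integrable v AddCircle.haarAddCircle := fun hv =>
      hv.integrable_of_hasCompactSupport (HasCompactSupport.of_compactSpace _)
    have e1 : w = (fun y => (k : ℂ) ^ 4 * a.du0 y) + fun y => Complex.I * σ * a.u0 y := rfl
    rw [e1, fourierCoeff.add (hi (by fun_prop)) (hi (by fun_prop)), Pi.add_apply,
      fourierCoeff.const_mul, fourierCoeff.const_mul, a.fourierCoeff_du0]
    have e2 : (k : ℂ) ^ 4 * (Complex.I * n * fourierCoeff a.u0 n) +
        Complex.I * σ * fourierCoeff a.u0 n =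
        Complex.I * (((t * n + σ : ℝ) : ℂ) * fourierCoeff a.u0 n) := by
      rw [ht4]; push_cast; ring
    rw [e2, norm_mul, Complex.norm_I, one_mul, norm_mul, Complex.norm_real, Real.norm_eq_abs]
  have i0 : ∫ y, ‖v0 y‖ ^ 2 ≤ (2 * B) ^ 2 * (8 * (K * k ^ 3 * Real.exp τ) ^ 2) := by
    refine (integral_multCirc_sub_sq_le hf c0 cw (B := 2 * B) fun n => ?_).trans ?_
    · rw [hwc, ← mul_assoc]
      refine mul_le_mul_of_nonneg_right ?_ (norm_nonneg _)
      rcases le_or_gt (1 / 2) |t * n + σ| with h | h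
      · exact (hB _).trans (by nlinarith)
      · have h1 : |t * n| ≤ 3 / 2 := by
          have := abs_sub (t * n + σ) σ
          rw [add_sub_cancel_right] at this
          linarith
        have h2 : 1 / 2 ≤ |t * n| := by
          have := abs_sub (t * n + σ) (t * n)
          rw [add_sub_cancel_left] at this
          linarith
        rw [hm, hχ.annularCutoff_eq_one hR h2 h1, sub_self, abs_zero]
        positivity
    · exact mul_le_mul_of_nonneg_left (Circ.integral_sq_le_of_norm_le cw a.frequency) (sq_nonneg _)
  have i1 : ∫ y, ‖v1 y‖ ^ 2 ≤ B ^ 2 * (8 * (K * Real.exp τ / k) ^ 2) := by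
    refine (integral_multCirc_sub_sq_le hf c1 c1 (B := B) fun n => ?_).trans ?_
    · exact mul_le_mul_of_nonneg_right (hB _) (norm_nonneg _)
    · refine mul_le_mul_of_nonneg_left (Circ.integral_sq_le_of_norm_le c1 fun y => ?_) (sq_nonneg _)
      rw [le_div_iff₀ hk, mul_comm]; exact a.u1_le y
  have j0 := Circ.integral_sq_le_of_norm_le_gaussian cf0 hk a.f0_le
  have j1 := Circ.integral_sq_le_of_norm_le_gaussian cf1 hk a.f1_le
  have hcn : ‖c‖ ^ 2 = 1 / a.mass := by
    rw [hc, Complex.norm_real, Real.norm_of_nonneg (by positivity), div_pow, one_pow,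
      Real.sq_sqrt hZ.le]
  have n0 : ∀ u : Circ → ℂ, 0 ≤ ∫ y, ‖u y‖ ^ 2 := fun u => integral_nonneg fun _ => by positivity
  have hint : ∫ p : Torus, ‖c * (a.f0 p.1 * v0 p.2 + a.f1 p.1 * v1 p.2)‖ ^ 2 ≤
      1 / a.mass * (480 * K ^ 4 * B ^ 2 * (k ^ 8 * Real.exp τ ^ 2)) := by
    have s1 : ∫ p : Torus, ‖c * (a.f0 p.1 * v0 p.2 + a.f1 p.1 * v1 p.2)‖ ^ 2 ≤
        ∫ p : Torus, 1 / a.mass * (2 * (‖a.f0 p.1‖ ^ 2 * ‖v0 p.2‖ ^ 2) +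
          2 * (‖a.f1 p.1‖ ^ 2 * ‖v1 p.2‖ ^ 2)) := by
      refine integral_mono (integrable_torus_of_continuous (by fun_prop))
        (integrable_torus_of_continuous (by fun_prop)) fun p => ?_
      simp only
      rw [norm_mul, mul_pow, hcn]
      refine mul_le_mul_of_nonneg_left ?_ (by positivity)
      have h1 := norm_add_le (a.f0 p.1 * v0 p.2) (a.f1 p.1 * v1 p.2)
      rw [norm_mul, norm_mul] at h1
      refine (pow_le_pow_left₀ (norm_nonneg _) h1 2).trans ?_
      nlinarith [sq_nonneg (‖a.f0 p.1‖ * ‖v0 p.2‖ - ‖a.f1 p.1‖ * ‖v1 p.2‖)]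
    refine s1.trans ?_
    rw [integral_const_mul, integral_add (integrable_torus_of_continuous (by fun_prop))
      (integrable_torus_of_continuous (by fun_prop)), integral_const_mul, integral_const_mul,
      integral_torus_mul (fun x => ‖a.f0 x‖ ^ 2) (fun y => ‖v0 y‖ ^ 2),
      integral_torus_mul (fun x => ‖a.f1 x‖ ^ 2) (fun y => ‖v1 y‖ ^ 2)]
    refine mul_le_mul_of_nonneg_left ?_ (by positivity)
    have p0 := mul_le_mul j0 i0 (n0 v0) (by positivity)
    have p1 := mul_le_mul j1 i1 (n0 v1) (by positivity)
    have q0 : 6 * K ^ 2 * k ^ 2 * ((2 * B) ^ 2 * (8 * (K * k ^ 3 * Real.exp τ) ^ 2)) =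
        192 * K ^ 4 * B ^ 2 * (k ^ 8 * Real.exp τ ^ 2) := by ring
    have q1 : 6 * (K * k ^ 4) ^ 2 * k ^ 2 * (B ^ 2 * (8 * (K * Real.exp τ / k) ^ 2)) =
        48 * K ^ 4 * B ^ 2 * (k ^ 8 * Real.exp τ ^ 2) := by field_simp; ring
    rw [q0] at p0
    rw [q1] at p1
    linarith
  have hmass := a.le_mass hK hk hk1 hτ hy hσ (μ := y₀ / 4) (by positivity) (by linarith)
  rw [eD, eLpNorm_two_eq_sqrt_of_continuous (by fun_prop)]
  apply ENNReal.ofReal_le_ofReal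
  rw [Real.sqrt_le_left (by positivity), mul_pow, Real.sq_sqrt (by positivity)]
  refine hint.trans ?_
  have hL : 0 < 2 * (y₀ / 4) / K ^ 2 * k ^ 2 * Real.exp (-(2 * (y₀ / 4) * τ)) := by positivity
  -- Here `k² e^{2τ}` has to be beaten by the exponential in the lower bound for the mass, which
  -- needs `2 + y₀ / 2 ≤ 5`.
  have hexp : k ^ 2 * Real.exp τ ^ 2 ≤ Real.exp (-(2 * (y₀ / 4) * τ)) := by
    have hpi := Real.pi_le_four
    have h1 : k * Real.exp ((2 + y₀ / 2) * τ) ≤ 1 := mul_exp_le_one_of_le hk hτ hkτ (by linarith)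
    calc k ^ 2 * Real.exp τ ^ 2 = k * (k * Real.exp ((2 + y₀ / 2) * τ)) *
          Real.exp (-(2 * (y₀ / 4) * τ)) := by
          rw [← Real.exp_nat_mul, mul_assoc, mul_assoc k, ← Real.exp_add, ← mul_assoc, ← sq]
          congr 2; push_cast; ring
      _ ≤ 1 * 1 * Real.exp (-(2 * (y₀ / 4) * τ)) := by gcongr
      _ = _ := by ring
  calc 1 / a.mass * (480 * K ^ 4 * B ^ 2 * (k ^ 8 * Real.exp τ ^ 2))
      ≤ 1 / (2 * (y₀ / 4) / K ^ 2 * k ^ 2 * Real.exp (-(2 * (y₀ / 4) * τ))) *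
        (480 * K ^ 4 * B ^ 2 * (k ^ 8 * Real.exp τ ^ 2)) := by gcongr
    _ = 1 / (2 * (y₀ / 4) / K ^ 2 * k ^ 2 * Real.exp (-(2 * (y₀ / 4) * τ))) *
        (480 * K ^ 4 * B ^ 2 * (k ^ 6 * (k ^ 2 * Real.exp τ ^ 2))) := by ring
    _ ≤ 1 / (2 * (y₀ / 4) / K ^ 2 * k ^ 2 * Real.exp (-(2 * (y₀ / 4) * τ))) *
        (480 * K ^ 4 * B ^ 2 * (k ^ 6 * Real.exp (-(2 * (y₀ / 4) * τ)))) := by gcongr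
    _ = _ := by field_simp; ring

/-- For `|s| ≥ δ` the amplitude decays like `e^{-δτ}`. For `|x| ≥ δ` the Gaussian is `O(k⁴)`, which
outweighs the growth `e^τ` and still leaves `k e^{-δτ}`. -/
theorem norm_sq_le_of_far (hK : 1 ≤ K) (hk : 0 < k) (hk1 : k ≤ 1) (hτ : 0 ≤ τ) (hν : 0 < ν)
    (hkτ : k * Real.exp (5 * τ) ≤ 1) {δ : ℝ} (hδ : 0 < δ) (hδ1 : δ ≤ 1) (hkδ : k ^ 4 ≤ δ / 2)
    {p : Torus} (hp : δ ≤ |p.1.rep| ∨ δ ≤ |σ * p.2.rep - y₀|) :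
    ‖a.ψ p‖ ^ 2 ≤ (K * (1 + (ν + 1) / (δ / 2) ^ (ν + 1)) + 32 * K ^ 2 / δ ^ 2) ^ 2 *
      Real.exp (-(2 * δ * τ)) * (2 * p.1.gaussian k ^ 2 + 2 * k ^ 2) := by
  set T := K * (1 + (ν + 1) / (δ / 2) ^ (ν + 1)) with hT
  have hT0 : 0 < T := by positivity
  have hG := p.1.gaussian_pos k
  have hD0 : 0 < 32 * K ^ 2 / δ ^ 2 := by positivity
  have he := Real.exp_pos (-(δ * τ))
  have key : ‖a.ψ p‖ ≤ (T + 32 * K ^ 2 / δ ^ 2) * Real.exp (-(δ * τ)) * (p.1.gaussian k + k) := by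
    rcases hp with h | h
    · have h1 : ‖a.ψ p‖ ≤ 2 * K ^ 2 * Real.exp τ * p.1.gaussian k := by
        rw [a.eq_ψ]
        refine (norm_add_le _ _).trans ?_
        rw [norm_mul, norm_mul]
        have b1 := a.f0_le p.1
        have b2 := a.u0_le p.2
        have b3 := a.f1_le p.1
        have b4 := a.u1_le p.2
        have hk3 : k ^ 3 ≤ 1 := pow_le_one₀ hk.le hk1
        calc ‖a.f0 p.1‖ * ‖a.u0 p.2‖ + ‖a.f1 p.1‖ * ‖a.u1 p.2‖
            ≤ (K * p.1.gaussian k) * Real.exp τ + (K * k ^ 4 * p.1.gaussian k) * ‖a.u1 p.2‖ := by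
              gcongr
          _ = (K * p.1.gaussian k) * Real.exp τ
              + (K * k ^ 3 * p.1.gaussian k) * (k * ‖a.u1 p.2‖) := by ring
          _ ≤ (K * p.1.gaussian k) * Real.exp τ
              + (K * 1 * p.1.gaussian k) * (K * Real.exp τ) := by gcongr
          _ = (K + K ^ 2) * (Real.exp τ * p.1.gaussian k) := by ring
          _ ≤ (2 * K ^ 2) * (Real.exp τ * p.1.gaussian k) := by
              have : K + K ^ 2 ≤ 2 * K ^ 2 := by nlinarith
              gcongr
          _ = _ := by ring
      have h2 : p.1.gaussian k ≤ 16 * k ^ 4 / δ ^ 2 := by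
        have hx : δ ^ 2 ≤ p.1.rep ^ 2 := by rw [← sq_abs p.1.rep]; gcongr
        have hx' : 0 < δ ^ 2 / (16 * (k ^ 2) ^ 2) := by positivity
        have h3 : p.1.gaussian k ≤ Real.exp (-(δ ^ 2 / (16 * (k ^ 2) ^ 2))) := by
          unfold Circ.gaussian
          apply Real.exp_le_exp.2
          rw [neg_le_neg_iff]
          gcongr
        refine h3.trans ?_
        rw [Real.exp_neg, inv_le_comm₀ (Real.exp_pos _) (by positivity), inv_div]
        have := Real.add_one_le_exp (δ ^ 2 / (16 * (k ^ 2) ^ 2))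
        rw [← pow_mul] at this ⊢
        linarith
      have h4 : k ^ 4 * Real.exp τ ≤ k * Real.exp (-(δ * τ)) := by
        have h5 : k * Real.exp ((1 + δ) * τ) ≤ 1 := mul_exp_le_one_of_le hk hτ hkτ (by linarith)
        have h6 : Real.exp τ = Real.exp ((1 + δ) * τ) * Real.exp (-(δ * τ)) := by
          rw [← Real.exp_add]; congr 1; ring
        calc k ^ 4 * Real.exp τ = k * k ^ 2 * (k * Real.exp ((1 + δ) * τ)) * Real.exp (-(δ * τ)) := by
              rw [h6]; ring
          _ ≤ k * 1 * 1 * Real.exp (-(δ * τ)) := by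
              have : k ^ 2 ≤ 1 := pow_le_one₀ hk.le hk1
              gcongr
          _ = _ := by ring
      calc ‖a.ψ p‖ ≤ 2 * K ^ 2 * Real.exp τ * (16 * k ^ 4 / δ ^ 2) := h1.trans (by gcongr)
        _ = 32 * K ^ 2 / δ ^ 2 * (k ^ 4 * Real.exp τ) := by ring
        _ ≤ 32 * K ^ 2 / δ ^ 2 * (k * Real.exp (-(δ * τ))) := by gcongr
        _ = (0 + 32 * K ^ 2 / δ ^ 2) * Real.exp (-(δ * τ)) * (0 + k) := by ring
        _ ≤ _ := by gcongr
    · have h1 := a.norm_le δ hδ (by linarith) hkδ p h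
      calc ‖a.ψ p‖ ≤ (T + 0) * Real.exp (-(δ * τ)) * (p.1.gaussian k + 0) := by
            rw [add_zero, add_zero]; exact h1
        _ ≤ _ := by gcongr
  refine (pow_le_pow_left₀ (norm_nonneg _) key 2).trans ?_
  rw [mul_pow, mul_pow, ← Real.exp_nat_mul]
  have e : ((2 : ℕ) : ℝ) * -(δ * τ) = -(2 * δ * τ) := by push_cast; ring
  rw [e]
  gcongr
  nlinarith [sq_nonneg (p.1.gaussian k - k)]

/-- The density of the normalized quasimode concentrates on the set where `|x| < δ` and
`|y|` is within `δ` of `y₀`. -/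
theorem integral_mul_normalized_sq_le (hK : 1 ≤ K) (hk : 0 < k) (hk1 : k ≤ 1) (hτ : 0 ≤ τ)
    (hν : 0 < ν) (hkτ : k * Real.exp (5 * τ) ≤ 1) (hy0 : 0 < y₀) (hy : y₀ < Real.pi)
    (hσ : σ = 1 ∨ σ = -1) {δ : ℝ} (hδ : 0 < δ) (hδ1 : δ ≤ 1) (hkδ : k ^ 4 ≤ δ / 2)
    {α : Torus → ℝ} (hα : Continuous α) {M ε : ℝ} (hε : 0 ≤ ε) (hM : ∀ p, |α p| ≤ M)
    (hαε : ∀ p : Torus, |p.1.rep| < δ → |σ * p.2.rep - y₀| < δ → |α p| ≤ ε) :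
    |∫ p, α p * ‖a.normalized p‖ ^ 2| ≤ ε + M *
      (112 * (K * (1 + (ν + 1) / (δ / 2) ^ (ν + 1)) + 32 * K ^ 2 / δ ^ 2) ^ 2 * K ^ 2 /
        min (δ / 2) (y₀ / 2) * Real.exp (-(δ * τ))) := by
  have hZ := a.mass_pos hK hk hk1 hτ hy0 hy hσ
  set D := K * (1 + (ν + 1) / (δ / 2) ^ (ν + 1)) + 32 * K ^ 2 / δ ^ 2 with hD
  -- With `2μ ≤ δ` the mass is at least of order `k² e^{-δτ}`, against `e^{-2δτ}` in the density far
  -- away; the quotient decays like `e^{-δτ}`.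
  set μ := min (δ / 2) (y₀ / 2) with hμ
  have hμ0 : 0 < μ := by positivity
  have hμδ : μ ≤ δ / 2 := min_le_left _ _
  have hM0 : 0 ≤ M := (abs_nonneg _).trans (hM 0)
  have cn := a.continuous_normalized
  have cg : Continuous fun p : Torus => p.1.gaussian k :=
    (Circ.continuous_gaussian k).comp continuous_fst
  have hmass := a.le_mass hK hk hk1 hτ hy hσ hμ0 (min_le_right _ _)
  set E := D ^ 2 * Real.exp (-(2 * δ * τ)) / a.mass with hE
  have hE0 : 0 ≤ E := by positivity
  have hpt : ∀ p, ‖α p * ‖a.normalized p‖ ^ 2‖ ≤ ε * ‖a.normalized p‖ ^ 2 +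
      M * E * (2 * p.1.gaussian k ^ 2 + 2 * k ^ 2) := fun p => by
    have hn : 0 ≤ ‖a.normalized p‖ ^ 2 := by positivity
    have hg : 0 ≤ 2 * p.1.gaussian k ^ 2 + 2 * k ^ 2 := by positivity
    rw [Real.norm_eq_abs, abs_mul, abs_of_nonneg hn]
    by_cases hin : |p.1.rep| < δ ∧ |σ * p.2.rep - y₀| < δ
    · have := mul_le_mul_of_nonneg_right (hαε p hin.1 hin.2) hn
      have h2 : 0 ≤ M * E * (2 * p.1.gaussian k ^ 2 + 2 * k ^ 2) := by positivity
      linarith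
    · have hfar : δ ≤ |p.1.rep| ∨ δ ≤ |σ * p.2.rep - y₀| := by
        by_contra! hcon
        exact hin hcon
      have h1 := a.norm_sq_le_of_far hK hk hk1 hτ hν hkτ hδ hδ1 hkδ hfar
      have h2 : ‖a.normalized p‖ ^ 2 ≤ E * (2 * p.1.gaussian k ^ 2 + 2 * k ^ 2) := by
        rw [a.norm_normalized_sq hZ, hE, div_mul_eq_mul_div]
        gcongr
      have h3 := mul_le_mul (hM p) h2 hn hM0
      have h4 : 0 ≤ ε * ‖a.normalized p‖ ^ 2 := by positivity
      linarith
  have h1 : |∫ p, α p * ‖a.normalized p‖ ^ 2| ≤ ∫ p : Torus, (ε * ‖a.normalized p‖ ^ 2 +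
      M * E * (2 * p.1.gaussian k ^ 2 + 2 * k ^ 2)) :=
    norm_integral_le_of_norm_le (integrable_torus_of_continuous (by fun_prop))
      (Eventually.of_forall hpt)
  have h2 : ∫ p : Torus, (2 * p.1.gaussian k ^ 2 + 2 * k ^ 2) ≤ 224 * k ^ 2 := by
    rw [integral_add (integrable_torus_of_continuous (by fun_prop)) (integrable_const _),
      integral_const_mul]
    have g := integral_torus_gaussian_sq_le hk
    have hv := integral_torus_mul (fun _ => 1) (fun _ => 1)
    simp only [one_mul] at hv
    rw [Circ.integral_one] at hv
    have e : ∫ _ : Torus, 2 * k ^ 2 = 2 * k ^ 2 * ∫ _ : Torus, (1 : ℝ) := by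
      rw [← integral_const_mul, mul_one]
    rw [e, hv]
    have hpi := Real.pi_le_four
    have hpi0 := Real.pi_pos
    have : (2 * Real.pi) * (2 * Real.pi) ≤ 64 := by nlinarith
    nlinarith [mul_le_mul_of_nonneg_left this (sq_nonneg k)]
  rw [integral_add (integrable_torus_of_continuous (by fun_prop))
    (integrable_torus_of_continuous (by fun_prop)), integral_const_mul, integral_const_mul,
    a.integral_normalized_sq hZ, mul_one] at h1
  refine h1.trans (add_le_add le_rfl ?_)
  rw [mul_assoc]
  refine mul_le_mul_of_nonneg_left ?_ hM0
  have hμτ : Real.exp (-(δ * τ)) ≤ Real.exp (-(2 * μ * τ)) := Real.exp_le_exp.2 (by nlinarith)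
  have hee : Real.exp (-(2 * δ * τ)) = Real.exp (-(δ * τ)) * Real.exp (-(δ * τ)) := by
    rw [← Real.exp_add]; congr 1; ring
  calc E * ∫ p : Torus, (2 * p.1.gaussian k ^ 2 + 2 * k ^ 2) ≤ E * (224 * k ^ 2) := by gcongr
    _ ≤ D ^ 2 * Real.exp (-(2 * δ * τ)) / (2 * μ / K ^ 2 * k ^ 2 * Real.exp (-(δ * τ))) *
        (224 * k ^ 2) := by
        rw [hE]
        gcongr
        refine le_trans ?_ hmass
        gcongr
    _ = _ := by rw [hee]; field_simp; ring

end Ansatz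

/-! ### The constant quasimode, passage to the limit, and the conclusion. -/

theorem eLpNorm_torus_const (d : ℝ) :
    eLpNorm (fun _ : Torus => (d : ℂ)) 2 volume = ENNReal.ofReal (2 * Real.pi * |d|) := by
  rw [eLpNorm_two_eq_sqrt_of_continuous continuous_const]
  congr 1
  have hv := integral_torus_mul (fun _ => 1) (fun _ => 1)
  simp only [one_mul] at hv
  rw [Circ.integral_one] at hv
  have e : ∫ _ : Torus, ‖(d : ℂ)‖ ^ 2 = d ^ 2 * ∫ _ : Torus, (1 : ℝ) := by
    rw [← integral_const_mul, mul_one, Complex.norm_real, Real.norm_eq_abs, sq_abs]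
  rw [e, hv, ← sq, ← mul_pow, Real.sqrt_sq_eq_abs, abs_mul, abs_of_pos Real.two_pi_pos, mul_comm]

theorem exists_ae_bound_of_memLp_top {X : Type*} [MeasurableSpace X] {μ : Measure X} {f : X → ℝ}
    (hf : MemLp f ∞ μ) : ∃ M : ℝ, 0 ≤ M ∧ ∀ᵐ x ∂μ, |f x| ≤ M := by
  refine ⟨(eLpNorm f ∞ μ).toReal, ENNReal.toReal_nonneg, ?_⟩
  have hfin := hf.2.ne
  rw [eLpNorm_exponent_top] at hfin ⊢
  filter_upwards [enorm_ae_le_eLpNormEssSup f μ] with x hx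
  have := ENNReal.toReal_mono hfin hx
  rwa [toReal_enorm, Real.norm_eq_abs] at this

theorem IsQuasimode.mono {V b : Circ → ℝ} {h β r r' : ℝ} {ψ : Torus → ℂ}
    (hψ : IsQuasimode V b h β r ψ) (hr : r ≤ r') : IsQuasimode V b h β r' ψ := by
  obtain ⟨h1, h2, g, h3, h4, h5⟩ := hψ
  exact ⟨h1, h2, g, h3, h4, h5.trans (ENNReal.ofReal_le_ofReal hr)⟩

/-- The normalized constant function is a quasimode with width of order one. -/
theorem isQuasimode_const {V b : Circ → ℝ} (hV : Continuous V) {M : ℝ}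
    (hM : ∀ᵐ p : Torus, |b p.2| ≤ M) (hM0 : 0 ≤ M) {h β L : ℝ} (hh : 0 < h) (hh1 : h ≤ 1)
    (hβ : 0 ≤ β) (hβL : β ≤ L) :
    IsQuasimode V b h β (M + 1 + L) (fun _ => ((1 / (2 * Real.pi) : ℝ) : ℂ)) := by
  have hpi := Real.two_pi_pos
  have hL0 : 0 ≤ L := hβ.trans hβL
  refine ⟨memLp_two_of_continuous continuous_const, ?_, fun _ => 0,
    memLp_two_of_continuous continuous_const, isWeakGrushin_const hV _, ?_⟩
  · rw [eLpNorm_torus_const, abs_of_pos (by positivity), mul_one_div_cancel hpi.ne']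
    simp
  · have hae : ∀ᵐ p : Torus, ‖quasimodeResidual h β b (fun _ => ((1 / (2 * Real.pi) : ℝ) : ℂ))
        (fun _ => 0) p‖ ≤ ‖(((M + 1 + L) / (2 * Real.pi) : ℝ) : ℂ)‖ := by
      filter_upwards [hM] with p hp
      have e : quasimodeResidual h β b (fun _ => ((1 / (2 * Real.pi) : ℝ) : ℂ)) (fun _ => 0) p =
          ((1 / (2 * Real.pi) : ℝ) : ℂ) * (Complex.I * ((h * b p.2 : ℝ) : ℂ) - 1
            - Complex.I * ((h * β : ℝ) : ℂ)) := by
        unfold quasimodeResidual; push_cast; ring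
      rw [e, norm_mul, Complex.norm_real, Complex.norm_real, Real.norm_of_nonneg (by positivity),
        Real.norm_of_nonneg (by positivity), one_div, ← div_eq_inv_mul]
      gcongr
      refine (norm_sub_le _ _).trans ((add_le_add (norm_sub_le _ _) le_rfl).trans ?_)
      rw [norm_mul, norm_mul, Complex.norm_I, one_mul, one_mul, Complex.norm_real, Complex.norm_real,
        Real.norm_eq_abs, Real.norm_eq_abs, abs_mul, abs_mul, abs_of_pos hh, abs_of_nonneg hβ,
        norm_one]
      have h1 : h * |b p.2| ≤ 1 * M := by gcongr
      have h2 : h * β ≤ 1 * L := by gcongr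
      linarith
    refine (eLpNorm_mono_ae hae).trans ?_
    rw [eLpNorm_torus_const, abs_of_nonneg (by positivity), mul_div_cancel₀ _ hpi.ne']

/-- The triangle inequality in both directions squeezes the norm between `1 - C t` and `1 + C t`. -/
theorem tendsto_one_of_eLpNorm_sub_le {F G : ℝ → Torus → ℂ} {C h₀ : ℝ} (hh₀ : 0 < h₀)
    (h : ∀ t, 0 < t → t ≤ h₀ → Continuous (F t) ∧ Continuous (G t) ∧ eLpNorm (F t) 2 volume = 1 ∧
      eLpNorm (G t - F t) 2 volume ≤ ENNReal.ofReal (C * t)) :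
    Tendsto (fun t => eLpNorm (G t) 2 volume) (𝓝[>] 0) (𝓝 1) := by
  have hlim : Tendsto (fun t : ℝ => ENNReal.ofReal (C * t)) (𝓝[>] 0) (𝓝 0) := by
    have : Tendsto (fun t : ℝ => ENNReal.ofReal (C * t)) (𝓝 0) (𝓝 (ENNReal.ofReal (C * 0))) :=
      (ENNReal.continuous_ofReal.comp (continuous_const.mul continuous_id)).tendsto 0
    rw [mul_zero, ENNReal.ofReal_zero] at this
    exact this.mono_left nhdsWithin_le_nhds
  have hl : Tendsto (fun t : ℝ => 1 - ENNReal.ofReal (C * t)) (𝓝[>] 0) (𝓝 1) := by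
    have := ENNReal.Tendsto.sub (tendsto_const_nhds (x := (1 : ℝ≥0∞))) hlim (Or.inl (by simp))
    rwa [tsub_zero] at this
  have hu : Tendsto (fun t : ℝ => ENNReal.ofReal (C * t) + 1) (𝓝[>] 0) (𝓝 1) := by
    simpa using hlim.add (tendsto_const_nhds (x := (1 : ℝ≥0∞)))
  have hev : ∀ᶠ t : ℝ in 𝓝[>] 0, 0 < t ∧ t ≤ h₀ := by
    filter_upwards [Ioc_mem_nhdsGT hh₀] with t ht using ht
  refine tendsto_of_tendsto_of_tendsto_of_le_of_le' hl hu ?_ ?_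
  · filter_upwards [hev] with t ht
    obtain ⟨cF, cG, h1, h2⟩ := h t ht.1 ht.2
    rw [tsub_le_iff_right]
    calc (1 : ℝ≥0∞) = eLpNorm (G t + (F t - G t)) 2 volume := by rw [← h1]; congr 1; abel
      _ ≤ eLpNorm (G t) 2 volume + eLpNorm (F t - G t) 2 volume :=
        eLpNorm_add_le cG.aestronglyMeasurable (cF.sub cG).aestronglyMeasurable (by norm_num)
      _ ≤ _ := by
        rw [eLpNorm_sub_comm]
        gcongr
  · filter_upwards [hev] with t ht
    obtain ⟨cF, cG, h1, h2⟩ := h t ht.1 ht.2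
    calc eLpNorm (G t) 2 volume = eLpNorm ((G t - F t) + F t) 2 volume := by congr 1; abel
      _ ≤ eLpNorm (G t - F t) 2 volume + eLpNorm (F t) 2 volume :=
        eLpNorm_add_le (cG.sub cF).aestronglyMeasurable cF.aestronglyMeasurable (by norm_num)
      _ ≤ _ := by rw [h1]; gcongr

theorem exists_delta_of_continuous_torus {a : Torus → ℝ} (ha : Continuous a) (σ y₀ : ℝ)
    (hσ : σ = 1 ∨ σ = -1) {ε : ℝ} (hε : 0 < ε) :
    ∃ δ : ℝ, 0 < δ ∧ δ ≤ 1 ∧ ∀ p : Torus, |p.1.rep| < δ → |σ * p.2.rep - y₀| < δ →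
      |a p - a (((0 : ℝ) : Circ), ((σ * y₀ : ℝ) : Circ))| ≤ ε := by
  have hc : Continuous fun q : ℝ × ℝ => a ((q.1 : Circ), (q.2 : Circ)) :=
    ha.comp (((AddCircle.continuous_mk' _).comp continuous_fst).prodMk
      ((AddCircle.continuous_mk' _).comp continuous_snd))
  obtain ⟨δ, hδ, h⟩ := Metric.continuous_iff.1 hc (0, σ * y₀) ε hε
  refine ⟨min δ 1, by positivity, min_le_right _ _, fun p h1 h2 => ?_⟩
  have h3 : |p.2.rep - σ * y₀| = |σ * p.2.rep - y₀| := by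
    rcases hσ with rfl | rfl
    · congr 1; ring
    · rw [← abs_neg]; congr 1; ring
  have h4 := h (p.1.rep, p.2.rep) (by
    rw [Prod.dist_eq, Real.dist_eq, Real.dist_eq, sub_zero, h3]
    exact max_lt (h1.trans_le (min_le_left _ _)) (h2.trans_le (min_le_left _ _)))
  simp only [Circ.coe_rep] at h4
  exact h4.le

theorem theorem5p4 (ν : ℝ) (hν : 1 < ν) :
    ∃ C₁ : ℝ, 0 < C₁ ∧
    ∀ y₀ : ℝ, 0 < y₀ → y₀ < Real.pi →
    ∃ C₀ : ℝ, 0 < C₀ ∧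
    ∀ ρ : ℝ, 0 < ρ → ρ < 1 → y₀ + ρ < Real.pi →
    ∀ V : Circ → ℝ, IsGrushinPotential V →
    ∀ b : Circ → ℝ, MemW1Infty (fun p : Torus => b p.2) →
      IsWidelyUndampedProfile ν y₀ ρ b →
    ∃ C : ℝ, 0 < C ∧
    ∀ β : ℝ → ℝ, (∀ h : ℝ, 0 < h → h ≤ 1 → 0 ≤ β h ∧ β h ≤ C₁ * h * Real.log (1 / h)) →
    ∀ σ : ℝ, (σ = 1 ∨ σ = -1) →
    ∃ ψ : ℝ → Torus → ℂ,
      (∀ h : ℝ, 0 < h → h ≤ 1 →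
        IsQuasimode V b h (β h) (C * h ^ 2 * Real.exp (-(C₀ * β h / h))) (ψ h)) ∧
      SubellipticConcentration ψ ∧
      (Tendsto (fun h : ℝ => β h / h) (𝓝[>] 0) atTop →
        DensityTendstoDirac ψ (((0 : ℝ) : Circ), ((σ * y₀ : ℝ) : Circ))) := by
  -- `C₁ = 1/10` is exactly what makes `√h · exp(5 β / h) ≤ 1`, and `C₀ = y₀ / 4` is the exponent of
  -- `Ansatz.isQuasimode`.
  refine ⟨1 / 10, by norm_num, fun y₀ hy0 hyπ => ⟨y₀ / 4, by positivity, ?_⟩⟩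
  intro ρ hρ hρ1 hyρ V hV b hbW hb
  obtain ⟨K, k₀, hK, hk₀, hk₀1, hans⟩ := exists_ansatz hV hb hν hy0 hρ hρ1 hyρ
  -- Nothing bounds `c` in the profile, so the `L^∞` part of `W^{1,∞}` supplies the bound on `b` for
  -- the constant quasimode.
  obtain ⟨M, hM0, hM⟩ := exists_ae_bound_of_memLp_top hbW.1
  set L := Real.log (1 / k₀ ^ 2) with hL
  have hk₀2 : k₀ ^ 2 ≤ 1 := pow_le_one₀ hk₀.le hk₀1
  have hk₀p : 0 < k₀ ^ 2 := by positivity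
  have hL0 : 0 ≤ L := Real.log_nonneg ((one_le_div hk₀p).2 hk₀2)
  -- For `h ≥ k₀²` one has `β / h ≤ L`, so `m` bounds `h² exp(-C₀ β / h)` from below and a width of
  -- order one is admissible.
  set m := (k₀ ^ 2) ^ 2 * Real.exp (-(y₀ / 4 * L)) with hm
  have hm0 : 0 < m := by positivity
  have hs0 : 0 < √(y₀ / 2) := Real.sqrt_pos.2 (by positivity)
  set Cs := 7 * K ^ 2 / √(y₀ / 2) with hCs
  have hCs0 : 0 < Cs := by positivity
  set Cl := (M + 1 + L) / m with hCl
  have hCl0 : 0 < Cl := by positivity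
  refine ⟨Cs + Cl, by positivity, fun β hβ σ hσ => ?_⟩
  have hτ : ∀ h, 0 < h → h ≤ 1 → 0 ≤ β h / h ∧ β h / h ≤ 1 / 10 * Real.log (1 / h) :=
    fun h hh hh1 => by
      obtain ⟨h1, h2⟩ := hβ h hh hh1
      refine ⟨by positivity, ?_⟩
      rw [div_le_iff₀ hh]
      linarith
  have hsmall : ∀ h, 0 < h → h ≤ k₀ ^ 2 → 0 < √h ∧ √h ≤ k₀ ∧ √h ≤ 1 ∧ 0 ≤ β h / h ∧
      √h * Real.exp (5 * (β h / h)) ≤ 1 := fun h hh hhk => by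
    have hsq : √h ≤ k₀ := by rw [Real.sqrt_le_left hk₀.le]; exact hhk
    obtain ⟨h1, h2⟩ := hτ h hh (hhk.trans hk₀2)
    refine ⟨Real.sqrt_pos.2 hh, hsq, hsq.trans hk₀1, h1, ?_⟩
    rw [← Real.exp_log (Real.sqrt_pos.2 hh), ← Real.exp_add, Real.exp_le_one_iff,
      Real.log_sqrt hh.le]
    have hlog : Real.log (1 / h) = -Real.log h := by rw [one_div, Real.log_inv]
    rw [hlog] at h2
    linarith
  -- Both regimes are put into one existence statement, so that a single choice defines the family
  -- for all `h`.
  have hex : ∀ h : ℝ, ∃ φ : Torus → ℂ,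
      (0 < h → h ≤ k₀ ^ 2 → ∃ a : Ansatz V b ν y₀ K (√h) (β h / h) σ, φ = a.normalized) ∧
      (k₀ ^ 2 < h → φ = fun _ => ((1 / (2 * Real.pi) : ℝ) : ℂ)) := by
    intro h
    by_cases hc : 0 < h ∧ h ≤ k₀ ^ 2
    · obtain ⟨s1, s2, -, s3, s4⟩ := hsmall h hc.1 hc.2
      obtain ⟨a⟩ := hans (√h) (β h / h) σ s1 s2 s3 s4 hσ
      exact ⟨a.normalized, fun _ _ => ⟨a, rfl⟩, fun hlt => absurd hc.2 (not_le.2 hlt)⟩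
    · exact ⟨_, fun h1 h2 => absurd ⟨h1, h2⟩ hc, fun _ => rfl⟩
  choose ψ hψ hψc using hex
  refine ⟨ψ, fun h hh hh1 => ?_, fun χ hχ => ?_, fun hlim a => ?_⟩
  · rcases le_or_gt h (k₀ ^ 2) with hle | hlt
    · obtain ⟨a, ha⟩ := hψ h hh hle
      obtain ⟨s1, -, s2, s3, s4⟩ := hsmall h hh hle
      have := a.isQuasimode hK s1 s2 s3 hy0 hyπ hσ
      rw [Real.sq_sqrt hh.le, ← ha, mul_div_cancel₀ _ hh.ne'] at this
      refine this.mono ?_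
      have e : y₀ / 4 * β h / h = y₀ / 4 * (β h / h) := mul_div_assoc _ _ _
      rw [e]
      gcongr
      linarith
    · rw [hψc h hlt]
      obtain ⟨t1, t2⟩ := hτ h hh hh1
      have hlog : Real.log (1 / h) ≤ L :=
        Real.log_le_log (by positivity) (one_div_le_one_div_of_le hk₀p hlt.le)
      have hτL : β h / h ≤ L := by linarith
      have hβL : β h ≤ L := by
        rw [div_le_iff₀ hh] at hτL
        nlinarith
      refine (isQuasimode_const hV.continuous hM hM0 hh hh1 (hβ h hh hh1).1 hβL).mono ?_
      have hlow : m ≤ h ^ 2 * Real.exp (-(y₀ / 4 * β h / h)) := by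
        rw [hm, mul_div_assoc]
        gcongr
      calc M + 1 + L = Cl * m := by rw [hCl]; field_simp
        _ ≤ (Cs + Cl) * (h ^ 2 * Real.exp (-(y₀ / 4 * β h / h))) := by
          gcongr
          linarith
        _ = _ := by ring
  · obtain ⟨B, hB0, hB⟩ := hχ.exists_bound
    -- The inner limit is already `1` for every `R ≥ 4`, so the outer one is trivial.
    refine ⟨fun _ => 1, ?_, tendsto_const_nhds⟩
    filter_upwards [eventually_ge_atTop 4] with R hR
    refine tendsto_one_of_eLpNorm_sub_le (F := ψ) (C := √(960 * K ^ 6 * B ^ 2 / y₀)) hk₀p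
      fun h hh hle => ?_
    obtain ⟨a, ha⟩ := hψ h hh hle
    obtain ⟨s1, -, s2, s3, s4⟩ := hsmall h hh hle
    have := a.eLpNorm_multY_sub_le hK s1 s2 s3 s4 hy0 hyπ hσ hχ (hB R) hR
    rw [Real.sq_sqrt hh.le, ← ha] at this
    refine ⟨?_, this.1, ?_, this.2⟩
    · rw [ha]; exact a.continuous_normalized
    · rw [ha]; exact a.eLpNorm_normalized (a.mass_pos hK s1 s2 s3 hy0 hyπ hσ)
  · set q : Torus := (((0 : ℝ) : Circ), ((σ * y₀ : ℝ) : Circ)) with hq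
    rw [Metric.tendsto_nhds]
    intro ε hε
    obtain ⟨δ, hδ, hδ1, hnear⟩ := exists_delta_of_continuous_torus a.continuous σ y₀ hσ (half_pos hε)
    obtain ⟨A, hA⟩ := isCompact_univ.exists_bound_of_continuousOn
      (f := fun p => a p - a q) (by fun_prop)
    set D := 112 * (K * (1 + (ν + 1) / (δ / 2) ^ (ν + 1)) + 32 * K ^ 2 / δ ^ 2) ^ 2 * K ^ 2 /
        min (δ / 2) (y₀ / 2) with hD
    have hdec : Tendsto (fun h : ℝ => A * (D * Real.exp (-(δ * (β h / h))))) (𝓝[>] 0) (𝓝 0) := by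
      have h1 := Real.tendsto_exp_neg_atTop_nhds_zero.comp (hlim.const_mul_atTop hδ)
      simpa using (h1.const_mul D).const_mul A
    have e1 : ∀ᶠ h : ℝ in 𝓝[>] 0, A * (D * Real.exp (-(δ * (β h / h)))) < ε / 2 :=
      hdec.eventually_lt_const (half_pos hε)
    have e2 : ∀ᶠ h : ℝ in 𝓝[>] 0, 0 < h ∧ h ≤ min (k₀ ^ 2) (δ / 2) := by
      filter_upwards [Ioc_mem_nhdsGT (by positivity : 0 < min (k₀ ^ 2) (δ / 2))] with t ht using ht
    filter_upwards [e1, e2] with h h1 h2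
    obtain ⟨hh, hle'⟩ := h2
    have hle := hle'.trans (min_le_left _ _)
    obtain ⟨an, ha⟩ := hψ h hh hle
    obtain ⟨s1, -, s2, s3, s4⟩ := hsmall h hh hle
    have hmass := an.mass_pos hK s1 s2 s3 hy0 hyπ hσ
    -- Since `√h ^ 4 = h²` and `h ≤ 1`, the bound `h ≤ δ / 2` suffices.
    have hkδ : √h ^ 4 ≤ δ / 2 := by
      have : √h ^ 4 = h ^ 2 := by
        rw [show √h ^ 4 = (√h ^ 2) ^ 2 by ring, Real.sq_sqrt hh.le]
      rw [this]
      have := hle'.trans (min_le_right _ _)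
      nlinarith
    have hbound := an.integral_mul_normalized_sq_le hK s1 s2 s3 (by linarith) s4 hy0 hyπ hσ hδ hδ1
      hkδ (α := fun p => a p - a q) (by fun_prop) (half_pos hε).le (fun p => hA p trivial) hnear
    have cn := an.continuous_normalized
    have e3 : ∫ p, (a p - a q) * ‖an.normalized p‖ ^ 2 =
        (∫ p, a p * ‖an.normalized p‖ ^ 2) - a q := by
      simp_rw [sub_mul]
      rw [integral_sub (integrable_torus_of_continuous (by fun_prop))
        (integrable_torus_of_continuous (by fun_prop)), integral_const_mul,
        an.integral_normalized_sq hmass, mul_one]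
    rw [e3, ← ha] at hbound
    rw [Real.dist_eq]
    linarith
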